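/- Let $G$ be a locally compact totally disconnected topological group, $A\le G$ a closed central subgroup and $\mathbb F$ a field of characteristic $p\ge 0$. **Categories.** A representation $(\pi,V)$ of $G$ over $\mathbb F$ is smooth if every $v\in V$ is fixed by some compact open subgroup of $G$. Let $\mathcal M_A(G)$ be the category of smooth representations of $G$ over $\mathbb F$ whose restriction to $A$ is semisimple. Let $\chi:A\to\widetilde{\mathbb F}^\times$ be a character with values in a field extension $\widetilde{\mathbb F}\supseteq\mathbb F$ that is generated as an $\mathbb F$-algebra by $\chi(A)$, and let $\mathcal M_{A,\chi}(G)\subseteq\mathcal M_A(G)$ be the full subcategory of those representations that, as representations of $A$, are direct sums of copies of $\widetilde{\mathbb F}$ with $A$ acting by multiplication through $\chi$. The projective dimension of an object is the minimal length of a resolution by projective objects of the category, and the projective dimension $\mathrm{pd}$ of a category is the supremum of the projective dimensions of its objects. **Actions.** Let $\mathcal X_\bullet$ be a simplicial set with face maps $d_i$ and degeneracy maps $s_i$. An action of $G$ on $\mathcal X_\bullet$ consists of actions of $G$ on all the sets $\mathcal X_k$ together with maps $R=R_k:G\times\mathcal X_k\to \mathrm{Sym}(\{0,\dots,k\})$ such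 that, for all $g,h\in G$ and $x\in\mathcal X_k$, 1. $R(1,x)=1$ and $R(gh,x)=R(g,hx)\,R(h,x)$; 2. with $\phi=R(g,x)$: for $k\geq 1$, $R(g,d_ix)$ is the permutation of $\{0,\dots,k-1\}$ obtained from the bijection $\{0,\dots,k\}\setminus\{i\}\to\{0,\dots,k\}\setminus\{\phi(i)\}$ induced by $\phi$ by renumbering both sides in increasing order, and $R(g,s_ix)$ is the permutation $\psi$ of $\{0,\dots,k+1\}$ with $\psi(i)=\phi(i)$, $\psi(i+1)=\phi(i)+1$ and $\sigma^{\phi(i)}\circ\psi=\phi\circ\sigma^i$, where $\sigma^j:\{0,\dots,k+1\}\to\{0,\dots,k\}$ is the non-decreasing surjection that takes the value $j$ twice; 3. $g\cdot d_i x=d_{R(g,x)(i)}(g\cdot x)$ for $k\ge 1$ and $0\le i\le k$; 4. $g\cdot s_i x=s_{R(g,x)(i)}(g\cdot x)$ for $0\le i\le k$. (Thus $g$ takes the $i$-th vertex of $x$ to the $R(g,x)(i)$-th vertex of $g\cdot x$, and $G$ acts on the geometric realisation $|\mathcal X|$ by permuting barycentric coordinates.) The action is continuous if the action of $G$ on each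 discrete set $\mathcal X_k$ is continuous. **Theorem.** Suppose that $G$ acts continuously on an $n$-dimensional simplicial set $\mathcal X_\bullet$ whose geometric realisation $|\mathcal X|$ is contractible, and that $A$ acts trivially on all the sets $\mathcal X_k$. Suppose that for every non-degenerate simplex $x$ the stabiliser $G_x$ is compact modulo $A$, i.e. $G_x/A$ is compact, and that $\mathbb F$ is $G_x/A$-ordinary, i.e. $p=0$ or $p$ does not divide the index of any open subgroup of $G_x/A$ (equivalently, $p$ does not divide the order of the profinite group $G_x/A$). Then $$\mathrm{pd}(\mathcal M_{A,\chi}(G))\le n\quad\text{for every such }\chi,\qquad\text{and}\qquad \mathrm{pd}(\mathcal M_A(G))\le n .$$ -/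

import Mathlib

open CategoryTheory CategoryTheory.Limits Simplicial Pointwise Topology

universe u

noncomputable section

namespace SmoothRep

/-! ### Ordinary fields -/

/-- The characteristic `p` of `F` does not divide the order of the profinite group `K`.
The order of `K` is the supernatural number `lcm` of the indices of the open subgroups of `K`,
so a prime divides it exactly when it divides one of these indices. These indices are finite and
non-zero for compact `K`, hence a field of characteristic `0` is always ordinary. -/
def IsOrdinary (F : Type u) [Field F] (K : Type u) [Group K] [TopologicalSpace K] : Prop :=
  ∀ U : OpenSubgroup K, ¬ ringChar F ∣ (U : Subgroup K).index

section Groups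

variable {G : Type u} [Group G]

theorem normal_subgroupOf_of_le_center {A : Subgroup G} (hA : A ≤ Subgroup.center G)
    (H : Subgroup G) : (A.subgroupOf H).Normal := by
  constructor
  intro a ha h
  have hc := Subgroup.mem_center_iff.1 (hA ha) h
  have : h * a * h⁻¹ = a := by
    apply Subtype.ext
    simp only [Subgroup.coe_mul, Subgroup.coe_inv]
    simp only [Subgroup.coe_subtype] at hc
    rw [hc, mul_inv_cancel_right]
  rwa [this]

/-- `H / A` is compact (in the quotient topology). -/
def IsCompactModulo [TopologicalSpace G] (A H : Subgroup G) : Prop :=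
  CompactSpace (H ⧸ A.subgroupOf H)

/-- The field `F` is `H / A`-ordinary, where `A` is central. -/
def IsOrdinaryModulo [TopologicalSpace G] (F : Type u) [Field F] {A : Subgroup G}
    (hA : A ≤ Subgroup.center G) (H : Subgroup G) : Prop :=
  haveI := normal_subgroupOf_of_le_center hA H
  IsOrdinary F (H ⧸ A.subgroupOf H)

end Groups

/-! ### Categories of smooth representations -/

section Categories

variable (F : Type u) [Field F] (G : Type u) [Group G] [TopologicalSpace G]

/-- Every vector is fixed by a compact open subgroup. -/
def IsSmooth : ObjectProperty (Rep.{u} F G) := fun V =>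
  ∀ v : V, ∃ K : Subgroup G, IsCompact (K : Set G) ∧ IsOpen (K : Set G) ∧
    ∀ k ∈ K, V.ρ k v = v

variable {G}

/-- The restriction of the representation to `A` is semisimple. -/
def IsSemisimpleOn (A : Subgroup G) : ObjectProperty (Rep.{u} F G) := fun V =>
  Representation.IsSemisimpleRepresentation (V.ρ.comp A.subtype)

/-- Smooth representations of `G` that are semisimple over `A`. -/
def isInMA (A : Subgroup G) : ObjectProperty (Rep.{u} F G) := fun V =>
  IsSmooth F G V ∧ IsSemisimpleOn F A V

variable {F}

/-- An element of `Irr (F A)`: the field `Ft ⊇ F` is generated, as an `F`-algebra, by the values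
of the character `χ`. -/
def IsIrrCharacter {A : Subgroup G} {Ft : Type u} [Field Ft] [Algebra F Ft]
    (χ : A →* Ftˣ) : Prop :=
  Algebra.adjoin F (Set.range fun a => (χ a : Ft)) = ⊤

/-- As a representation of `A`, `V` is a direct sum of copies of `Ft`, on which `A` acts by
multiplication through `χ`. -/
def IsSumOfCharacter {A : Subgroup G} {Ft : Type u} [Field Ft] [Algebra F Ft]
    (χ : A →* Ftˣ) : ObjectProperty (Rep.{u} F G) := fun V =>
  ∃ (ι : Type u) (e : V ≃ₗ[F] (ι →₀ Ft)),
    ∀ (a : A) (v : V) (i : ι), e (V.ρ a v) i = χ a * e v i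

/-- `A`-semisimple smooth representations of `G` that are direct sums of copies of `Ft_χ` as
representations of `A`. -/
def isInMAChar {A : Subgroup G} {Ft : Type u} [Field Ft] [Algebra F Ft]
    (χ : A →* Ftˣ) : ObjectProperty (Rep.{u} F G) := fun V =>
  isInMA F A V ∧ IsSumOfCharacter χ V

variable (F)

/-- The category `M_A(G)`. -/
abbrev MA (A : Subgroup G) := (isInMA F A).FullSubcategory

/-- The category `M_{A,χ}(G)`. -/
abbrev MAChar {A : Subgroup G} {Ft : Type u} [Field Ft] [Algebra F Ft]
    (χ : A →* Ftˣ) := (isInMAChar (F := F) χ).FullSubcategory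

/-! The next facts only serve to see that the two categories have a zero object. -/

section Zero

variable [IsTopologicalGroup G] [LocallyCompactSpace G] [TotallyDisconnectedSpace G]

variable (G) in
theorem exists_compact_open_subgroup :
    ∃ K : Subgroup G, IsCompact (K : Set G) ∧ IsOpen (K : Set G) := by
  obtain ⟨s, hs, h1s, -⟩ := exists_compact_subset (isOpen_univ (X := G)) (Set.mem_univ 1)
  obtain ⟨W, hW, h1W, hWs⟩ :=
    loc_compact_Haus_tot_disc_of_zero_dim.mem_nhds_iff.1 (isOpen_interior.mem_nhds h1s)
  have hWc : IsCompact W := hs.of_isClosed_subset hW.1 (hWs.trans interior_subset)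
  obtain ⟨V, hV, hVW⟩ := compact_open_separated_mul_left hWc hW.2 subset_rfl
  let K : Subgroup G := MulAction.stabilizer G W
  have hKo : IsOpen (K : Set G) := by
    refine K.isOpen_of_mem_nhds (g := 1) ?_
    filter_upwards [hV, inv_mem_nhds_one G hV] with g hg hg'
    refine MulAction.mem_stabilizer_iff.2 (Set.Subset.antisymm ?_ ?_)
    · rintro _ ⟨w, hw, rfl⟩
      exact hVW (Set.mul_mem_mul hg hw)
    · intro w hw
      exact Set.mem_smul_set_iff_inv_smul_mem.2 (hVW (Set.mul_mem_mul (Set.mem_inv.1 hg') hw))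
  refine ⟨K, hWc.of_isClosed_subset (K.isClosed_of_isOpen hKo) ?_, hKo⟩
  intro g hg
  have h : g • W = W := MulAction.mem_stabilizer_iff.1 hg
  rw [← h]
  exact ⟨1, h1W, mul_one g⟩

theorem isInMA_of_subsingleton (A : Subgroup G) (V : Rep.{u} F G) [Subsingleton V] :
    isInMA F A V := by
  obtain ⟨K, hK⟩ := exists_compact_open_subgroup G
  refine ⟨fun v => ⟨K, hK.1, hK.2, fun _ _ => Subsingleton.elim _ _⟩, ?_⟩
  refine ⟨fun a => ⟨⊥, ?_⟩⟩
  have : a = ⊥ := by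
    apply SetLike.ext
    intro v
    rw [Subsingleton.elim v 0]
    exact ⟨fun _ => zero_mem (⊥ : Submodule F V), fun _ => zero_mem a.toSubmodule⟩
  have h : (⊥ : Subrepresentation (V.ρ.comp A.subtype)) = ⊤ := by
    apply SetLike.ext
    intro v
    rw [Subsingleton.elim v 0]
    exact ⟨fun _ => Set.mem_univ _, fun _ => zero_mem (⊥ : Submodule F V)⟩
  rw [this]
  exact ⟨disjoint_bot_left, codisjoint_iff.2 (by simpa using h)⟩

instance (A : Subgroup G) : (isInMA F A).ContainsZero where
  exists_zero := ⟨Rep.trivial F G PUnit, (Rep.isZero_iff _ _ _).2 inferInstance,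
    isInMA_of_subsingleton F A _⟩

instance {A : Subgroup G} {Ft : Type u} [Field Ft] [Algebra F Ft] (χ : A →* Ftˣ) :
    (isInMAChar (F := F) χ).ContainsZero where
  exists_zero := ⟨Rep.trivial F G PUnit, (Rep.isZero_iff _ _ _).2 inferInstance,
    isInMA_of_subsingleton F A _, PEmpty, 0, fun _ _ i => i.elim⟩

end Zero

end Categories

/-! ### Projective dimension -/

section ProjectiveDimension

variable {C : Type*} [Category C] [HasZeroObject C] [HasZeroMorphisms C]

/-- `V` has a projective resolution `0 → P_n → ⋯ → P_0 → V → 0`. -/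
def HasProjectiveResolutionLE (V : C) (n : ℕ) : Prop :=
  ∃ P : ProjectiveResolution V, ∀ i, n < i → IsZero (P.complex.X i)

/-- The minimal length of a projective resolution of `V` (`⊤` if there is no finite one). -/
def projDim (V : C) : ℕ∞ :=
  ⨅ (n : ℕ) (_ : HasProjectiveResolutionLE V n), (n : ℕ∞)

variable (C) in
/-- The projective dimension of a category: the supremum over its objects. -/
def categoryProjDim : ℕ∞ := ⨆ V : C, projDim V

end ProjectiveDimension

/-! ### Group actions on simplicial sets -/

section Actions

variable (G : Type u) [Group G] (X : SSet.{u}) [∀ k, MulAction G (X _⦋k⦌)]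

/-- The action of `G` on each discrete set of simplices is continuous. -/
def IsContinuousAction [TopologicalSpace G] : Prop :=
  ∀ k : ℕ,
    letI : TopologicalSpace (X _⦋k⦌) := ⊥
    ContinuousSMul G (X _⦋k⦌)

variable {G X}

/-- The action of `G` on the sets of simplices respects the simplicial structure up to the
permutations `R g x` of the vertices of simplices: the `i`-th vertex of `x` is sent by `g` to the
vertex number `R g x i` of `g • x`. This is what makes `G` act on the geometric realisation, by
permuting barycentric coordinates. -/
structure IsCrossedAction (R : ∀ {k : ℕ}, G → X _⦋k⦌ → Equiv.Perm (Fin (k + 1))) : Prop where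
  /-- `R` is a groupoid map -/
  map_one : ∀ {k : ℕ} (x : X _⦋k⦌), R 1 x = 1
  map_mul : ∀ {k : ℕ} (g h : G) (x : X _⦋k⦌), R (g * h) x = R g (h • x) * R h x
  /-- `G` permutes faces and degeneracies as `R` prescribes -/
  smul_δ : ∀ {k : ℕ} (g : G) (x : X _⦋k + 1⦌) (i : Fin (k + 2)),
    g • X.δ i x = X.δ (R g x i) (g • x)
  smul_σ : ∀ {k : ℕ} (g : G) (x : X _⦋k⦌) (i : Fin (k + 1)),
    g • X.σ i x = X.σ (R g x i) (g • x)
  /-- `R` is compatible with faces: on the `i`-th face of `x` it is obtained from `R g x` by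
  deleting `i` from the source and its image from the target -/
  R_δ : ∀ {k : ℕ} (g : G) (x : X _⦋k + 1⦌) (i : Fin (k + 2)) (j : Fin (k + 1)),
    (R g x i).succAbove (R g (X.δ i x) j) = R g x (i.succAbove j)
  /-- `R` is compatible with degeneracies: on the `i`-th degeneracy of `x` it is obtained from
  `R g x` by doubling `i` in the source and its image in the target, keeping the order of the two
  copies -/
  R_σ : ∀ {k : ℕ} (g : G) (x : X _⦋k⦌) (i : Fin (k + 1)) (j : Fin (k + 2)),
    (R g x i).predAbove (R g (X.σ i x) j) = R g x (i.predAbove j)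
  R_σ_castSucc : ∀ {k : ℕ} (g : G) (x : X _⦋k⦌) (i : Fin (k + 1)),
    R g (X.σ i x) i.castSucc = (R g x i).castSucc
  R_σ_succ : ∀ {k : ℕ} (g : G) (x : X _⦋k⦌) (i : Fin (k + 1)),
    R g (X.σ i x) i.succ = (R g x i).succ

end Actions

end SmoothRep

end

/-! Every object `V` of either category is resolved by the normalised chains of `𝒳` with
coefficients in `V`. The `k`-th term is a sum of copies of `V` indexed by the non-degenerate
`k`-simplices; `g` carries the copy at `x` to the copy at `g • x` by `ρ g` times the sign of `R g
x`. There are no terms above degree `n`, so it remains to see that the terms lie in the category,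
that the augmented complex is exact and equivariant, and that the terms are projective.

Membership: `A` fixes all simplices, degenerate ones included, and this forces `R a x = 1`; as a
representation of `A` each term is a sum of copies of `V`. Both categories have the form "smooth,
`A`-semisimple, killed by a set `I` of elements of `F[A]`", with `I` empty for `M_A(G)` and `I` the
kernel of `F[A] → Ft` for `M_{A,χ}(G)`, so one argument serves both (`isInMAKilledBy_empty`,
`isInMAKilledBy_ker`).

Exactness: the chains of a finite-dimensional simplicial set compute the singular homology of its
realisation (`SSet.quasiIso_comparison`). This goes by induction over skeleta. Attaching cells is a
pushout; it leaves relative simplicial chains unchanged for formal reasons and relative singular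
chains by excision, which rests on barycentric subdivision (`SmallSimplices.quasiIso_small`) and on
a collar of the boundary of a simplex. Contractibility of the realisation then makes the chains
those of a point. Equivariance of the differential is a sign computation
(`Equiv.Perm.sign_of_succAbove`).

Projectivity (`IsSignCocycle.exists_lift`): let `f` be a map from a term to `W'` and `e : W → W'` a
surjection. Semisimplicity over `A` gives an `A`-linear section of `e`, hence an `A`-linear lift of
`f` on each summand. Averaging its sign-twisted conjugates over the compact group `G_x / A`, whose
order is invertible in `F`, makes the lift at `x` invariant under `G_x`; transport along orbits
makes the family of lifts `G`-equivariant. -/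

noncomputable section

/-! ### Affine simplices and their barycentric subdivision -/

namespace AffineChain

/-- The standard topological simplex of dimension `n`. -/
abbrev Simplex (n : ℕ) := stdSimplex ℝ (Fin (n + 1))

variable {l m n : ℕ}

/-- The affine map between standard simplices with prescribed vertices. -/
def comb (w : Fin (m + 1) → Simplex n) (t : Simplex m) : Simplex n :=
  ⟨∑ i, t i • (w i : Fin (n + 1) → ℝ),
    (convex_stdSimplex ℝ (Fin (n + 1))).sum_mem (fun i _ => t.2.1 i) t.2.2 fun i _ => (w i).2⟩

lemma comb_coe (w : Fin (m + 1) → Simplex n) (t : Simplex m) :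
    (comb w t : Fin (n + 1) → ℝ) = ∑ i, t i • (w i : Fin (n + 1) → ℝ) := rfl

lemma comb_apply (w : Fin (m + 1) → Simplex n) (t : Simplex m) (j : Fin (n + 1)) :
    comb w t j = ∑ i, t i * w i j := by
  simp only [comb_coe, Finset.sum_apply, Pi.smul_apply, smul_eq_mul]

lemma simplex_ext {s t : Simplex n} (h : ∀ j, s j = t j) : s = t := by
  apply Subtype.ext; funext j; exact h j

lemma continuous_comb (w : Fin (m + 1) → Simplex n) : Continuous (comb w) := by
  refine Continuous.subtype_mk ?_ _
  refine continuous_finsetSum _ fun i _ => ?_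
  exact ((continuous_apply i).comp continuous_subtype_val).smul continuous_const

/-- The affine map with prescribed vertices, as a continuous map. -/
def combMap (w : Fin (m + 1) → Simplex n) : C(Simplex m, Simplex n) := ⟨comb w, continuous_comb w⟩

lemma comb_comb (u : Fin (m + 1) → Simplex n) (w : Fin (l + 1) → Simplex m) (t : Simplex l) :
    comb u (comb w t) = comb (fun j => comb u (w j)) t := by
  apply simplex_ext
  intro j
  simp only [comb_apply, Finset.sum_mul, Finset.mul_sum]
  rw [Finset.sum_comm]
  simp only [mul_assoc]

lemma vertex_apply (i j : Fin (n + 1)) :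
    (stdSimplex.vertex i : Simplex n) j = if j = i then 1 else 0 := by
  rw [stdSimplex.vertex_coe, Pi.single_apply]

lemma comb_vertex (w : Fin (m + 1) → Simplex n) (i : Fin (m + 1)) :
    comb w (stdSimplex.vertex i) = w i := by
  apply simplex_ext
  intro j
  simp [comb_apply, vertex_apply]

lemma comb_vertices (t : Simplex n) : comb stdSimplex.vertex t = t := by
  apply simplex_ext
  intro j
  simp [comb_apply, vertex_apply]

lemma comb_vertices_comp (f : Fin (m + 1) → Fin (n + 1)) (t : Simplex m) :
    comb (fun i => stdSimplex.vertex (f i)) t = stdSimplex.map f t := by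
  apply simplex_ext
  intro j
  rw [stdSimplex.map_coe, FunOnFinite.linearMap_apply_apply]
  simp only [comb_apply, vertex_apply, Finset.sum_filter, mul_ite, mul_one, mul_zero]
  refine Finset.sum_congr rfl fun i _ => ?_
  simp only [eq_comm]

/-- The simplicial operators on singular simplices are precomposition with `stdSimplex.map`; this
reduces them to reindexing the vertices of an affine simplex. -/
lemma comb_comp (w : Fin (m + 1) → Simplex n) (f : Fin (l + 1) → Fin (m + 1)) (t : Simplex l) :
    comb (w ∘ f) t = comb w (stdSimplex.map f t) := by
  rw [← comb_vertices_comp, comb_comb]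
  simp only [comb_vertex]
  rfl

/-- Distances to the points of an affine simplex are controlled by the distances to its
vertices. -/
lemma dist_comb_le (w : Fin (m + 1) → Simplex n) (t : Simplex m) (x : Simplex n) {C : ℝ}
    (h : ∀ i, dist (w i) x ≤ C) : dist (comb w t) x ≤ C := by
  have : (comb w t : Fin (n + 1) → ℝ) ∈ Metric.closedBall (x : Fin (n + 1) → ℝ) C :=
    (convex_closedBall (x : Fin (n + 1) → ℝ) C).sum_mem (fun i _ => t.2.1 i) t.2.2
      fun i _ => h i
  exact this

/-- The barycentre of a family of points. -/
def bary (w : Fin (m + 1) → Simplex n) : Simplex n := comb w stdSimplex.barycenter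

lemma comb_bary (u : Fin (m + 1) → Simplex n) (w : Fin (l + 1) → Simplex m) :
    comb u (bary w) = bary fun j => comb u (w j) := comb_comb _ _ _

/-- The vector from `w j` to the barycentre is the mean of the `m + 1` vectors `w i - w j`, one of
which vanishes. This is the source of the contraction factor `m / (m + 1)`. -/
lemma dist_bary_le (w : Fin (m + 1) → Simplex n) {C : ℝ} (h : ∀ i j, dist (w i) (w j) ≤ C)
    (j : Fin (m + 1)) : dist (bary w) (w j) ≤ m / (m + 1) * C := by
  have hm : (0 : ℝ) < m + 1 := by positivity
  have hx : ((bary w : Simplex n) : Fin (n + 1) → ℝ) - w j =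
      ((m : ℝ) + 1)⁻¹ • ∑ i, ((w i : Fin (n + 1) → ℝ) - w j) := by
    have hb : ∀ i : Fin (m + 1), (stdSimplex.barycenter : Simplex m) i = ((m : ℝ) + 1)⁻¹ := by
      intro i
      change ((Fintype.card (Fin (m + 1)) : ℝ))⁻¹ = _
      simp
    rw [bary, comb_coe, Finset.sum_sub_distrib, Finset.sum_const, Finset.card_univ,
      Fintype.card_fin, smul_sub, ← Nat.cast_smul_eq_nsmul ℝ, smul_smul]
    simp only [hb, ← Finset.smul_sum]
    push_cast
    rw [inv_mul_cancel₀ hm.ne', one_smul]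
  change ‖((bary w : Simplex n) : Fin (n + 1) → ℝ) - w j‖ ≤ _
  rw [hx, norm_smul, Real.norm_of_nonneg (by positivity), div_mul_eq_mul_div, inv_mul_eq_div]
  refine div_le_div_of_nonneg_right ?_ hm.le
  rw [← Finset.add_sum_erase _ _ (Finset.mem_univ j), sub_self, zero_add]
  refine (norm_sum_le_of_le _ (n := fun _ => C) fun i _ => h i j).trans ?_
  rw [Finset.sum_const, Finset.card_erase_of_mem (Finset.mem_univ _), Finset.card_univ,
    Fintype.card_fin, nsmul_eq_mul]
  simp

/-- Formal integral combinations of affine `m`-simplices in the standard `n`-simplex. -/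
abbrev Chain (m n : ℕ) := (Fin (m + 1) → Simplex n) →₀ ℤ

/-- The boundary of an affine chain. -/
def bdry : Chain (m + 1) n →ₗ[ℤ] Chain m n :=
  Finsupp.linearCombination ℤ fun w =>
    ∑ i : Fin (m + 2), (-1 : ℤ) ^ (i : ℕ) • Finsupp.single (w ∘ i.succAbove) 1

lemma bdry_single (w : Fin (m + 2) → Simplex n) :
    bdry (Finsupp.single w 1) =
      ∑ i : Fin (m + 2), (-1 : ℤ) ^ (i : ℕ) • Finsupp.single (w ∘ i.succAbove) (1 : ℤ) := by
  simp [bdry]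

/-- The cone over an affine chain. -/
def cone (p : Simplex n) : Chain m n →ₗ[ℤ] Chain (m + 1) n :=
  Finsupp.lmapDomain ℤ ℤ fun w => (Fin.cons p w : Fin (m + 2) → Simplex n)

lemma cone_single (p : Simplex n) (w : Fin (m + 1) → Simplex n) (a : ℤ) :
    cone p (Finsupp.single w a) = Finsupp.single (Fin.cons p w : Fin (m + 2) → Simplex n) a := by
  simp [cone]

/-- The image of an affine chain under an affine map. -/
def push (u : Fin (n + 1) → Simplex l) : Chain m n →ₗ[ℤ] Chain m l :=
  Finsupp.lmapDomain ℤ ℤ fun w => comb u ∘ w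

lemma push_single (u : Fin (n + 1) → Simplex l) (w : Fin (m + 1) → Simplex n) (a : ℤ) :
    push u (Finsupp.single w a) = Finsupp.single (comb u ∘ w) a := by
  simp [push]

/-- A linear map on affine chains is determined by its values on affine simplices. -/
lemma chain_hom_ext {M : Type*} [AddCommGroup M] {f g : Chain m n →ₗ[ℤ] M}
    (h : ∀ w, f (Finsupp.single w 1) = g (Finsupp.single w 1)) : f = g :=
  Finsupp.lhom_ext' fun w => LinearMap.ext_ring (h w)

lemma cons_comp_succAbove_succ (p : Simplex n) (w : Fin (m + 2) → Simplex n) (i : Fin (m + 2)) :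
    (Fin.cons p w : Fin (m + 3) → Simplex n) ∘ i.succ.succAbove =
      (Fin.cons p (w ∘ i.succAbove) : Fin (m + 2) → Simplex n) := by
  funext j
  refine Fin.cases ?_ (fun j => ?_) j <;> simp

/-- The face opposite the apex gives back `c`; the other faces are cones over faces of `c`, with the
sign shifted by one. The formula needs `c` of positive degree: over a point the second term would be
the apex itself. -/
lemma bdry_cone (p : Simplex n) (c : Chain (m + 1) n) :
    bdry (cone p c) = c - cone p (bdry c) := by
  suffices bdry ∘ₗ cone p = LinearMap.id - cone p ∘ₗ (bdry (m := m)) from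
    LinearMap.congr_fun this c
  apply chain_hom_ext
  intro w
  simp only [LinearMap.comp_apply, LinearMap.sub_apply, LinearMap.id_apply, cone_single,
    bdry_single, map_sum, map_smul]
  rw [Fin.sum_univ_succ]
  simp only [cons_comp_succAbove_succ, Fin.val_succ, pow_succ, Fin.val_zero, pow_zero, one_smul,
    mul_neg, mul_one, neg_smul, Finset.sum_neg_distrib, ← sub_eq_add_neg]
  congr 2

/-- In degree `0` the cone formula has the apex as an extra term, which cancels in differences of
points, hence on boundaries of edges. -/
lemma bdry_cone_single_sub (p : Simplex n) (v w : Fin 1 → Simplex n) :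
    bdry (cone p (Finsupp.single v 1 - Finsupp.single w 1)) =
      (Finsupp.single v 1 - Finsupp.single w 1 : Chain 0 n) := by
  have h : ∀ v : Fin 1 → Simplex n, bdry (cone p (Finsupp.single v 1)) =
      Finsupp.single v 1 - Finsupp.single (fun _ => p) 1 := by
    intro v
    rw [cone_single, bdry_single, Fin.sum_univ_two]
    simp only [Fin.val_zero, pow_zero, one_smul, Fin.val_one, pow_one, neg_smul,
      ← sub_eq_add_neg]
    congr 2
    funext j
    obtain rfl : j = 0 := Subsingleton.elim (α := Fin 1) j 0
    rfl
  rw [map_sub, map_sub, h, h]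
  abel

lemma push_cone (u : Fin (n + 1) → Simplex l) (p : Simplex n) (c : Chain m n) :
    push u (cone p c) = cone (comb u p) (push u c) := by
  suffices push u ∘ₗ cone p = cone (comb u p) ∘ₗ (push (m := m) u) from LinearMap.congr_fun this c
  apply chain_hom_ext
  intro w
  simp only [LinearMap.comp_apply, cone_single, push_single]
  congr 1
  exact Fin.comp_cons _ _ _

lemma push_bdry (u : Fin (n + 1) → Simplex l) (c : Chain (m + 1) n) :
    push u (bdry c) = bdry (push u c) := by
  suffices push u ∘ₗ bdry = bdry ∘ₗ (push (m := m + 1) u) from LinearMap.congr_fun this c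
  apply chain_hom_ext
  intro w
  simp only [LinearMap.comp_apply, bdry_single, push_single, map_sum, map_smul]
  rfl

/-- The barycentric subdivision of affine chains. -/
def sd (m : ℕ) : Chain m n →ₗ[ℤ] Chain m n :=
  Nat.rec (motive := fun m => Chain m n →ₗ[ℤ] Chain m n) LinearMap.id
    (fun _ f => Finsupp.linearCombination ℤ fun w =>
      cone (bary w) (f (bdry (Finsupp.single w 1)))) m

lemma sd_zero (c : Chain 0 n) : sd 0 c = c := rfl

lemma sd_succ_single (w : Fin (m + 2) → Simplex n) :
    sd (m + 1) (Finsupp.single w 1) = cone (bary w) (sd m (bdry (Finsupp.single w 1))) := by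
  simp [sd]

/-- Each affine simplex is the cone from its first vertex over the opposite face, so the cone
formula gives an induction that avoids the double sum over faces. -/
lemma bdry_bdry (c : Chain (m + 2) n) : bdry (bdry c) = 0 := by
  induction m with
  | zero =>
    suffices bdry ∘ₗ bdry = (0 : Chain 2 n →ₗ[ℤ] Chain 0 n) from LinearMap.congr_fun this c
    apply chain_hom_ext
    intro w
    rw [LinearMap.comp_apply, LinearMap.zero_apply, ← Fin.cons_self_tail w, ← cone_single,
      bdry_cone, map_sub, bdry_single, Fin.sum_univ_two]
    simp only [Fin.val_zero, pow_zero, one_smul, Fin.val_one, pow_one, neg_smul,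
      ← sub_eq_add_neg]
    rw [bdry_cone_single_sub, sub_self]
  | succ m ih =>
    suffices bdry ∘ₗ bdry = (0 : Chain (m + 3) n →ₗ[ℤ] Chain (m + 1) n) from
      LinearMap.congr_fun this c
    apply chain_hom_ext
    intro w
    rw [LinearMap.comp_apply, LinearMap.zero_apply, ← Fin.cons_self_tail w, ← cone_single,
      bdry_cone, map_sub, bdry_cone, ih, map_zero, sub_zero, sub_self]

/-- Affine maps preserve barycentres, cones and faces. This naturality is what lets subdivision
descend to singular chains. -/
lemma push_sd (u : Fin (n + 1) → Simplex l) (c : Chain m n) :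
    push u (sd m c) = sd m (push u c) := by
  induction m with
  | zero => rfl
  | succ m ih =>
    suffices push u ∘ₗ sd (m + 1) = sd (m + 1) ∘ₗ (push (m := m + 1) u) from
      LinearMap.congr_fun this c
    apply chain_hom_ext
    intro w
    simp only [LinearMap.comp_apply, sd_succ_single, push_single]
    rw [push_cone, ih, push_bdry, push_single, comb_bary]
    rfl

/-- The chain homotopy between the identity and the barycentric subdivision. -/
def sdHomotopy (m : ℕ) : Chain m n →ₗ[ℤ] Chain (m + 1) n :=
  Nat.rec (motive := fun m => Chain m n →ₗ[ℤ] Chain (m + 1) n) 0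
    (fun _ f => Finsupp.linearCombination ℤ fun w =>
      cone (bary w) (Finsupp.single w 1 - f (bdry (Finsupp.single w 1)))) m

lemma sdHomotopy_zero (c : Chain 0 n) : sdHomotopy 0 c = 0 := rfl

lemma sdHomotopy_succ_single (w : Fin (m + 2) → Simplex n) :
    sdHomotopy (m + 1) (Finsupp.single w 1) =
      cone (bary w) (Finsupp.single w 1 - sdHomotopy m (bdry (Finsupp.single w 1))) := by
  simp [sdHomotopy]

/-- With `T` the homotopy and `b` the barycentre, the cone formula gives `∂Tw = w - T∂w - b·(∂w -
∂T∂w)`. By induction and `∂∂ = 0`, the bracket is `sd ∂w`, whose cone is `sd w`. -/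
lemma bdry_sdHomotopy (c : Chain (m + 1) n) :
    bdry (sdHomotopy (m + 1) c) = c - sd (m + 1) c - sdHomotopy m (bdry c) := by
  induction m with
  | zero =>
    suffices bdry ∘ₗ sdHomotopy 1 =
        LinearMap.id - sd 1 - sdHomotopy 0 ∘ₗ (bdry (m := 0) (n := n)) from
      LinearMap.congr_fun this c
    apply chain_hom_ext
    intro w
    simp only [LinearMap.comp_apply, LinearMap.sub_apply, LinearMap.id_apply,
      sdHomotopy_succ_single, sd_succ_single, sdHomotopy_zero, sub_zero, sd_zero]
    rw [bdry_cone]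
  | succ m ih =>
    suffices bdry ∘ₗ sdHomotopy (m + 2) =
        LinearMap.id - sd (m + 2) - sdHomotopy (m + 1) ∘ₗ (bdry (m := m + 1) (n := n)) from
      LinearMap.congr_fun this c
    apply chain_hom_ext
    intro w
    simp only [LinearMap.comp_apply, LinearMap.sub_apply, LinearMap.id_apply,
      sdHomotopy_succ_single (m := m + 1), sd_succ_single]
    rw [bdry_cone, map_sub, ih, bdry_bdry, map_zero, sub_zero, sub_sub_cancel]
    abel

lemma push_sdHomotopy (u : Fin (n + 1) → Simplex l) (c : Chain m n) :
    push u (sdHomotopy m c) = sdHomotopy m (push u c) := by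
  induction m with
  | zero => simp [sdHomotopy_zero]
  | succ m ih =>
    suffices push u ∘ₗ sdHomotopy (m + 1) = sdHomotopy (m + 1) ∘ₗ (push (m := m + 1) u) from
      LinearMap.congr_fun this c
    apply chain_hom_ext
    intro w
    simp only [LinearMap.comp_apply, sdHomotopy_succ_single, push_single]
    rw [push_cone, map_sub, ih, push_bdry, push_single, comb_bary]
    rfl

lemma linearMap_eq_sum {M : Type*} [AddCommGroup M] (f : Chain m n →ₗ[ℤ] M) (c : Chain m n) :
    f c = ∑ w ∈ c.support, c w • f (Finsupp.single w 1) := by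
  conv_lhs => rw [← Finsupp.sum_single c, Finsupp.sum, map_sum]
  refine Finset.sum_congr rfl fun w _ => ?_
  rw [← map_smul, Finsupp.smul_single, smul_eq_mul, mul_one]

lemma exists_of_mem_support {k : ℕ} (f : Chain m n →ₗ[ℤ] Chain k l) (c : Chain m n)
    {w' : Fin (k + 1) → Simplex l} (hw' : w' ∈ (f c).support) :
    ∃ w ∈ c.support, w' ∈ (f (Finsupp.single w 1)).support := by
  classical
  rw [linearMap_eq_sum] at hw'
  obtain ⟨w, hw, h⟩ := Finset.mem_biUnion.1 (Finsupp.support_finsetSum hw')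
  exact ⟨w, hw, Finsupp.support_smul h⟩

lemma exists_of_mem_support_bdry (w : Fin (m + 2) → Simplex n) {w' : Fin (m + 1) → Simplex n}
    (hw' : w' ∈ (bdry (Finsupp.single w 1)).support) : ∃ i : Fin (m + 2), w' = w ∘ i.succAbove := by
  classical
  rw [bdry_single] at hw'
  obtain ⟨i, -, h⟩ := Finset.mem_biUnion.1 (Finsupp.support_finsetSum hw')
  exact ⟨i, Finset.mem_singleton.1 (Finsupp.support_single_subset (Finsupp.support_smul h))⟩

lemma exists_of_mem_support_cone (p : Simplex n) (c : Chain m n) {w' : Fin (m + 2) → Simplex n}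
    (hw' : w' ∈ (cone p c).support) : ∃ w ∈ c.support, w' = Fin.cons p w := by
  classical
  obtain ⟨w, hw, h⟩ := exists_of_mem_support _ _ hw'
  rw [cone_single] at h
  exact ⟨w, hw, Finset.mem_singleton.1 (Finsupp.support_single_subset h)⟩

/-- An edge of the subdivision either ends at the barycentre, where `dist_bary_le` and convexity
bound it, or lies in a subdivided face, where induction applies because `m / (m + 1)` increases with
`m`. The first conjunct, that the vertices stay in the hull, is carried along for the former case.
-/
lemma dist_le_of_mem_support_sd_single (w : Fin (m + 1) → Simplex n) {C : ℝ}
    (hC : ∀ i j, dist (w i) (w j) ≤ C) {w' : Fin (m + 1) → Simplex n}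
    (hw' : w' ∈ (sd m (Finsupp.single w 1)).support) :
    (∀ j, ∃ t, w' j = comb w t) ∧ ∀ j k, dist (w' j) (w' k) ≤ m / (m + 1) * C := by
  classical
  have hC0 : 0 ≤ C := dist_nonneg.trans (hC 0 0)
  induction m with
  | zero =>
    obtain rfl : w' = w := Finset.mem_singleton.1 (Finsupp.support_single_subset hw')
    refine ⟨fun j => ⟨stdSimplex.vertex j, (comb_vertex _ _).symm⟩, fun j k => ?_⟩
    obtain rfl : j = k := Subsingleton.elim (α := Fin 1) j k
    simp
  | succ m ih =>
    rw [sd_succ_single] at hw'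
    obtain ⟨w₁, hw₁, rfl⟩ := exists_of_mem_support_cone _ _ hw'
    obtain ⟨w₂, hw₂, h₁⟩ := exists_of_mem_support _ _ hw₁
    obtain ⟨i, rfl⟩ := exists_of_mem_support_bdry _ hw₂
    obtain ⟨hull, hd⟩ := ih (w ∘ i.succAbove) (fun _ _ => hC _ _) h₁
    have hull' : ∀ j, ∃ t, w₁ j = comb w t := fun j => by
      obtain ⟨t, ht⟩ := hull j
      exact ⟨_, ht.trans (comb_comp _ _ _)⟩
    have hb : ∀ j, dist (w₁ j) (bary w) ≤ (m + 1 : ℕ) / ((m + 1 : ℕ) + 1) * C := fun j => by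
      obtain ⟨t, ht⟩ := hull' j
      rw [ht]
      refine dist_comb_le _ _ _ fun i => ?_
      rw [dist_comm]
      exact dist_bary_le w hC i
    refine ⟨fun j => ?_, fun j k => ?_⟩
    · refine Fin.cases ⟨_, rfl⟩ (fun j => ?_) j
      simpa using hull' j
    · refine Fin.cases ?_ (fun j => ?_) j <;> refine Fin.cases ?_ (fun k => ?_) k
      · rw [dist_self]; positivity
      · rw [dist_comm]; simpa using hb k
      · simpa using hb j
      · refine (hd j k).trans (mul_le_mul_of_nonneg_right ?_ hC0)
        rw [div_le_div_iff₀ (by positivity) (by positivity)]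
        push_cast
        nlinarith

lemma dist_le_of_mem_support_iterate_sd (N : ℕ) (c : Chain m n) {C : ℝ}
    (hC : ∀ w ∈ c.support, ∀ i j, dist (w i) (w j) ≤ C) {w : Fin (m + 1) → Simplex n}
    (hw : w ∈ ((sd m)^[N] c).support) (i j : Fin (m + 1)) :
    dist (w i) (w j) ≤ (m / (m + 1)) ^ N * C := by
  induction N generalizing w i j with
  | zero => simpa using hC w hw i j
  | succ N ih =>
    rw [Function.iterate_succ_apply'] at hw
    obtain ⟨w₁, hw₁, h⟩ := exists_of_mem_support _ _ hw
    rw [pow_succ', mul_assoc]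
    exact (dist_le_of_mem_support_sd_single w₁ (ih hw₁) h).2 i j

/-- Iterated subdivisions of a standard simplex become arbitrarily fine. -/
lemma exists_iterate_sd_dist_lt (m : ℕ) {δ : ℝ} (hδ : 0 < δ) :
    ∃ N : ℕ, ∀ w ∈ ((sd m)^[N] (Finsupp.single (stdSimplex.vertex (S := ℝ)) 1)).support,
      ∀ i j, dist (w i) (w j) < δ := by
  classical
  have h1 : (m : ℝ) / (m + 1) < 1 := by rw [div_lt_one (by positivity)]; linarith
  obtain ⟨N, hN⟩ := exists_pow_lt_of_lt_one hδ h1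
  refine ⟨N, fun w hw i j => ?_⟩
  -- The constant `1` bounds the diameter of the standard simplex.
  refine (dist_le_of_mem_support_iterate_sd N _ (C := 1) (fun v _ i j => ?_) hw i j).trans_lt
    (by simpa using hN)
  exact (Metric.dist_le_diam_of_mem (bounded_stdSimplex _) (v i).2 (v j).2).trans
    diam_stdSimplex_le

end AffineChain
end

noncomputable section

/-! ### Subdivision of singular chains -/

namespace SingularChain

open AffineChain Opposite

variable {Y : TopCat.{u}} {l m k : ℕ}

/-- The restriction of a singular simplex to an affine simplex. -/
def restr (s : TopCat.toSSet.obj Y _⦋m⦌) (w : Fin (k + 1) → Simplex m) :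
    TopCat.toSSet.obj Y _⦋k⦌ :=
  (Y.toSSetObjEquiv (op ⦋k⦌)).symm ((Y.toSSetObjEquiv (op ⦋m⦌) s).comp (combMap w))

lemma restr_apply (s : TopCat.toSSet.obj Y _⦋m⦌) (w : Fin (k + 1) → Simplex m)
    (t : Simplex k) :
    Y.toSSetObjEquiv (op ⦋k⦌) (restr s w) t = Y.toSSetObjEquiv (op ⦋m⦌) s (comb w t) := by
  rw [restr, Equiv.apply_symm_apply]
  rfl

lemma simplex_ext {s t : TopCat.toSSet.obj Y _⦋m⦌}
    (h : ∀ x : Simplex m, Y.toSSetObjEquiv (op ⦋m⦌) s x = Y.toSSetObjEquiv (op ⦋m⦌) t x) :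
    s = t :=
  (Y.toSSetObjEquiv (op ⦋m⦌)).injective (ContinuousMap.ext h)

lemma δ_restr (s : TopCat.toSSet.obj Y _⦋m⦌) (w : Fin (k + 2) → Simplex m) (i : Fin (k + 2)) :
    (TopCat.toSSet.obj Y).δ i (restr s w) = restr s (w ∘ i.succAbove) := by
  apply simplex_ext
  intro t
  rw [restr_apply, comb_comp, ← restr_apply]
  rfl

lemma restr_restr (s : TopCat.toSSet.obj Y _⦋m⦌) (u : Fin (l + 1) → Simplex m)
    (w : Fin (k + 1) → Simplex l) : restr (restr s u) w = restr s (comb u ∘ w) := by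
  apply simplex_ext
  intro t
  rw [restr_apply, restr_apply, restr_apply, comb_comb]
  rfl

lemma restr_vertex (s : TopCat.toSSet.obj Y _⦋m⦌) :
    restr s (stdSimplex.vertex (S := ℝ)) = s := by
  apply simplex_ext
  intro t
  rw [restr_apply, comb_vertices]

variable {C : Type*} [Category* C] [Preadditive C]

/-- Postcomposition, as a linear map. -/
def postcomp {A B D : C} (f : B ⟶ D) : (A ⟶ B) →ₗ[ℤ] (A ⟶ D) :=
  (Preadditive.rightComp A f).toIntLinearMap

lemma postcomp_apply {A B D : C} (f : B ⟶ D) (g : A ⟶ B) : postcomp f g = g ≫ f := rfl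

variable [HasCoproducts.{u} C] (R : C)

/-- The singular chain obtained by restricting a singular simplex to an affine chain. -/
def realize (s : TopCat.toSSet.obj Y _⦋m⦌) :
    Chain k m →ₗ[ℤ] (R ⟶ ((TopCat.toSSet.obj Y).chainComplex R).X k) :=
  Finsupp.linearCombination ℤ fun w => (TopCat.toSSet.obj Y).ιChainComplex (restr s w)

lemma realize_single (s : TopCat.toSSet.obj Y _⦋m⦌) (w : Fin (k + 1) → Simplex m) :
    realize R s (Finsupp.single w 1) = (TopCat.toSSet.obj Y).ιChainComplex (restr s w) := by
  simp [realize]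

lemma realize_vertex (s : TopCat.toSSet.obj Y _⦋m⦌) :
    realize R s (Finsupp.single stdSimplex.vertex 1) = (TopCat.toSSet.obj Y).ιChainComplex s := by
  rw [realize_single, restr_vertex]

lemma realize_bdry (s : TopCat.toSSet.obj Y _⦋m⦌) (c : Chain (k + 1) m) :
    realize R s c ≫ ((TopCat.toSSet.obj Y).chainComplex R).d (k + 1) k =
      realize R s (bdry c) := by
  suffices postcomp (((TopCat.toSSet.obj Y).chainComplex R).d (k + 1) k) ∘ₗ realize R s =
      realize R s ∘ₗ bdry from LinearMap.congr_fun this c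
  apply chain_hom_ext
  intro w
  rw [LinearMap.comp_apply, LinearMap.comp_apply, postcomp_apply, realize_single, bdry_single,
    map_sum, SSet.ιChainComplex_d]
  refine Finset.sum_congr rfl fun i _ => ?_
  rw [map_smul, realize_single, δ_restr]

lemma realize_restr (s : TopCat.toSSet.obj Y _⦋m⦌) (u : Fin (l + 1) → Simplex m)
    (c : Chain k l) : realize R (restr s u) c = realize R s (push u c) := by
  suffices realize R (restr s u) = realize R s ∘ₗ push u from LinearMap.congr_fun this c
  apply chain_hom_ext
  intro w
  rw [LinearMap.comp_apply, realize_single, push_single, realize_single, restr_restr]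

/-- An operation on affine chains, compatible with affine maps, acts on singular chains. -/
def natural (Φ : ∀ {n : ℕ}, Chain m n →ₗ[ℤ] Chain k n) :
    ((TopCat.toSSet.obj Y).chainComplex R).X m ⟶ ((TopCat.toSSet.obj Y).chainComplex R).X k :=
  Cofan.IsColimit.desc ((TopCat.toSSet.obj Y).isColimitChainComplexXCofan R m) fun s =>
    realize R s (Φ (Finsupp.single stdSimplex.vertex 1))

lemma ι_natural (Φ : ∀ {n : ℕ}, Chain m n →ₗ[ℤ] Chain k n) (s : TopCat.toSSet.obj Y _⦋m⦌) :
    (TopCat.toSSet.obj Y).ιChainComplex s ≫ natural R Φ =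
      realize R s (Φ (Finsupp.single stdSimplex.vertex 1)) :=
  Cofan.IsColimit.fac ((TopCat.toSSet.obj Y).isColimitChainComplexXCofan R m) _ _

/-- An affine simplex `w` is the image of the identity simplex under `comb w`, so `hΦ` carries the
defining value of `natural R Φ` on the identity simplex over to `w`. -/
lemma realize_natural (Φ : ∀ {n : ℕ}, Chain m n →ₗ[ℤ] Chain k n)
    (hΦ : ∀ {l n : ℕ} (u : Fin (n + 1) → Simplex l) (c : Chain m n), push u (Φ c) = Φ (push u c))
    (s : TopCat.toSSet.obj Y _⦋l⦌) (c : Chain m l) :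
    realize R s c ≫ natural R Φ = realize R s (Φ c) := by
  suffices postcomp (natural R Φ) ∘ₗ realize R s = realize R s ∘ₗ Φ from LinearMap.congr_fun this c
  apply chain_hom_ext
  intro w
  rw [LinearMap.comp_apply, LinearMap.comp_apply, postcomp_apply, realize_single, ι_natural,
    realize_restr, hΦ, push_single]
  congr 3
  funext j
  exact comb_vertex w j

variable (Y)

/-- The barycentric subdivision of singular chains. -/
def subdivision (m : ℕ) :
    ((TopCat.toSSet.obj Y).chainComplex R).X m ⟶ ((TopCat.toSSet.obj Y).chainComplex R).X m :=
  natural R (sd m)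

/-- The homotopy between the identity and the barycentric subdivision of singular chains. -/
def subdivisionHomotopy (m : ℕ) : ((TopCat.toSSet.obj Y).chainComplex R).X m ⟶
    ((TopCat.toSSet.obj Y).chainComplex R).X (m + 1) :=
  natural R (sdHomotopy m)

variable {Y}

lemma realize_subdivision (s : TopCat.toSSet.obj Y _⦋l⦌) (c : Chain m l) :
    realize R s c ≫ subdivision Y R m = realize R s (sd m c) :=
  realize_natural R (sd m) push_sd s c

lemma realize_subdivisionHomotopy (s : TopCat.toSSet.obj Y _⦋l⦌) (c : Chain m l) :
    realize R s c ≫ subdivisionHomotopy Y R m = realize R s (sdHomotopy m c) :=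
  realize_natural R (sdHomotopy m) push_sdHomotopy s c

lemma ι_subdivisionHomotopy (s : TopCat.toSSet.obj Y _⦋m⦌) :
    (TopCat.toSSet.obj Y).ιChainComplex s ≫ subdivisionHomotopy Y R m =
      realize R s (sdHomotopy m (Finsupp.single stdSimplex.vertex 1)) := by
  rw [← realize_vertex, realize_subdivisionHomotopy]

lemma subdivision_zero : subdivision Y R 0 = 𝟙 _ := by
  apply SSet.chainComplex_hom_ext
  intro s
  rw [← realize_vertex, realize_subdivision, Category.comp_id, sd_zero]

lemma subdivisionHomotopy_comm (m : ℕ) :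
    subdivisionHomotopy Y R (m + 1) ≫ ((TopCat.toSSet.obj Y).chainComplex R).d (m + 2) (m + 1) +
      ((TopCat.toSSet.obj Y).chainComplex R).d (m + 1) m ≫ subdivisionHomotopy Y R m =
    𝟙 _ - subdivision Y R (m + 1) := by
  apply SSet.chainComplex_hom_ext
  intro s
  rw [← realize_vertex, Preadditive.comp_add, Preadditive.comp_sub, ← Category.assoc,
    ← Category.assoc, realize_subdivision, Category.comp_id, realize_subdivisionHomotopy,
    realize_bdry, realize_bdry, realize_subdivisionHomotopy, bdry_sdHomotopy, map_sub, map_sub]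
  abel

end SingularChain
end

noncomputable section

/-! ### Quasi-isomorphisms in short exact sequences -/

namespace ShortExactQuasiIso

open HomologicalComplex HomologySequence ComposableArrows Abelian

variable {C : Type*} [Category* C] [Abelian C]

/-- The four lemma on `H_{j+1}(X₃) → H_j(X₁) → H_j(X₂) → H_j(X₃)`. -/
lemma mono_homologyMap_τ₂ {S₁ S₂ : ShortComplex (ChainComplex C ℕ)} (φ : S₁ ⟶ S₂)
    (hS₁ : S₁.ShortExact) (hS₂ : S₂.ShortExact) (h₁ : QuasiIso φ.τ₁) (h₃ : QuasiIso φ.τ₃) (j : ℕ) :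
    Mono (homologyMap φ.τ₂ j) := by
  apply mono_of_epi_of_mono_of_mono ((δ₀Functor ⋙ δ₀Functor).map
    (mapComposableArrows₅ φ hS₁ hS₂ (j + 1) j rfl))
  · exact (composableArrows₅_exact hS₁ (j + 1) j rfl).δ₀.δ₀
  · exact (composableArrows₅_exact hS₂ (j + 1) j rfl).δ₀.δ₀
  · exact inferInstanceAs (Epi (homologyMap φ.τ₃ (j + 1)))
  · exact inferInstanceAs (Mono (homologyMap φ.τ₁ j))
  · exact inferInstanceAs (Mono (homologyMap φ.τ₃ j))

/-- In positive degree this is the four lemma on `H_j(X₁) → H_j(X₂) → H_j(X₃) → H_{j-1}(X₁)`. In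
degree `0` the last term is missing; surjectivity of `H_0(X₂) → H_0(X₃)` replaces it. -/
lemma epi_homologyMap_τ₂ {S₁ S₂ : ShortComplex (ChainComplex C ℕ)} (φ : S₁ ⟶ S₂)
    (hS₁ : S₁.ShortExact) (hS₂ : S₂.ShortExact) (h₁ : QuasiIso φ.τ₁) (h₃ : QuasiIso φ.τ₃) (j : ℕ) :
    Epi (homologyMap φ.τ₂ j) := by
  cases j with
  | succ j =>
    apply epi_of_epi_of_epi_of_mono ((δlastFunctor ⋙ δlastFunctor).map
      (mapComposableArrows₅ φ hS₁ hS₂ (j + 1) j rfl))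
    · exact (composableArrows₅_exact hS₁ (j + 1) j rfl).δlast.δlast
    · exact (composableArrows₅_exact hS₂ (j + 1) j rfl).δlast.δlast
    · exact inferInstanceAs (Epi (homologyMap φ.τ₁ (j + 1)))
    · exact inferInstanceAs (Epi (homologyMap φ.τ₃ (j + 1)))
    · exact inferInstanceAs (Mono (homologyMap φ.τ₁ j))
  | zero =>
    have e₁ : Epi (homologyMap S₁.g 0) := by
      have := hS₁.epi_g
      exact epi_homologyMap_of_epi_of_not_rel _ _ (by simp)
    rw [epi_iff_surjective_up_to_refinements]
    intro A x
    obtain ⟨A₁, π₁, _, y, hy⟩ := surjective_up_to_refinements_of_epi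
      (homologyMap S₁.g 0 ≫ homologyMap φ.τ₃ 0) (x ≫ homologyMap S₂.g 0)
    have comm : homologyMap S₁.g 0 ≫ homologyMap φ.τ₃ 0 =
        homologyMap φ.τ₂ 0 ≫ homologyMap S₂.g 0 := by
      rw [← homologyMap_comp, ← homologyMap_comp, φ.comm₂₃]
    rw [comm] at hy
    -- `y` has the same image as `x` in the homology of `S₂.X₃`, so the difference comes from that
    -- of `S₂.X₁`, where `φ.τ₁` can be inverted.
    obtain ⟨A₂, π₂, _, z, hz⟩ := (hS₂.homology_exact₂ 0).exact_up_to_refinements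
      (π₁ ≫ x - y ≫ homologyMap φ.τ₂ 0) (by
        dsimp
        rw [Preadditive.sub_comp, Category.assoc, Category.assoc, hy, sub_self])
    refine ⟨A₂, π₂ ≫ π₁, inferInstance, z ≫ inv (homologyMap φ.τ₁ 0) ≫ homologyMap S₁.f 0 +
      π₂ ≫ y, ?_⟩
    have comm' : homologyMap S₁.f 0 ≫ homologyMap φ.τ₂ 0 =
        homologyMap φ.τ₁ 0 ≫ homologyMap S₂.f 0 := by
      rw [← homologyMap_comp, ← homologyMap_comp, φ.comm₁₂]
    dsimp at hz
    rw [Preadditive.add_comp, Category.assoc, Category.assoc, Category.assoc, comm',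
      IsIso.inv_hom_id_assoc, ← hz, Preadditive.comp_sub]
    simp

lemma quasiIso_τ₂ {S₁ S₂ : ShortComplex (ChainComplex C ℕ)} (φ : S₁ ⟶ S₂)
    (hS₁ : S₁.ShortExact) (hS₂ : S₂.ShortExact) (h₁ : QuasiIso φ.τ₁) (h₃ : QuasiIso φ.τ₃) :
    QuasiIso φ.τ₂ := by
  rw [quasiIso_iff]
  intro j
  rw [quasiIsoAt_iff_isIso_homologyMap]
  have := mono_homologyMap_τ₂ φ hS₁ hS₂ h₁ h₃ j
  have := epi_homologyMap_τ₂ φ hS₁ hS₂ h₁ h₃ j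
  exact isIso_of_mono_of_epi _

/-- A monomorphism of complexes with acyclic cokernel is a quasi-isomorphism. -/
lemma quasiIso_f_of_acyclic {S : ShortComplex (ChainComplex C ℕ)} (hS : S.ShortExact)
    (h : S.X₃.Acyclic) : QuasiIso S.f := by
  rw [quasiIso_iff]
  intro j
  rw [quasiIsoAt_iff_isIso_homologyMap]
  have hz : ∀ i, IsZero (S.X₃.homology i) := fun i => (h i).isZero_homology
  have : Mono (homologyMap S.f j) :=
    (hS.homology_exact₁ (j + 1) j rfl).mono_g ((hz _).eq_of_src _ _)
  have : Epi (homologyMap S.f j) := (hS.homology_exact₂ j).epi_f ((hz _).eq_of_tgt _ _)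
  exact isIso_of_mono_of_epi _

end ShortExactQuasiIso

/-! ### Relative chains of maps of simplicial sets -/

namespace RelativeChain

variable {k : Type u} [Ring k] (R : ModuleCat.{u} k)

instance : ((SSet.chainComplexFunctor (ModuleCat.{u} k)).obj R).PreservesMonomorphisms where
  preserves f _ := by
    dsimp [SSet.chainComplexFunctor]
    apply +allowSynthFailures Functor.map_mono
    apply +allowSynthFailures Functor.map_mono
    dsimp [SSet, SimplicialObject.whiskering, SimplicialObject]
    infer_instance

/-- The chains of the target of a morphism modulo the image of the chains of the source. -/
abbrev rel : Arrow SSet.{u} ⥤ ChainComplex (ModuleCat.{u} k) ℕ :=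
  ((SSet.chainComplexFunctor (ModuleCat.{u} k)).obj R).mapArrow ⋙ coker _

/-- The short complex defining the relative chains. -/
def relShortComplex (f : Arrow SSet.{u}) : ShortComplex (ChainComplex (ModuleCat.{u} k) ℕ) :=
  ShortComplex.mk (SSet.chainComplexMap f.hom R) (cokernel.π (SSet.chainComplexMap f.hom R))
    (cokernel.condition _)

lemma relShortComplex_shortExact (f : Arrow SSet.{u}) [Mono f.hom] :
    (relShortComplex R f).ShortExact := by
  have : Mono (relShortComplex R f).f := inferInstanceAs (Mono (SSet.chainComplexMap f.hom R))
  have : Epi (relShortComplex R f).g :=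
    inferInstanceAs (Epi (cokernel.π (SSet.chainComplexMap f.hom R)))
  exact ShortComplex.ShortExact.mk
    (ShortComplex.exact_of_g_is_cokernel _ (cokernelIsCokernel _))

/-- The functoriality of the short complex of relative chains. -/
def relShortComplexMap {f g : Arrow SSet.{u}} (φ : f ⟶ g) :
    relShortComplex R f ⟶ relShortComplex R g where
  τ₁ := SSet.chainComplexMap φ.left R
  τ₂ := SSet.chainComplexMap φ.right R
  τ₃ := (rel R).map φ
  comm₁₂ := by
    change SSet.chainComplexMap _ R ≫ SSet.chainComplexMap _ R =
      SSet.chainComplexMap _ R ≫ SSet.chainComplexMap _ R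
    rw [← Functor.map_comp, ← Functor.map_comp]
    congr 1
    exact Arrow.w φ
  comm₂₃ := (cokernel.π_desc _ _ _).symm

lemma quasiIso_rel_map {f g : Arrow SSet.{u}} [Mono f.hom] [Mono g.hom] (φ : f ⟶ g)
    (h₁ : QuasiIso (SSet.chainComplexMap φ.left R))
    (h₂ : QuasiIso (SSet.chainComplexMap φ.right R)) : QuasiIso ((rel R).map φ) :=
  HomologicalComplex.HomologySequence.quasiIso_τ₃ (relShortComplexMap R φ)
    (relShortComplex_shortExact R f) (relShortComplex_shortExact R g) h₁ h₂

lemma quasiIso_right_of_rel {f g : Arrow SSet.{u}} [Mono f.hom] [Mono g.hom] (φ : f ⟶ g)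
    (h₁ : QuasiIso (SSet.chainComplexMap φ.left R)) (h₃ : QuasiIso ((rel R).map φ)) :
    QuasiIso (SSet.chainComplexMap φ.right R) :=
  ShortExactQuasiIso.quasiIso_τ₂ (relShortComplexMap R φ)
    (relShortComplex_shortExact R f) (relShortComplex_shortExact R g) h₁ h₃

/-- In degree `m` the chains are the coproduct of copies of `R` indexed by the `m`-simplices, and
forming this coproduct preserves pushouts of index sets. -/
lemma isPushout_chainComplexMap {A B A' B' : SSet.{u}} {t : A ⟶ A'} {l : A ⟶ B} {r : A' ⟶ B'}
    {b : B ⟶ B'} (h : IsPushout t l r b) :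
    IsPushout (SSet.chainComplexMap t R) (SSet.chainComplexMap l R) (SSet.chainComplexMap r R)
      (SSet.chainComplexMap b R) := by
  have w : SSet.chainComplexMap t R ≫ SSet.chainComplexMap r R =
      SSet.chainComplexMap l R ≫ SSet.chainComplexMap b R := by
    rw [← Functor.map_comp, ← Functor.map_comp, h.w]
  refine ⟨⟨w⟩, ⟨HomologicalComplex.isColimitOfEval _ _ fun m => ?_⟩⟩
  refine (isColimitMapCoconePushoutCoconeEquiv _ _).2 (IsPushout.isColimit ?_)
  have := (h.map ((evaluation _ _).obj (Opposite.op ⦋m⦌))).map (sigmaConst.{u}.obj R)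
  exact this

/-- Parallel sides of a pushout square have isomorphic cokernels: simplicial excision holds on the
nose, without subdivision. -/
lemma isIso_rel_map_of_isPushout {f g : Arrow SSet.{u}} (φ : f ⟶ g)
    (h : IsPushout φ.left f.hom g.hom φ.right) : IsIso ((rel R).map φ) := by
  exact isIso_cokernel_map_of_isPushout (isPushout_chainComplexMap R h).flip

end RelativeChain
end

noncomputable section

/-! ### Small singular simplices -/

namespace SmallSimplices

variable {k : Type u} [Ring k]

/-- A subcomplex is quasi-isomorphic to the whole complex if an endomorphism homotopic to the
identity eventually moves every chain into it. -/
lemma quasiIso_of_subdivision {A B : ChainComplex (ModuleCat.{u} k) ℕ} (i : A ⟶ B) [Mono i]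
    (S : ∀ m, B.X m ⟶ B.X m) (T : ∀ m, B.X m ⟶ B.X (m + 1)) (hS₀ : S 0 = 𝟙 _)
    (hST : ∀ m, T (m + 1) ≫ B.d (m + 2) (m + 1) + B.d (m + 1) m ≫ T m = 𝟙 _ - S (m + 1))
    (hT : ∀ m a, ∃ a', T m (i.f m a) = i.f (m + 1) a')
    (hS : ∀ m b, ∃ N a, (S m)^[N] b = i.f m a) : QuasiIso i := by
  let E : ShortComplex (ChainComplex (ModuleCat.{u} k) ℕ) :=
    ShortComplex.mk i (cokernel.π i) (cokernel.condition i)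
  have : Mono E.f := inferInstanceAs (Mono i)
  have : Epi E.g := inferInstanceAs (Epi (cokernel.π i))
  have hE : E.ShortExact := ShortComplex.ShortExact.mk
    (ShortComplex.exact_of_g_is_cokernel _ (cokernelIsCokernel _))
  have hEm : ∀ m, (E.map (HomologicalComplex.eval _ _ m)).ShortExact :=
    fun m => hE.map_of_exact _
  have hsurj : ∀ m (q : E.X₃.X m), ∃ b : B.X m, E.g.f m b = q :=
    fun m => (hEm m).moduleCat_surjective_g
  have hker : ∀ m (b : B.X m), E.g.f m b = 0 → ∃ a : A.X m, i.f m a = b :=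
    fun m => (ShortComplex.moduleCat_exact_iff _).1 (hEm m).exact
  have hzero : ∀ m (a : A.X m), E.g.f m (i.f m a) = 0 :=
    fun m a => (E.map (HomologicalComplex.eval _ _ m)).moduleCat_zero_apply a
  have hcomm : ∀ m n (b : B.X m), E.g.f n (B.d m n b) = E.X₃.d m n (E.g.f m b) := fun m n b =>
    (ConcreteCategory.congr_hom (E.g.comm m n) b).symm
  have hcommi : ∀ m n (a : A.X m), i.f n (A.d m n a) = B.d m n (i.f m a) := fun m n a =>
    (ConcreteCategory.congr_hom (i.comm m n) a).symm
  have hdd : ∀ m n l (b : B.X m), B.d n l (B.d m n b) = 0 := fun m n l b =>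
    ConcreteCategory.congr_hom (B.d_comp_d m n l) b
  have hST' : ∀ m (b : B.X (m + 1)), b = S (m + 1) b + B.d (m + 2) (m + 1) (T (m + 1) b) +
      T m (B.d (m + 1) m b) := fun m b => by
    have : B.d (m + 2) (m + 1) (T (m + 1) b) + T m (B.d (m + 1) m b) = b - S (m + 1) b :=
      ConcreteCategory.congr_hom (hST m) b
    rw [add_assoc, this]
    abel
  -- A chain with boundary in the subcomplex agrees with its `N`-th subdivision up to a boundary and
  -- a chain of the subcomplex. The induction needs that its subdivision again has boundary in the
  -- subcomplex, which follows by applying the differential to `hb`.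
  have iter : ∀ N m (b : B.X (m + 1)), (∃ a, B.d (m + 1) m b = i.f m a) →
      ∃ c a, b = (S (m + 1))^[N] b + B.d (m + 2) (m + 1) c + i.f (m + 1) a := by
    intro N m
    induction N with
    | zero => exact fun b _ => ⟨0, 0, by simp⟩
    | succ N ih =>
      rintro b ⟨a, ha⟩
      obtain ⟨a', ha'⟩ := hT m a
      have hb := hST' m b
      rw [ha, ha'] at hb
      obtain ⟨c, a₁, h⟩ := ih (S (m + 1) b) ⟨a - A.d (m + 1) m a', by
        have := congrArg (B.d (m + 1) m) hb
        rw [map_add, map_add, hdd, add_zero, ha, ← hcommi] at this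
        rw [map_sub, this, add_sub_cancel_right]⟩
      refine ⟨c + T (m + 1) b, a₁ + a', ?_⟩
      rw [Function.iterate_succ_apply, map_add, map_add]
      refine hb.trans ((congrArg (fun x => x + B.d (m + 2) (m + 1) (T (m + 1) b) +
        i.f (m + 1) a') h).trans ?_)
      abel
  refine ShortExactQuasiIso.quasiIso_f_of_acyclic hE fun m => ?_
  cases m with
  | zero =>
    rw [HomologicalComplex.exactAt_iff' _ 1 0 0 (by simp) (by simp),
      ShortComplex.moduleCat_exact_iff]
    intro q _
    obtain ⟨b, rfl⟩ := hsurj 0 q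
    obtain ⟨N, a, h⟩ := hS 0 b
    -- Since `S 0` is the identity, every chain of degree `0` already lies in the subcomplex and the
    -- quotient is zero there.
    have : ∀ N, (S 0)^[N] b = b := fun N => by
      induction N with
      | zero => rfl
      | succ N ih => rw [Function.iterate_succ_apply', ih, hS₀]; rfl
    rw [this] at h
    exact ⟨0, by rw [map_zero, h]; exact (hzero 0 a).symm⟩
  | succ m =>
    rw [HomologicalComplex.exactAt_iff' _ (m + 2) (m + 1) m (by simp) (by simp),
      ShortComplex.moduleCat_exact_iff]
    intro q hq
    obtain ⟨b, rfl⟩ := hsurj (m + 1) q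
    obtain ⟨a, ha⟩ := hker m (B.d (m + 1) m b) (by rw [hcomm]; exact hq)
    obtain ⟨N, a₁, h₁⟩ := hS (m + 1) b
    obtain ⟨c, a₂, h₂⟩ := iter N m b ⟨a, ha.symm⟩
    refine ⟨E.g.f (m + 2) c, ?_⟩
    change E.X₃.d (m + 2) (m + 1) (E.g.f (m + 2) c) = E.g.f (m + 1) b
    rw [← hcomm, h₂, h₁, map_add, map_add, hzero, hzero, zero_add, add_zero]

open AffineChain SingularChain Opposite

variable (R : ModuleCat.{u} k) {Y : TopCat.{u}}

/-- The singular simplices contained in a subset. -/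
def within (S : Set Y) : (TopCat.toSSet.obj Y).Subcomplex where
  obj n := {s | ∀ t, Y.toSSetObjEquiv n s t ∈ S}
  map f _ hs t := hs (stdSimplex.map f.unop t)

lemma restr_mem_within {S : Set Y} {m n : ℕ} {s : TopCat.toSSet.obj Y _⦋m⦌}
    (hs : s ∈ (within S).obj (op ⦋m⦌)) (w : Fin (n + 1) → Simplex m) :
    restr s w ∈ (within S).obj (op ⦋n⦌) := by
  intro t
  exact (restr_apply s w t).symm ▸ hs _

section

variable (Z : SSet.{u}) (M : Z.Subcomplex) (m : ℕ)

/-- The submodule of chains supported on a subcomplex. -/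
def chainsOf : Submodule k ((Z.chainComplex R).X m) :=
  LinearMap.range ((SSet.chainComplexMap M.ι R).f m).hom

lemma ι_mem_chainsOf {z : Z _⦋m⦌} (hz : z ∈ M.obj (op ⦋m⦌)) (r : R) :
    Z.ιChainComplex (R := R) z r ∈ chainsOf R Z M m :=
  ⟨(M : SSet.{u}).ιChainComplex (R := R) (⟨z, hz⟩ : (M : SSet.{u}) _⦋m⦌) r,
    ConcreteCategory.congr_hom (SSet.ι_chainComplexMap_f _ _ M.ι R _) r⟩

/-- Chains are sums of multiples of simplices. -/
lemma eq_top_of_ι_mem (P : Submodule k ((Z.chainComplex R).X m))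
    (h : ∀ z r, Z.ιChainComplex (R := R) z r ∈ P) : P = ⊤ := by
  rw [← Submodule.ker_mkQ P, LinearMap.ker_eq_top]
  have : ModuleCat.ofHom P.mkQ = 0 := by
    apply SSet.chainComplex_hom_ext
    intro z
    ext r
    exact (Submodule.Quotient.mk_eq_zero P).2 (h z r)
  exact congrArg ModuleCat.Hom.hom this

end

lemma realize_mem_chainsOf (M : (TopCat.toSSet.obj Y).Subcomplex) {m n : ℕ}
    (s : TopCat.toSSet.obj Y _⦋m⦌) (c : Chain n m)
    (h : ∀ w ∈ c.support, restr s w ∈ M.obj (op ⦋n⦌)) (r : R) :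
    realize R s c r ∈ chainsOf R _ M n := by
  rw [linearMap_eq_sum]
  change (ModuleCat.Hom.hom _) r ∈ _
  rw [ModuleCat.hom_sum, LinearMap.sum_apply]
  refine Submodule.sum_mem _ fun w hw => ?_
  rw [ModuleCat.hom_zsmul, LinearMap.smul_apply, realize_single]
  exact zsmul_mem (ι_mem_chainsOf R _ M n (h w hw) r) _

variable {U V : Set Y}

/-- Take a Lebesgue number `δ` of the cover pulled back to the compact simplex, and subdivide until
vertices are less than `δ / 2` apart; by convexity each piece lies in a `δ`-ball around its first
vertex, hence in one member of the cover. -/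
lemma exists_iterate_sd_small (hU : IsOpen U) (hV : IsOpen V) (hUV : U ∪ V = Set.univ) {m : ℕ}
    (s : TopCat.toSSet.obj Y _⦋m⦌) :
    ∃ N : ℕ, ∀ w ∈ ((sd m)^[N] (Finsupp.single (stdSimplex.vertex (S := ℝ)) 1)).support,
      restr s w ∈ (within U ⊔ within V).obj (op ⦋m⦌) := by
  let f : C(Simplex m, Y) := Y.toSSetObjEquiv (op ⦋m⦌) s
  let c : Bool → Set (Simplex m) := fun b => f ⁻¹' (bif b then U else V)
  have hc : ∀ b, IsOpen (c b) := by
    rintro (_ | _)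
    · exact hV.preimage f.continuous
    · exact hU.preimage f.continuous
  obtain ⟨δ, hδ, h⟩ := lebesgue_number_lemma_of_metric (s := Set.univ) (c := c) isCompact_univ hc
    (by
      intro t _
      rcases (hUV.symm ▸ Set.mem_univ (f t) : f t ∈ U ∪ V) with h | h
      · exact Set.mem_iUnion.2 ⟨true, h⟩
      · exact Set.mem_iUnion.2 ⟨false, h⟩)
  obtain ⟨N, hN⟩ := exists_iterate_sd_dist_lt m (half_pos hδ)
  refine ⟨N, fun w hw => ?_⟩
  obtain ⟨b, hb⟩ := h (w 0) (Set.mem_univ _)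
  have key : ∀ t, f (comb w t) ∈ (bif b then U else V) := fun t => hb (Metric.mem_ball.2
    ((dist_comb_le w t (w 0) fun i => (hN w hw i 0).le).trans_lt (half_lt_self hδ)))
  cases b with
  | true => exact Or.inl fun t => (restr_apply s w t).symm ▸ key t
  | false => exact Or.inr fun t => (restr_apply s w t).symm ▸ key t

/-- The singular simplices that are small with respect to an open cover by two subsets compute
singular homology. -/
theorem quasiIso_small (hU : IsOpen U) (hV : IsOpen V) (hUV : U ∪ V = Set.univ) :
    QuasiIso (SSet.chainComplexMap (within U ⊔ within V).ι R) := by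
  set M := within U ⊔ within V with hM
  have hrestr : ∀ {m n : ℕ} (s : TopCat.toSSet.obj Y _⦋m⦌) (w : Fin (n + 1) → Simplex m),
      s ∈ M.obj (op ⦋m⦌) → restr s w ∈ M.obj (op ⦋n⦌) := by
    rintro m n s w (h | h)
    · exact Or.inl (restr_mem_within h w)
    · exact Or.inr (restr_mem_within h w)
  have hι : ∀ {m : ℕ} (s : TopCat.toSSet.obj Y _⦋m⦌) (r : R) (N : ℕ),
      (subdivision Y R m)^[N] ((TopCat.toSSet.obj Y).ιChainComplex (R := R) s r) =
        realize R s ((sd m)^[N] (Finsupp.single stdSimplex.vertex 1)) r := by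
    intro m s r N
    induction N with
    | zero => rw [Function.iterate_zero, Function.iterate_zero, id, id, realize_vertex]
    | succ N ih =>
      rw [Function.iterate_succ_apply', Function.iterate_succ_apply', ih, ← realize_subdivision]
      rfl
  have hsub : ∀ m x, x ∈ chainsOf R _ M m → subdivision Y R m x ∈ chainsOf R _ M m := by
    rintro m _ ⟨a, rfl⟩
    suffices (chainsOf R _ M m).comap
        ((SSet.chainComplexMap M.ι R).f m ≫ subdivision Y R m).hom = ⊤ from
      this.symm.le Submodule.mem_top
    apply eq_top_of_ι_mem
    intro z r
    change subdivision Y R m ((SSet.chainComplexMap M.ι R).f m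
      ((M : SSet.{u}).ιChainComplex (R := R) z r)) ∈ chainsOf R _ M m
    rw [show (SSet.chainComplexMap M.ι R).f m ((M : SSet.{u}).ιChainComplex (R := R) z r) =
      (TopCat.toSSet.obj Y).ιChainComplex (R := R) z.1 r from
      ConcreteCategory.congr_hom (SSet.ι_chainComplexMap_f _ _ M.ι R z) r]
    have := hι z.1 r 1
    rw [Function.iterate_one, Function.iterate_one] at this
    rw [this]
    exact realize_mem_chainsOf R M _ _ (fun w _ => hrestr _ _ z.2) r
  refine quasiIso_of_subdivision _ (subdivision Y R) (subdivisionHomotopy Y R)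
    (subdivision_zero R) (subdivisionHomotopy_comm R) (fun m a => ?_) (fun m b => ?_)
  · suffices (chainsOf R _ M (m + 1)).comap
        ((SSet.chainComplexMap M.ι R).f m ≫ subdivisionHomotopy Y R m).hom = ⊤ by
      obtain ⟨a', ha'⟩ := this.symm.le (Submodule.mem_top (x := a))
      exact ⟨a', ha'.symm⟩
    apply eq_top_of_ι_mem
    intro z r
    change subdivisionHomotopy Y R m ((SSet.chainComplexMap M.ι R).f m
      ((M : SSet.{u}).ιChainComplex (R := R) z r)) ∈ chainsOf R _ M (m + 1)
    rw [show (SSet.chainComplexMap M.ι R).f m ((M : SSet.{u}).ιChainComplex (R := R) z r) =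
      (TopCat.toSSet.obj Y).ιChainComplex (R := R) z.1 r from
      ConcreteCategory.congr_hom (SSet.ι_chainComplexMap_f _ _ M.ι R z) r]
    rw [show subdivisionHomotopy Y R m ((TopCat.toSSet.obj Y).ιChainComplex (R := R) z.1 r) =
      realize R z.1 (sdHomotopy m (Finsupp.single stdSimplex.vertex 1)) r from
      ConcreteCategory.congr_hom (ι_subdivisionHomotopy R z.1) r]
    exact realize_mem_chainsOf R M _ _ (fun w _ => hrestr _ _ z.2) r
  · have hmono : ∀ {x} {N N' : ℕ}, N ≤ N' → (subdivision Y R m)^[N] x ∈ chainsOf R _ M m →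
        (subdivision Y R m)^[N'] x ∈ chainsOf R _ M m := by
      intro x N N' h hx
      induction N', h using Nat.le_induction with
      | base => exact hx
      | succ N' _ ih => rw [Function.iterate_succ_apply']; exact hsub _ _ ih
    -- Chains that become small after some number of subdivisions form a submodule, because
    -- smallness persists under further subdivision (`hmono`); it is therefore enough to treat
    -- single simplices.
    let P : Submodule k (((TopCat.toSSet.obj Y).chainComplex R).X m) :=
      { carrier := {x | ∃ N : ℕ, (subdivision Y R m)^[N] x ∈ chainsOf R _ M m}
        zero_mem' := ⟨0, zero_mem _⟩
        add_mem' := by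
          rintro x y ⟨N, hx⟩ ⟨N', hy⟩
          refine ⟨max N N', ?_⟩
          rw [iterate_map_add]
          exact add_mem (hmono (le_max_left _ _) hx) (hmono (le_max_right _ _) hy)
        smul_mem' := by
          rintro c x ⟨N, hx⟩
          refine ⟨N, ?_⟩
          rw [Function.Commute.iterate_left (f := subdivision Y R m) (g := fun x => c • x)
            (fun x => map_smul (subdivision Y R m).hom c x) N x]
          exact Submodule.smul_mem _ _ hx }
    have hP : P = ⊤ := by
      apply eq_top_of_ι_mem
      intro s r
      obtain ⟨N, hN⟩ := exists_iterate_sd_small hU hV hUV s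
      refine ⟨N, ?_⟩
      rw [hι]
      exact realize_mem_chainsOf R M s _ hN r
    obtain ⟨N, a, ha⟩ := hP.symm.le (Submodule.mem_top (x := b))
    exact ⟨N, a, ha.symm⟩

end SmallSimplices
end

noncomputable section

/-! ### Pushouts of topological spaces -/

namespace TopPushout

variable {A B D Y : TopCat.{u}} {a : A ⟶ B} {i : A ⟶ D} {j : B ⟶ Y} {q : D ⟶ Y}

lemma comm_apply (h : IsPushout a i j q) (x : A) : j (a x) = q (i x) :=
  ConcreteCategory.congr_hom h.w x

lemma exists_continuousMap (h : IsPushout a i j q) {Z : Type u} [TopologicalSpace Z] (f : C(B, Z))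
    (g : C(D, Z)) (w : ∀ x, f (a x) = g (i x)) :
    ∃ φ : C(Y, Z), (∀ b, φ (j b) = f b) ∧ ∀ d, φ (q d) = g d := by
  have w' : a ≫ TopCat.ofHom f = i ≫ TopCat.ofHom g := by
    ext x
    exact w x
  refine ⟨(h.desc (TopCat.ofHom f) (TopCat.ofHom g) w').hom, fun b => ?_, fun d => ?_⟩
  · exact ConcreteCategory.congr_hom (h.inl_desc _ _ w') b
  · exact ConcreteCategory.congr_hom (h.inr_desc _ _ w') d

/-- Every function into an indiscrete space is continuous, so the universal property also holds for
mere functions: the pushout of spaces has the pushout of sets as underlying set. -/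
lemma exists_function (h : IsPushout a i j q) {S : Type u} (f : B → S) (g : D → S)
    (w : ∀ x, f (a x) = g (i x)) : ∃ φ : Y → S, (∀ b, φ (j b) = f b) ∧ ∀ d, φ (q d) = g d := by
  let _ : TopologicalSpace S := ⊤
  obtain ⟨φ, hφ⟩ := exists_continuousMap h ⟨f, continuous_top⟩ ⟨g, continuous_top⟩ w
  exact ⟨φ, hφ⟩

/-- The constant function `True` and the indicator of the union of the two images agree on `B` and
on `D`, hence everywhere. -/
lemma exists_preimage (h : IsPushout a i j q) (y : Y) : (∃ b, j b = y) ∨ ∃ d, q d = y := by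
  let _ : TopologicalSpace (ULift.{u} Prop) := ⊤
  let k₁ : Y ⟶ TopCat.of (ULift.{u} Prop) := TopCat.ofHom ⟨fun _ => ⟨True⟩, continuous_top⟩
  let k₂ : Y ⟶ TopCat.of (ULift.{u} Prop) :=
    TopCat.ofHom ⟨fun y => ⟨(∃ b, j b = y) ∨ ∃ d, q d = y⟩, continuous_top⟩
  have hj : j ≫ k₁ = j ≫ k₂ := by
    ext b
    exact ⟨fun _ => Or.inl ⟨b, rfl⟩, fun _ => trivial⟩
  have hq : q ≫ k₁ = q ≫ k₂ := by
    ext b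
    exact ⟨fun _ => Or.inr ⟨b, rfl⟩, fun _ => trivial⟩
  exact of_eq_true (congrArg ULift.down (ConcreteCategory.congr_hom (h.hom_ext hj hq) y)).symm

lemma isOpen_of_preimage (h : IsPushout a i j q) {O : Set Y} (hj : IsOpen (j ⁻¹' O))
    (hq : IsOpen (q ⁻¹' O)) : IsOpen O := by
  refine (TopCat.isOpen_iff_of_isColimit _ h.isColimit O).2 ?_
  rintro (_ | _ | _)
  · change IsOpen ((a ≫ j) ⁻¹' O)
    exact hj.preimage a.hom.continuous
  · exact hj
  · exact hq

/-- The partial inverse `φ` of `j` shows that gluing identifies no two points of `B`, and that a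
point of `D` meets `B` only through `A`. -/
lemma exists_retraction (hi : IsClosedEmbedding i) (h : IsPushout a i j q) :
    ∃ φ : Y → Option B, (∀ b, φ (j b) = some b) ∧
    ∀ d b, φ (q d) = some b → ∃ x, i x = d ∧ a x = b := by
  classical
  let g : D → Option B := fun d => if hd : ∃ x, i x = d then some (a hd.choose) else none
  obtain ⟨φ, h₁, h₂⟩ := exists_function h (S := Option B) some g (fun x => by
    have hx : ∃ x', i x' = i x := ⟨x, rfl⟩
    simp only [g, dif_pos hx]
    rw [hi.injective hx.choose_spec])
  refine ⟨φ, h₁, fun d b hb => ?_⟩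
  rw [h₂] at hb
  by_cases hd : ∃ x, i x = d
  · simp only [g, dif_pos hd, Option.some.injEq] at hb
    exact ⟨_, hd.choose_spec, hb⟩
  · simp only [g, dif_neg hd] at hb
    exact absurd hb (by simp)

/-- For `K` closed in `B`, the preimage of `j '' K` in `B` is `K` and in `D` is `i '' (a ⁻¹' K)`;
both are closed. -/
lemma isClosedEmbedding (hi : IsClosedEmbedding i) (h : IsPushout a i j q) :
    IsClosedEmbedding j := by
  obtain ⟨φ, h₁, h₂⟩ := exists_retraction hi h
  have inj : Function.Injective j := fun b b' hb => by
    have := congrArg φ hb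
    rwa [h₁, h₁, Option.some.injEq] at this
  refine .of_continuous_injective_isClosedMap j.hom.continuous inj fun K hK => ?_
  rw [← isOpen_compl_iff]
  apply isOpen_of_preimage h
  · rw [Set.preimage_compl, Set.preimage_image_eq _ inj]
    exact hK.isOpen_compl
  · rw [Set.preimage_compl]
    have : q ⁻¹' (j '' K) = i '' (a ⁻¹' K) := by
      ext d
      constructor
      · rintro ⟨b, hb, hbd⟩
        obtain ⟨x, hx, hxb⟩ := h₂ d b (by rw [← hbd, h₁])
        exact ⟨x, by rwa [Set.mem_preimage, hxb], hx⟩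
      · rintro ⟨x, hx, rfl⟩
        exact ⟨a x, hx, comm_apply h x⟩
    change IsOpen (q ⁻¹' (j '' K))ᶜ
    rw [this]
    exact (hi.isClosedMap _ (hK.preimage a.hom.continuous)).isOpen_compl

end TopPushout

/-! ### Collars -/

/-- A closed subspace with a neighbourhood `{ρ < 1 / 2}` that can be deformed into it. -/
structure Collar {A D : TopCat.{u}} (i : A ⟶ D) where
  /-- the inclusion is a closed embedding -/
  isClosedEmbedding : IsClosedEmbedding i
  /-- a function that vanishes on the subspace -/
  ρ : C(D, ℝ)
  /-- the deformation -/
  h : C(D, C(unitInterval, D))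
  ρ_i : ∀ x, ρ (i x) = 0
  h_zero : ∀ d, h d 0 = d
  h_i : ∀ x t, h (i x) t = i x
  ρ_h : ∀ d t, ρ d < 1 / 2 → ρ (h d t) < 1 / 2
  h_one : ∀ d, ρ d < 1 / 2 → ∃ x, i x = h d 1

namespace Collar

section

variable {A D : TopCat.{u}} {i : A ⟶ D} (c : Collar i)

/-- The neighbourhood of the subspace. -/
def U : Set D := {d | c.ρ d < 1 / 2}

/-- An open subset of the complement of the subspace. -/
def V : Set D := {d | 0 < c.ρ d}

lemma isOpen_U : IsOpen c.U := isOpen_lt c.ρ.continuous continuous_const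

lemma isOpen_V : IsOpen c.V := isOpen_lt continuous_const c.ρ.continuous

lemma U_union_V : c.U ∪ c.V = Set.univ := by
  rw [Set.eq_univ_iff_forall]
  intro d
  by_cases h : c.ρ d < 1 / 2
  · exact Or.inl h
  · exact Or.inr (lt_of_lt_of_le (by norm_num) (not_lt.1 h))

/-- The inclusion of the neighbourhood. -/
def inclU : TopCat.of c.U ⟶ D := TopCat.ofHom ⟨Subtype.val, continuous_subtype_val⟩

lemma i_mem_U (x : A) : i x ∈ c.U := by
  change c.ρ (i x) < 1 / 2
  rw [c.ρ_i]
  norm_num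

/-- The inclusion of the subspace in its neighbourhood. -/
def toU : A ⟶ TopCat.of c.U :=
  TopCat.ofHom ⟨fun x => ⟨i x, c.i_mem_U x⟩, i.hom.continuous.subtype_mk _⟩

/-- The retraction of the neighbourhood. -/
def retr : TopCat.of c.U ⟶ A :=
  TopCat.ofHom ⟨fun d => (c.h_one d.1 d.2).choose, by
    -- The preimages under `i` are chosen pointwise; continuity can be tested after the embedding
    -- `i`, where the map becomes the time-one deformation.
    rw [c.isClosedEmbedding.isEmbedding.continuous_iff]
    have : (i ∘ fun d : c.U => (c.h_one d.1 d.2).choose) = fun d : c.U => c.h d.1 1 := by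
      funext d
      exact (c.h_one d.1 d.2).choose_spec
    rw [this]
    exact ((continuous_eval_const 1).comp c.h.continuous).comp continuous_subtype_val⟩

lemma i_retr (d : TopCat.of c.U) : i (c.retr d) = c.h d.1 1 := (c.h_one d.1 d.2).choose_spec

lemma toU_retr : c.toU ≫ c.retr = 𝟙 A := by
  ext x
  apply c.isClosedEmbedding.injective
  exact (c.i_retr (c.toU x)).trans (c.h_i x 1)

/-- The deformation of the neighbourhood into the subspace. -/
def homotopy : TopCat.Homotopy (𝟙 (TopCat.of c.U)) (c.retr ≫ c.toU) where
  toFun p := ⟨c.h p.2.1 p.1, c.ρ_h _ _ p.2.2⟩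
  continuous_toFun := by
    refine Continuous.subtype_mk ?_ _
    have : Continuous fun p : unitInterval × c.U => (c.h p.2.1, p.1) :=
      (c.h.continuous.comp (continuous_subtype_val.comp continuous_snd)).prodMk continuous_fst
    exact continuous_eval.comp this
  map_zero_left d := Subtype.ext (c.h_zero d.1)
  map_one_left d := Subtype.ext (c.i_retr d).symm

end

end Collar

section

variable {k : Type u} [Ring k] (R : ModuleCat.{u} k)

/-- Homotopy equivalences induce quasi-isomorphisms on singular chains. -/
lemma quasiIso_toSSet_map_of_homotopy {X Y : TopCat.{u}} (f : X ⟶ Y) (g : Y ⟶ X)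
    (h₁ : TopCat.Homotopy (f ≫ g) (𝟙 X)) (h₂ : TopCat.Homotopy (g ≫ f) (𝟙 Y)) :
    QuasiIso (SSet.chainComplexMap (TopCat.toSSet.map f) R) := by
  let e : HomotopyEquiv ((TopCat.toSSet.obj X).chainComplex R)
      ((TopCat.toSSet.obj Y).chainComplex R) :=
    { hom := SSet.chainComplexMap (TopCat.toSSet.map f) R
      inv := SSet.chainComplexMap (TopCat.toSSet.map g) R
      homotopyHomInvId := (Homotopy.ofEq (by
        rw [← Functor.map_comp, ← Functor.map_comp])).trans
        ((h₁.toSSet.chainComplexMap R).trans (Homotopy.ofEq (by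
          rw [SSet.chainComplexMap, CategoryTheory.Functor.map_id, CategoryTheory.Functor.map_id])))
      homotopyInvHomId := (Homotopy.ofEq (by
        rw [← Functor.map_comp, ← Functor.map_comp])).trans
        ((h₂.toSSet.chainComplexMap R).trans (Homotopy.ofEq (by
          rw [SSet.chainComplexMap, CategoryTheory.Functor.map_id,
            CategoryTheory.Functor.map_id]))) }
  exact e.quasiIso_hom

lemma Collar.quasiIso_toU {A D : TopCat.{u}} {i : A ⟶ D} (c : Collar i) :
    QuasiIso (SSet.chainComplexMap (TopCat.toSSet.map c.toU) R) :=
  quasiIso_toSSet_map_of_homotopy R c.toU c.retr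
    ((ContinuousMap.Homotopy.refl _).cast rfl (congrArg TopCat.Hom.hom c.toU_retr.symm)).symm
    c.homotopy.symm

end
end

noncomputable section

/-! ### Excision for collars -/

namespace SSet.Subcomplex

variable {Z Z' : SSet.{u}} (f : Z ⟶ Z')

/-- The restriction of a morphism to subcomplexes. -/
def restrict (N : Z.Subcomplex) (N' : Z'.Subcomplex)
    (h : ∀ n, ∀ z ∈ N.obj n, f.app n z ∈ N'.obj n) : (N : SSet) ⟶ N' :=
  Subcomplex.lift (N.ι ≫ f) (by
    rintro n _ ⟨z, rfl⟩
    exact h n z.1 z.2)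

/-- Levelwise `f` maps the complement of `N` in `M` bijectively onto that of `N'` in `M'`. Nothing
is required of `f` on `N`, where the attaching map may glue simplices together. -/
lemma isPushout_restrict {N M : Z.Subcomplex} (hNM : N ≤ M) {N' M' : Z'.Subcomplex}
    (hNM' : N' ≤ M') (hN : ∀ n, ∀ z ∈ N.obj n, f.app n z ∈ N'.obj n)
    (hM : ∀ n, ∀ z ∈ M.obj n, f.app n z ∈ M'.obj n)
    (hpre : ∀ n, ∀ z ∈ M.obj n, f.app n z ∈ N'.obj n → z ∈ N.obj n)
    (hsurj : ∀ n, ∀ z' ∈ M'.obj n, z' ∉ N'.obj n → ∃ z ∈ M.obj n, f.app n z = z')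
    (hinj : ∀ n, ∀ z ∈ M.obj n, ∀ w ∈ M.obj n, z ∉ N.obj n → w ∉ N.obj n →
      f.app n z = f.app n w → z = w) :
    IsPushout (restrict f N N' hN) (homOfLE hNM) (homOfLE hNM') (restrict f M M' hM) where
  w := rfl
  isColimit' := ⟨evaluationJointlyReflectsColimits _ (fun n ↦ by
    refine (isColimitMapCoconePushoutCoconeEquiv _ _).2 (IsPushout.isColimit ?_)
    have : Mono (((CategoryTheory.evaluation SimplexCategoryᵒᵖ (Type u)).obj n).map (homOfLE hNM')) := by
      rw [mono_iff_injective]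
      intro x y h
      exact Subtype.ext (congrArg (fun z => z.1) h)
    refine Types.isPushout_of_isPullback_of_mono' ?_ ?_ ?_
    · rw [Types.isPullback_iff]
      refine ⟨rfl, fun x y h => Subtype.ext (congrArg (fun z => z.1) h.2), fun x y h => ?_⟩
      have h' : x.1 = f.app n y.1 := congrArg (fun z => z.1) h
      exact ⟨⟨y.1, hpre n y.1 y.2 (h' ▸ x.2)⟩, Subtype.ext h'.symm, rfl⟩
    · rw [Set.eq_univ_iff_forall]
      intro z
      by_cases hz : z.1 ∈ N'.obj n
      · exact Or.inl ⟨⟨z.1, hz⟩, rfl⟩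
      · obtain ⟨w, hw, h⟩ := hsurj n z.1 z.2 hz
        exact Or.inr ⟨⟨w, hw⟩, Subtype.ext h⟩
    · intro x y hx hy h
      exact Subtype.ext (hinj n x.1 x.2 y.1 y.2 (fun h => hx ⟨⟨x.1, h⟩, rfl⟩)
        (fun h => hy ⟨⟨y.1, h⟩, rfl⟩) (congrArg (fun z => z.1) h)))⟩

end SSet.Subcomplex

namespace Collar

open SmallSimplices SSet.Subcomplex

section

variable {A D : TopCat.{u}} {i : A ⟶ D} (c : Collar i)

lemma mem_within_of_map (n : SimplexCategoryᵒᵖ) (s : (TopCat.toSSet.obj A).obj n) :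
    (TopCat.toSSet.map i).app n s ∈ (within c.U).obj n := fun t =>
  c.i_mem_U (A.toSSetObjEquiv n s t)

/-- Singular simplices in the subspace are small. -/
def toWithin : TopCat.toSSet.obj A ⟶ (within c.U : SSet) :=
  SSet.Subcomplex.lift (TopCat.toSSet.map i) (by
    rintro n _ ⟨z, rfl⟩
    exact c.mem_within_of_map n z)

/-- The comparison of the singular simplices of the neighbourhood with the singular simplices
contained in it. -/
def fromSingU : TopCat.toSSet.obj (TopCat.of c.U) ⟶ (within c.U : SSet) :=
  SSet.Subcomplex.lift (TopCat.toSSet.map c.inclU) (by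
    rintro n _ ⟨z, rfl⟩ t
    exact ((TopCat.of c.U).toSSetObjEquiv n z t).2)

instance : IsIso c.fromSingU := by
  rw [NatTrans.isIso_iff_isIso_app]
  intro n
  rw [isIso_iff_bijective]
  constructor
  · intro s t h
    apply ((TopCat.of c.U).toSSetObjEquiv n).injective
    ext x
    have := congrArg (fun z => D.toSSetObjEquiv n z.1 x) h
    exact this
  · rintro ⟨s, hs⟩
    refine ⟨((TopCat.of c.U).toSSetObjEquiv n).symm
      ⟨fun x => ⟨D.toSSetObjEquiv n s x, hs x⟩,
        (D.toSSetObjEquiv n s).continuous.subtype_mk _⟩, ?_⟩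
    apply Subtype.ext
    apply (D.toSSetObjEquiv n).injective
    ext x
    rfl

lemma mono_map (c : Collar i) : Mono (TopCat.toSSet.map i) := by
  have : Mono i := (TopCat.mono_iff_injective i).2 c.isClosedEmbedding.injective
  infer_instance

variable {k : Type u} [Ring k] (R : ModuleCat.{u} k)

lemma quasiIso_toWithin : QuasiIso (SSet.chainComplexMap c.toWithin R) := by
  have h : c.toWithin = TopCat.toSSet.map c.toU ≫ c.fromSingU := rfl
  have := c.quasiIso_toU R
  rw [h, SSet.chainComplexMap, Functor.map_comp]
  infer_instance

lemma within_le : within c.U ≤ within c.U ⊔ within c.V := le_sup_left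

/-- Pass from the subspace to its neighbourhood. -/
def arrowToWithin : Arrow.mk (TopCat.toSSet.map i) ⟶ Arrow.mk (within c.U).ι :=
  Arrow.homMk c.toWithin (𝟙 _) rfl

/-- Pass to small simplices. -/
def arrowFromSmall : Arrow.mk (SSet.Subcomplex.homOfLE c.within_le) ⟶ Arrow.mk (within c.U).ι :=
  Arrow.homMk (𝟙 _) (within c.U ⊔ within c.V).ι rfl

lemma quasiIso_arrowToWithin : QuasiIso ((RelativeChain.rel R).map c.arrowToWithin) := by
  have : Mono (Arrow.mk (TopCat.toSSet.map i)).hom := c.mono_map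
  have : Mono (Arrow.mk (within c.U).ι).hom := inferInstanceAs (Mono (within c.U).ι)
  refine RelativeChain.quasiIso_rel_map R _ (c.quasiIso_toWithin R) ?_
  change QuasiIso (SSet.chainComplexMap (𝟙 _) R)
  infer_instance

lemma quasiIso_arrowFromSmall : QuasiIso ((RelativeChain.rel R).map c.arrowFromSmall) := by
  have : Mono (Arrow.mk (SSet.Subcomplex.homOfLE c.within_le)).hom := inferInstanceAs (Mono (SSet.Subcomplex.homOfLE c.within_le))
  have : Mono (Arrow.mk (within c.U).ι).hom := inferInstanceAs (Mono (within c.U).ι)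
  refine RelativeChain.quasiIso_rel_map R _ ?_ (quasiIso_small R c.isOpen_U c.isOpen_V c.U_union_V)
  change QuasiIso (SSet.chainComplexMap (𝟙 _) R)
  infer_instance

end

section

variable {A B D Y : TopCat.{u}} {a : A ⟶ B} {i : A ⟶ D} {j : B ⟶ Y} {q : D ⟶ Y}
variable {k : Type u} [Ring k] (R : ModuleCat.{u} k)

/-- A map that is a homeomorphism off the neighbourhoods of the subspaces induces a
quasi-isomorphism on relative singular chains. -/
lemma quasiIso_rel_map (c : Collar i) (c' : Collar j) (w : a ≫ j = i ≫ q)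
    (hρ : ∀ d, c'.ρ (q d) = c.ρ d)
    (hq : ∀ d d', 0 < c.ρ d → q d = q d' → d = d')
    (s : C(c'.V, D)) (hs : ∀ y, q (s y) = y) :
    QuasiIso ((RelativeChain.rel R).map (Arrow.homMk (f := Arrow.mk (TopCat.toSSet.map i))
      (g := Arrow.mk (TopCat.toSSet.map j)) (TopCat.toSSet.map a) (TopCat.toSSet.map q)
      (by dsimp; rw [← Functor.map_comp, w, Functor.map_comp]))) := by
  set φ := (Arrow.homMk (f := Arrow.mk (TopCat.toSSet.map i))
      (g := Arrow.mk (TopCat.toSSet.map j)) (TopCat.toSSet.map a) (TopCat.toSSet.map q)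
      (by dsimp; rw [← Functor.map_comp, w, Functor.map_comp])) with hφ
  let f := TopCat.toSSet.map q
  have hU : ∀ d, q d ∈ c'.U ↔ d ∈ c.U := fun d => by
    change c'.ρ (q d) < _ ↔ c.ρ d < _
    rw [hρ]
  have hV : ∀ d, q d ∈ c'.V ↔ d ∈ c.V := fun d => by
    change _ < c'.ρ (q d) ↔ _ < c.ρ d
    rw [hρ]
  have hN : ∀ n, ∀ z ∈ (within c.U).obj n, f.app n z ∈ (within c'.U).obj n :=
    fun n z hz t => (hU _).2 (hz t)
  have hN' : ∀ n, ∀ z, f.app n z ∈ (within c'.U).obj n → z ∈ (within c.U).obj n :=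
    fun n z hz t => (hU _).1 (hz t)
  have hM : ∀ n, ∀ z ∈ (within c.U ⊔ within c.V).obj n,
      f.app n z ∈ (within c'.U ⊔ within c'.V).obj n := by
    rintro n z (hz | hz)
    · exact Or.inl (hN n z hz)
    · exact Or.inr fun t => (hV _).2 (hz t)
  -- A small simplex of `Y` outside `c'.U` lies in `c'.V`, where `s` inverts `q`. So the small
  -- simplices of `Y` are glued from those of `D`, and simplicial excision applies.
  have hpush : IsPushout (restrict f _ _ hN) (SSet.Subcomplex.homOfLE c.within_le) (SSet.Subcomplex.homOfLE c'.within_le)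
      (restrict f _ _ hM) := by
    refine isPushout_restrict f _ _ hN hM (fun n z _ => hN' n z) ?_ ?_
    · rintro n z' (hz' | hz') hz''
      · exact absurd hz' hz''
      · let τ : C(_, c'.V) := ⟨fun t => ⟨Y.toSSetObjEquiv n z' t, hz' t⟩,
          (Y.toSSetObjEquiv n z').continuous.subtype_mk _⟩
        have hz : f.app n ((D.toSSetObjEquiv n).symm (s.comp τ)) = z' := by
          apply (Y.toSSetObjEquiv n).injective
          ext t
          exact hs (τ t)
        refine ⟨(D.toSSetObjEquiv n).symm (s.comp τ), Or.inr fun t => (hV _).1 ?_, hz⟩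
        exact (hs (τ t)).symm ▸ (τ t).2
    · intro n z hz w hw hz' hw' h
      apply (D.toSSetObjEquiv n).injective
      ext t
      have hzV : z ∈ (within c.V).obj n := hz.resolve_left hz'
      exact hq _ _ (hzV t) (congrArg (fun z => Y.toSSetObjEquiv n z t) h)
  let ψ : Arrow.mk (SSet.Subcomplex.homOfLE c.within_le) ⟶ Arrow.mk (SSet.Subcomplex.homOfLE c'.within_le) :=
    Arrow.homMk (restrict f _ _ hN) (restrict f _ _ hM) hpush.w
  let ω : Arrow.mk (within c.U).ι ⟶ Arrow.mk (within c'.U).ι :=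
    Arrow.homMk (restrict f _ _ hN) f rfl
  have hψ : IsIso ((RelativeChain.rel R).map ψ) :=
    RelativeChain.isIso_rel_map_of_isPushout R ψ hpush
  have h₁ := c.quasiIso_arrowFromSmall R
  have h₂ := c'.quasiIso_arrowFromSmall R
  have h₃ := c.quasiIso_arrowToWithin R
  have h₄ := c'.quasiIso_arrowToWithin R
  -- The pair `(D, A)` maps to `(D, U)`, which receives the pair of small simplices; likewise for
  -- `Y`. Two-out-of-three carries the isomorphism `ψ` first to `ω`, then to `φ`.
  have comm₁ : c.arrowFromSmall ≫ ω = ψ ≫ c'.arrowFromSmall := rfl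
  have comm₂ : c.arrowToWithin ≫ ω = φ ≫ c'.arrowToWithin := by
    ext : 1
    · rw [← cancel_mono (within c'.U).ι]
      exact (TopCat.toSSet.congr_map w).symm
    · rfl
  have hω : QuasiIso ((RelativeChain.rel R).map ω) := by
    refine quasiIso_of_comp_left ((RelativeChain.rel R).map c.arrowFromSmall) _ (hφφ' := ?_)
    rw [← Functor.map_comp, comm₁, Functor.map_comp]
    infer_instance
  refine quasiIso_of_comp_right _ ((RelativeChain.rel R).map c'.arrowToWithin) (hφφ' := ?_)
  rw [← Functor.map_comp, ← comm₂, Functor.map_comp]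
  infer_instance

end

end Collar
end

/-! ### Collars under pushouts, isomorphisms and disjoint unions -/

noncomputable section

namespace Collar

variable {A B D Y : TopCat.{u}} {a : A ⟶ B} {i : A ⟶ D} {j : B ⟶ Y} {q : D ⟶ Y}

/-- Collars are stable under pushouts. -/
lemma exists_of_isPushout (c : Collar i) (h : IsPushout a i j q) :
    ∃ c' : Collar j, ∀ d, c'.ρ (q d) = c.ρ d := by
  obtain ⟨ρ, hρj, hρq⟩ := TopPushout.exists_continuousMap h (Z := ULift.{u} ℝ)
    ⟨fun _ => ⟨0⟩, continuous_const⟩ ⟨fun d => ⟨c.ρ d⟩, continuous_uliftUp.comp c.ρ.continuous⟩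
    (fun x => congrArg ULift.up (c.ρ_i x).symm)
  obtain ⟨H, hHj, hHq⟩ := TopPushout.exists_continuousMap h (Z := C(unitInterval, Y))
    (ContinuousMap.const'.comp j.hom)
    ⟨fun d => q.hom.comp (c.h d), (ContinuousMap.continuous_postcomp q.hom).comp c.h.continuous⟩
    (fun x => by
      ext t
      change j (a x) = q (c.h (i x) t)
      rw [c.h_i, TopPushout.comm_apply h])
  have hρj' : ∀ b, (ρ (j b)).down = 0 := fun b => congrArg ULift.down (hρj b)
  have hρq' : ∀ d, (ρ (q d)).down = c.ρ d := fun d => congrArg ULift.down (hρq d)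
  have hHj' : ∀ b t, H (j b) t = j b := fun b t => congrArg (fun f => f t) (hHj b)
  have hHq' : ∀ d t, H (q d) t = q (c.h d t) := fun d t => congrArg (fun f => f t) (hHq d)
  refine ⟨{
    isClosedEmbedding := TopPushout.isClosedEmbedding c.isClosedEmbedding h
    ρ := ⟨fun y => (ρ y).down, continuous_uliftDown.comp ρ.continuous⟩
    h := H
    ρ_i := hρj'
    h_zero := fun y => ?_
    h_i := hHj'
    ρ_h := fun y t hy => ?_
    h_one := fun y hy => ?_ }, hρq'⟩
  · obtain ⟨b, rfl⟩ | ⟨d, rfl⟩ := TopPushout.exists_preimage h y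
    · exact hHj' b 0
    · rw [hHq', c.h_zero]
  · change (ρ (H y t)).down < 1 / 2
    change (ρ y).down < 1 / 2 at hy
    obtain ⟨b, rfl⟩ | ⟨d, rfl⟩ := TopPushout.exists_preimage h y
    · rwa [hHj']
    · rw [hHq', hρq']
      exact c.ρ_h d t (by rwa [hρq'] at hy)
  · change (ρ y).down < 1 / 2 at hy
    obtain ⟨b, rfl⟩ | ⟨d, rfl⟩ := TopPushout.exists_preimage h y
    · exact ⟨b, (hHj' b 1).symm⟩
    · rw [hρq'] at hy
      obtain ⟨x, hx⟩ := c.h_one d hy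
      exact ⟨a x, by rw [hHq', ← hx, TopPushout.comm_apply h]⟩

/-- The function that remembers a point of `{ρ > 0}` and forgets all others is constant on the
subspace, so it descends to the pushout and separates these points. -/
lemma injective_of_isPushout (c : Collar i) (h : IsPushout a i j q) (d d' : D) (hd : 0 < c.ρ d)
    (hdd' : q d = q d') : d = d' := by
  classical
  obtain ⟨φ, -, hφ⟩ := TopPushout.exists_function h (S := Option D) (fun _ => none)
    (fun d => if 0 < c.ρ d then some d else none)
    (fun x => by rw [c.ρ_i, if_neg (lt_irrefl _)])
  have := congrArg φ hdd'
  rw [hφ, hφ, if_pos hd] at this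
  split_ifs at this
  exact Option.some.inj this

/-- A set-theoretic section is continuous because `q` is open on `c.V`: the image of an open subset
of `c.V` misses `B` and has preimage itself in `D`. -/
lemma exists_section_of_isPushout (c : Collar i) (h : IsPushout a i j q) (c' : Collar j)
    (hρ : ∀ d, c'.ρ (q d) = c.ρ d) : ∃ s : C(c'.V, D), ∀ y, q (s y) = y := by
  have hex : ∀ y : c'.V, ∃ d, q d = y := by
    rintro ⟨y, hy⟩
    obtain ⟨b, rfl⟩ | hd := TopPushout.exists_preimage h y
    · exact absurd hy (by
        change ¬ 0 < c'.ρ (j b)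
        rw [c'.ρ_i]
        exact lt_irrefl _)
    · exact hd
  choose s hs using hex
  have hsV : ∀ y, 0 < c.ρ (s y) := fun y => by
    rw [← hρ, hs]
    exact y.2
  refine ⟨⟨s, continuous_def.2 fun O hO => ?_⟩, hs⟩
  have hopen : IsOpen (q '' (O ∩ c.V)) := by
    apply TopPushout.isOpen_of_preimage h
    · convert isOpen_empty
      rw [Set.eq_empty_iff_forall_notMem]
      rintro b ⟨d, hd, hdb⟩
      have : 0 < c.ρ d := hd.2
      rw [← hρ, hdb, c'.ρ_i] at this
      exact lt_irrefl _ this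
    · convert hO.inter c.isOpen_V
      ext d
      constructor
      · rintro ⟨d', hd', hdd'⟩
        rwa [← c.injective_of_isPushout h d' d hd'.2 hdd']
      · exact fun hd => ⟨d, hd, rfl⟩
  convert hopen.preimage continuous_subtype_val
  ext y
  constructor
  · exact fun hy => ⟨s y, ⟨hy, hsV y⟩, hs y⟩
  · rintro ⟨d, hd, hdy⟩
    rw [Set.mem_preimage, ← c.injective_of_isPushout h d (s y) hd.2 (hdy.trans (hs y).symm)]
    exact hd.1

variable {k : Type u} [Ring k] (R : ModuleCat.{u} k)

/-- Excision for pushouts along collared maps. -/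
theorem quasiIso_rel_map_of_isPushout (c : Collar i) (h : IsPushout a i j q) :
    QuasiIso ((RelativeChain.rel R).map (Arrow.homMk (f := Arrow.mk (TopCat.toSSet.map i))
      (g := Arrow.mk (TopCat.toSSet.map j)) (TopCat.toSSet.map a) (TopCat.toSSet.map q)
      (by dsimp; rw [← Functor.map_comp, h.w, Functor.map_comp]))) := by
  obtain ⟨c', hρ⟩ := c.exists_of_isPushout h
  obtain ⟨s, hs⟩ := c.exists_section_of_isPushout h c' hρ
  exact c.quasiIso_rel_map R c' h.w hρ (c.injective_of_isPushout h) s hs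

lemma mono_of_isPushout (c : Collar i) (h : IsPushout a i j q) : Mono (TopCat.toSSet.map j) := by
  obtain ⟨c', -⟩ := c.exists_of_isPushout h
  exact c'.mono_map

/-- Transport of a collar along isomorphisms. -/
def ofIso {A' D' : TopCat.{u}} {i' : A' ⟶ D'} (c : Collar i) (e : A' ≅ A) (f : D' ≅ D)
    (w : i' ≫ f.hom = e.hom ≫ i) : Collar i' where
  isClosedEmbedding := by
    have h : i' = e.hom ≫ i ≫ f.inv := by rw [← Category.assoc, ← w, Category.assoc,
      Iso.hom_inv_id, Category.comp_id]
    rw [h]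
    exact (TopCat.homeoOfIso f).symm.isClosedEmbedding.comp
      (c.isClosedEmbedding.comp (TopCat.homeoOfIso e).isClosedEmbedding)
  ρ := c.ρ.comp f.hom.hom
  h := ⟨fun d => f.inv.hom.comp (c.h (f.hom d)), (ContinuousMap.continuous_postcomp f.inv.hom).comp
    (c.h.continuous.comp f.hom.hom.continuous)⟩
  ρ_i x := by
    have : f.hom (i' x) = i (e.hom x) := ConcreteCategory.congr_hom w x
    exact (congrArg c.ρ this).trans (c.ρ_i _)
  h_zero d := by
    change f.inv (c.h (f.hom d) 0) = d
    rw [c.h_zero]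
    exact ConcreteCategory.congr_hom f.hom_inv_id d
  h_i x t := by
    have : f.hom (i' x) = i (e.hom x) := ConcreteCategory.congr_hom w x
    change f.inv (c.h (f.hom (i' x)) t) = i' x
    rw [this, c.h_i, ← this]
    exact ConcreteCategory.congr_hom f.hom_inv_id (i' x)
  ρ_h d t hd := by
    have : f.hom (f.inv (c.h (f.hom d) t)) = c.h (f.hom d) t :=
      ConcreteCategory.congr_hom f.inv_hom_id _
    change c.ρ (f.hom (f.inv (c.h (f.hom d) t))) < 1 / 2
    rw [this]
    exact c.ρ_h _ t hd
  h_one d hd := by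
    obtain ⟨x, hx⟩ := c.h_one (f.hom d) hd
    refine ⟨e.inv x, ?_⟩
    change i' (e.inv x) = f.inv (c.h (f.hom d) 1)
    rw [← hx]
    have h : e.inv ≫ i' = i ≫ f.inv := by
      rw [Iso.eq_comp_inv, Category.assoc, w, Iso.inv_hom_id_assoc]
    exact ConcreteCategory.congr_hom h x

/-- The disjoint union of collars. -/
def sigma {S : Type u} (c : Collar i) :
    Collar (TopCat.ofHom (X := Σ _ : S, A) (Y := Σ _ : S, D)
      ⟨Sigma.map id fun _ => i, Continuous.sigma_map fun _ => i.hom.continuous⟩) where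
  isClosedEmbedding := by
    refine .of_continuous_injective_isClosedMap (ContinuousMap.continuous _) ?_ ?_
    · rintro ⟨s, x⟩ ⟨s', x'⟩ h
      obtain ⟨rfl, h'⟩ := Sigma.mk.inj_iff.1 h
      exact Sigma.ext rfl (heq_of_eq (c.isClosedEmbedding.injective (eq_of_heq h')))
    · intro K hK
      rw [isClosed_sigma_iff] at hK ⊢
      intro s
      convert c.isClosedEmbedding.isClosedMap _ (hK s)
      ext d
      constructor
      · rintro ⟨⟨s', x⟩, hx, h⟩
        obtain ⟨rfl, h'⟩ := Sigma.mk.inj_iff.1 h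
        exact ⟨x, hx, eq_of_heq h'⟩
      · rintro ⟨x, hx, rfl⟩
        exact ⟨⟨s, x⟩, hx, rfl⟩
  ρ := ⟨fun d => c.ρ d.2, continuous_sigma fun _ => c.ρ.continuous⟩
  h := ⟨fun d => (ContinuousMap.mk (Sigma.mk d.1) continuous_sigmaMk).comp (c.h d.2),
    continuous_sigma fun s => (ContinuousMap.continuous_postcomp
      (ContinuousMap.mk (Sigma.mk (β := fun _ : S => D) s) continuous_sigmaMk)).comp c.h.continuous⟩
  ρ_i x := c.ρ_i x.2
  h_zero d := Sigma.ext rfl (heq_of_eq (c.h_zero d.2))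
  h_i x t := Sigma.ext rfl (heq_of_eq (c.h_i x.2 t))
  ρ_h d t := c.ρ_h d.2 t
  h_one d hd := by
    obtain ⟨x, hx⟩ := c.h_one d.2 hd
    exact ⟨⟨d.1, x⟩, Sigma.ext rfl (heq_of_eq hx)⟩

end Collar
end

noncomputable section

/-! ### The collar of the boundary of a simplex -/

namespace SimplexCollar

open AffineChain

variable {n : ℕ}

/-- The smallest barycentric coordinate, normalised to be `1` at the barycentre. -/
def depth (p : Simplex n) : ℝ := (n + 1) * Finset.univ.inf' Finset.univ_nonempty p

lemma continuous_coord (i : Fin (n + 1)) : Continuous fun p : Simplex n => p i :=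
  (continuous_apply i).comp continuous_subtype_val

lemma continuous_depth : Continuous (depth (n := n)) :=
  continuous_const.mul
    (Continuous.finset_inf'_apply Finset.univ_nonempty fun i _ => continuous_coord i)

lemma depth_le (p : Simplex n) (i : Fin (n + 1)) : depth p ≤ (n + 1) * p i :=
  mul_le_mul_of_nonneg_left (Finset.inf'_le _ (Finset.mem_univ i)) (by positivity)

lemma exists_depth_eq (p : Simplex n) : ∃ i, depth p = (n + 1) * p i := by
  obtain ⟨i, -, hi⟩ := Finset.exists_mem_eq_inf' Finset.univ_nonempty (p : Fin (n + 1) → ℝ)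
  exact ⟨i, by rw [depth, hi]⟩

lemma depth_eq_zero {p : Simplex n} (h : ∃ i, p i = 0) : depth p = 0 := by
  obtain ⟨i, hi⟩ := h
  obtain ⟨j, hj⟩ := exists_depth_eq p
  refine le_antisymm ((depth_le p i).trans (by rw [hi, mul_zero])) ?_
  rw [hj]
  exact mul_nonneg (by positivity) (p.2.1 j)

/-- The factor by which points are pushed away from the barycentre. -/
def scale (p : Simplex n) : ℝ := max (1 / 2) (1 - depth p)

lemma scale_pos (p : Simplex n) : 0 < scale p := lt_of_lt_of_le (by norm_num) (le_max_left _ _)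

lemma continuous_scale : Continuous (scale (n := n)) :=
  continuous_const.max (continuous_const.sub continuous_depth)

/-- The coordinates of the image of a point under the radial projection. -/
def radialCoord (p : Simplex n) (i : Fin (n + 1)) : ℝ :=
  1 / (n + 1) + (p i - 1 / (n + 1)) / scale p

lemma continuous_radialCoord (i : Fin (n + 1)) :
    Continuous fun p : Simplex n => radialCoord p i :=
  continuous_const.add (((continuous_coord i).sub continuous_const).div continuous_scale
    fun p => (scale_pos p).ne')

/-- Dividing by `1 - depth p` moves `p` away from the barycentre exactly until its smallest
coordinate vanishes; `scale p` is at least this large, so no coordinate becomes negative. -/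
lemma radialCoord_nonneg (p : Simplex n) (i : Fin (n + 1)) : 0 ≤ radialCoord p i := by
  have hs := scale_pos p
  have h₁ : 1 - depth p ≤ scale p := le_max_right _ _
  have h₂ := depth_le p i
  have hn : (0 : ℝ) < n + 1 := by positivity
  have : radialCoord p i = (scale p + ((n + 1) * p i - 1)) / ((n + 1) * scale p) := by
    rw [radialCoord]
    field_simp
  rw [this]
  apply div_nonneg _ (by positivity)
  linarith

lemma sum_radialCoord (p : Simplex n) : ∑ i, radialCoord p i = 1 := by
  have h : ∑ i, p i = 1 := p.2.2
  have hn : (n : ℝ) + 1 ≠ 0 := by positivity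
  simp only [radialCoord, Finset.sum_add_distrib, ← Finset.sum_div, Finset.sum_sub_distrib, h,
    Finset.sum_const, Finset.card_univ, Fintype.card_fin, nsmul_eq_mul]
  push_cast
  rw [mul_one, div_self hn]
  simp

lemma radialCoord_of_boundary {p : Simplex n} (h : ∃ i, p i = 0) (i : Fin (n + 1)) :
    radialCoord p i = p i := by
  have : scale p = 1 := by
    rw [scale, depth_eq_zero h]
    norm_num
  rw [radialCoord, this]
  ring

/-- Below depth `1 / 2` the lower bound in `scale` is not active, and the projection reaches the
boundary at the minimal coordinate. -/
lemma radialCoord_eq_zero {p : Simplex n} (hp : depth p < 1 / 2) {i : Fin (n + 1)}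
    (hi : depth p = (n + 1) * p i) : radialCoord p i = 0 := by
  have hs : scale p = 1 - depth p := max_eq_right (by linarith)
  have hn : (0 : ℝ) < n + 1 := by positivity
  have h0 : 1 - depth p ≠ 0 := by linarith
  have : radialCoord p i = (scale p + ((n + 1) * p i - 1)) / ((n + 1) * scale p) := by
    have := (scale_pos p).ne'
    rw [radialCoord]
    field_simp
  rw [this, hs, ← hi]
  simp

/-- The deformation towards the boundary. -/
def push (p : Simplex n) (t : unitInterval) : Simplex n :=
  ⟨fun i => (1 - t) * p i + t * radialCoord p i, by
    refine ⟨fun i => ?_, ?_⟩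
    · have h₁ := p.2.1 i
      have h₂ := radialCoord_nonneg p i
      exact add_nonneg (mul_nonneg (sub_nonneg.2 t.2.2) h₁) (mul_nonneg t.2.1 h₂)
    · have h : ∑ i, p i = 1 := p.2.2
      rw [Finset.sum_add_distrib, ← Finset.mul_sum, ← Finset.mul_sum, sum_radialCoord, h]
      ring⟩

lemma push_apply (p : Simplex n) (t : unitInterval) (i : Fin (n + 1)) :
    push p t i = (1 - t) * p i + t * radialCoord p i := rfl

lemma continuous_push : Continuous fun x : Simplex n × unitInterval => push x.1 x.2 := by
  refine Continuous.subtype_mk (continuous_pi fun i => ?_) _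
  have ht : Continuous fun x : Simplex n × unitInterval => (x.2 : ℝ) :=
    continuous_subtype_val.comp continuous_snd
  exact ((continuous_const.sub ht).mul ((continuous_coord i).comp continuous_fst)).add
    (ht.mul ((continuous_radialCoord i).comp continuous_fst))

/-- The minimal coordinate of `p` is multiplied by `1 - t`, and it bounds the depth at every time
even if another coordinate becomes minimal. -/
lemma depth_push {p : Simplex n} (hp : depth p < 1 / 2) (t : unitInterval) :
    depth (push p t) < 1 / 2 := by
  obtain ⟨i, hi⟩ := exists_depth_eq p
  refine lt_of_le_of_lt (depth_le _ i) (lt_of_le_of_lt ?_ hp)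
  rw [push_apply, radialCoord_eq_zero hp hi, mul_zero, add_zero, hi]
  refine mul_le_mul_of_nonneg_left ?_ (by positivity)
  have h₁ : 0 ≤ p i := p.2.1 i
  have h₂ := t.2.1
  nlinarith

/-- The collar of the boundary of the standard simplex. -/
def collar {A D : TopCat.{u}} {i : A ⟶ D} (hi : IsClosedEmbedding i) (e : D ≃ₜ Simplex n)
    (h : ∀ d, (∃ x, i x = d) ↔ ∃ l, e d l = 0) : Collar i where
  isClosedEmbedding := hi
  ρ := ⟨fun d => depth (e d), continuous_depth.comp e.continuous⟩
  h := ContinuousMap.curry ⟨fun x => e.symm (push (e x.1) x.2), e.symm.continuous.comp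
    (continuous_push.comp ((e.continuous.comp continuous_fst).prodMk continuous_snd))⟩
  ρ_i x := depth_eq_zero ((h _).1 ⟨x, rfl⟩)
  h_zero d := by
    change e.symm (push (e d) 0) = d
    rw [e.symm_apply_eq]
    apply simplex_ext
    intro l
    simp [push_apply]
  h_i x t := by
    change e.symm (push (e (i x)) t) = i x
    rw [e.symm_apply_eq]
    apply simplex_ext
    intro l
    rw [push_apply, radialCoord_of_boundary ((h _).1 ⟨x, rfl⟩)]
    ring
  ρ_h d t hd := by
    change depth (e (e.symm (push (e d) t))) < 1 / 2
    rw [e.apply_symm_apply]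
    exact depth_push hd t
  h_one d hd := by
    rw [h]
    change ∃ l, e (e.symm (push (e d) 1)) l = 0
    rw [e.apply_symm_apply]
    obtain ⟨l, hl⟩ := exists_depth_eq (e d)
    refine ⟨l, ?_⟩
    rw [push_apply, radialCoord_eq_zero hd hl]
    simp

end SimplexCollar

namespace BoundaryRealization

open AffineChain SSet

variable {n : ℕ}

lemma map_succAbove_self (i : Fin (n + 2)) (z : Simplex n) :
    (stdSimplex.map i.succAbove z : Simplex (n + 1)) i = 0 := by
  rw [stdSimplex.map_coe, FunOnFinite.linearMap_apply_apply]
  apply Finset.sum_eq_zero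
  intro x hx
  exact absurd (Finset.mem_filter.1 hx).2 (i.succAbove_ne x)

lemma map_succAbove_succAbove (i : Fin (n + 2)) (z : Simplex n) (j : Fin (n + 1)) :
    (stdSimplex.map i.succAbove z : Simplex (n + 1)) (i.succAbove j) = z j := by
  rw [stdSimplex.map_coe, FunOnFinite.linearMap_apply_apply]
  have : Finset.univ.filter (fun x => i.succAbove x = i.succAbove j) = {j} := by
    ext x
    simp
  rw [this, Finset.sum_singleton]

lemma map_succAbove_injective (i : Fin (n + 2)) :
    Function.Injective (stdSimplex.map i.succAbove : Simplex n → Simplex (n + 1)) := by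
  intro z z' h
  apply simplex_ext
  intro j
  rw [← map_succAbove_succAbove i, h, map_succAbove_succAbove]

lemma exists_map_succAbove {p : Simplex (n + 1)} {i : Fin (n + 2)} (hi : p i = 0) :
    ∃ z : Simplex n, stdSimplex.map i.succAbove z = p := by
  have hsum : ∑ l, p l = 1 := p.2.2
  rw [Fin.sum_univ_succAbove _ i, hi, zero_add] at hsum
  let z : Simplex n := ⟨fun j => p (i.succAbove j), fun j => p.2.1 _, hsum⟩
  refine ⟨z, simplex_ext fun l => ?_⟩
  obtain rfl | ⟨j, rfl⟩ := Fin.eq_self_or_eq_succAbove i l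
  · rw [map_succAbove_self, hi]
  · exact map_succAbove_succAbove i z j

/-- The barycentric coordinates on the realisation of a standard simplex. -/
def coords (n : ℕ) : |(Δ[n] : SSet.{u})| ≃ₜ Simplex n := ⦋n⦌.toTopHomeo

lemma coords_δ (i : Fin (n + 2)) (x : |(Δ[n] : SSet.{u})|) :
    coords (n + 1) (SSet.toTop.map (SSet.stdSimplex.map (SimplexCategory.δ i)) x) =
      stdSimplex.map i.succAbove (coords n x) :=
  SimplexCategory.toTopHomeo_naturality_apply _ _

lemma exists_δ {x : |(Δ[n + 1] : SSet.{u})|} {i : Fin (n + 2)} (hi : coords (n + 1) x i = 0) :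
    ∃ z, SSet.toTop.map (SSet.stdSimplex.map (SimplexCategory.δ i)) z = x := by
  obtain ⟨z, hz⟩ := exists_map_succAbove hi
  obtain ⟨z, rfl⟩ := (coords n).surjective z
  exact ⟨z, (coords (n + 1)).injective ((coords_δ i z).trans hz)⟩

/-- The inclusion of the realisation of the boundary. -/
abbrev incl (n : ℕ) : |(∂Δ[n] : SSet.{u})| ⟶ |Δ[n]| := SSet.toTop.map ∂Δ[n].ι

lemma isEmpty_zero : IsEmpty |(∂Δ[0] : SSet.{u})| := by
  let _ : TopologicalSpace (ULift.{u} Prop) := ⊤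
  let f : Prop → (|(∂Δ[0] : SSet.{u})| ⟶ TopCat.of (ULift.{u} Prop)) := fun p =>
    TopCat.ofHom ⟨fun _ => ⟨p⟩, continuous_top⟩
  have h : f True = f False := (sSetTopAdj.homEquiv _ _).injective boundary.hom_ext₀
  refine ⟨fun x => ?_⟩
  have := congrArg ULift.down (ConcreteCategory.congr_hom h x)
  change True = False at this
  exact this ▸ trivial

/-- Two maps into an indiscrete space, the constant `True` and the indicator of the union of the
faces, are compared through the adjunction, where maps out of the boundary are determined on faces.
-/
lemma exists_face (y : |(∂Δ[n + 1] : SSet.{u})|) :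
    ∃ i x, SSet.toTop.map (boundary.ι i) x = y := by
  let _ : TopologicalSpace (ULift.{u} Prop) := ⊤
  let f : |(∂Δ[n + 1] : SSet.{u})| ⟶ TopCat.of (ULift.{u} Prop) :=
    TopCat.ofHom ⟨fun _ => ⟨True⟩, continuous_top⟩
  let g : |(∂Δ[n + 1] : SSet.{u})| ⟶ TopCat.of (ULift.{u} Prop) :=
    TopCat.ofHom ⟨fun y => ⟨∃ i x, SSet.toTop.map (boundary.ι i) x = y⟩, continuous_top⟩
  have h : f = g := by
    apply (sSetTopAdj.homEquiv _ _).injective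
    apply boundary.hom_ext
    intro i
    rw [← Adjunction.homEquiv_naturality_left, ← Adjunction.homEquiv_naturality_left]
    congr 1
    ext x
    exact ⟨fun _ => ⟨i, x, rfl⟩, fun _ => trivial⟩
  have := congrArg ULift.down (ConcreteCategory.congr_hom h y)
  exact of_eq_true this.symm

lemma toTopHomeo_incl (i : Fin (n + 2)) (x : |(Δ[n] : SSet.{u})|) :
    ((coords (n + 1)) (incl (n + 1) (SSet.toTop.map (boundary.ι i) x)) : Simplex (n + 1)) =
      stdSimplex.map i.succAbove (coords n x) := by
  have h : SSet.toTop.map (boundary.ι i) ≫ incl.{u} (n + 1) =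
      SSet.toTop.map (SSet.stdSimplex.map (SimplexCategory.δ i)) := by
    rw [← Functor.map_comp]
    rfl
  have h' : incl (n + 1) (SSet.toTop.map (boundary.ι i) x) =
      SSet.toTop.map (SSet.stdSimplex.map (SimplexCategory.δ i)) x :=
    ConcreteCategory.congr_hom h x
  rw [h']
  exact coords_δ i x

/-- A point of the simplex on two different faces lies on their common face of codimension two,
along which the boundary is already glued by the simplicial identity. This is the core of the
injectivity of `|∂Δ[n]| → |Δ[n]|`. -/
lemma eq_of_lt {i j : Fin (n + 2)} (hij : i < j) (x x' : |(Δ[n] : SSet.{u})|)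
    (h : incl (n + 1) (SSet.toTop.map (boundary.ι i) x) =
      incl (n + 1) (SSet.toTop.map (boundary.ι j) x')) :
    SSet.toTop.map (boundary.ι i) x = SSet.toTop.map (boundary.ι j) x' := by
  have h' := congrArg (fun y => (coords (n + 1) y)) h
  simp only [toTopHomeo_incl] at h'
  cases n with
  | zero =>
    -- The two faces of an interval are distinct points: all coordinates of a common point would
    -- vanish.
    exfalso
    obtain rfl : i = 0 := Fin.ext (by
      have h₁ : i.1 < j.1 := hij
      have h₂ := j.2
      change i.1 = 0
      omega)
    obtain rfl : j = 1 := Fin.ext (by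
      have h₁ : 0 < j.1 := hij
      have h₂ := j.2
      change j.1 = 1
      omega)
    have h₀ := map_succAbove_self (0 : Fin 2) (coords 0 x)
    have h₁ := map_succAbove_self (1 : Fin 2) (coords 0 x')
    rw [← h'] at h₁
    have := stdSimplex.add_eq_one
      (stdSimplex.map (0 : Fin 2).succAbove (coords 0 x) : Simplex 1)
    rw [h₀, h₁] at this
    norm_num at this
  | succ m =>
    obtain ⟨i, rfl⟩ := Fin.exists_castSucc_eq.2 (Fin.ne_last_of_lt hij)
    obtain ⟨j, rfl⟩ := Fin.exists_succ_eq.2 (Fin.ne_zero_of_lt hij)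
    have hij' : i ≤ j := Fin.castSucc_lt_succ_iff.1 hij
    -- The common point has coordinate `j.succ` equal to zero, and `i.castSucc.succAbove j = j.succ`
    -- because `i ≤ j`.
    have hx : (coords (m + 1) x) j = 0 := by
      rw [← map_succAbove_succAbove i.castSucc, h', Fin.succAbove_castSucc_of_le _ _ hij']
      exact map_succAbove_self _ _
    obtain ⟨z, hxz⟩ := exists_δ hx
    have hc : SSet.toTop.map (SSet.stdSimplex.map (SimplexCategory.δ j)) ≫
        SSet.toTop.map (boundary.ι.{u} i.castSucc) =
        SSet.toTop.map (SSet.stdSimplex.map (SimplexCategory.δ i)) ≫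
        SSet.toTop.map (boundary.ι j.succ) := by
      rw [← Functor.map_comp, ← Functor.map_comp]
      congr 1
      rw [← cancel_mono ∂Δ[m + 2].ι, Category.assoc, Category.assoc]
      exact (SSet.stdSimplex.map_comp _ _).symm.trans
        ((congrArg (fun f => SSet.stdSimplex.map f) (SimplexCategory.δ_comp_δ hij').symm).trans
          (SSet.stdSimplex.map_comp _ _))
    have hc' := ConcreteCategory.congr_hom hc z
    subst hxz
    refine hc'.trans (congrArg (SSet.toTop.map (boundary.ι j.succ)) ?_)
    apply (coords (m + 1)).injective
    apply map_succAbove_injective j.succ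
    rw [← h', ← toTopHomeo_incl, ← toTopHomeo_incl]
    exact congrArg (fun y => (coords (m + 2)) (incl (m + 2) y)) hc'.symm

lemma injective_incl (n : ℕ) : Function.Injective (incl.{u} n) := by
  cases n with
  | zero =>
    have := isEmpty_zero.{u}
    exact Function.injective_of_subsingleton _
  | succ n =>
    intro y y' h
    obtain ⟨i, x, rfl⟩ := exists_face y
    obtain ⟨j, x', rfl⟩ := exists_face y'
    rcases lt_trichotomy i j with hij | rfl | hij
    · exact eq_of_lt hij x x' h
    · have h' := congrArg (fun y => (coords (n + 1) y)) h
      simp only [toTopHomeo_incl] at h'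
      rw [(coords n).injective (map_succAbove_injective i h')]
    · exact (eq_of_lt hij x' x h.symm).symm

instance (n : ℕ) : CompactSpace |(Δ[n] : SSet.{u})| := (coords n).symm.compactSpace

instance (n : ℕ) : T2Space |(Δ[n] : SSet.{u})| := (coords n).symm.t2Space

instance (n : ℕ) : CompactSpace |(∂Δ[n] : SSet.{u})| := by
  cases n with
  | zero =>
    have := isEmpty_zero.{u}
    infer_instance
  | succ n =>
    refine ⟨?_⟩
    have : (Set.univ : Set |(∂Δ[n + 1] : SSet.{u})|) =
        ⋃ i, Set.range (SSet.toTop.map (boundary.ι.{u} (n := n) i)) := by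
      symm
      rw [Set.eq_univ_iff_forall]
      intro y
      obtain ⟨i, x, h⟩ := exists_face y
      exact Set.mem_iUnion.2 ⟨i, x, h⟩
    rw [this]
    exact isCompact_iUnion fun i => isCompact_range (TopCat.Hom.hom _).continuous

lemma isClosedEmbedding_incl (n : ℕ) : IsClosedEmbedding (incl.{u} n) :=
  .of_continuous_injective_isClosedMap (TopCat.Hom.hom _).continuous (injective_incl n)
    (TopCat.Hom.hom _).continuous.isClosedMap

lemma exists_incl_iff (d : |(Δ[n] : SSet.{u})|) :
    (∃ x, incl n x = d) ↔ ∃ l, (coords n d) l = 0 := by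
  cases n with
  | zero =>
    have := isEmpty_zero.{u}
    constructor
    · rintro ⟨x, -⟩
      exact isEmptyElim x
    · rintro ⟨l, hl⟩
      have := stdSimplex.eq_one_of_unique (X := Fin 1) (coords 0 d) l
      rw [hl] at this
      norm_num at this
  | succ n =>
    constructor
    · rintro ⟨y, rfl⟩
      obtain ⟨i, x, rfl⟩ := exists_face y
      exact ⟨i, by rw [toTopHomeo_incl, map_succAbove_self]⟩
    · rintro ⟨i, hi⟩
      obtain ⟨z, hz⟩ := exists_map_succAbove hi
      obtain ⟨z, rfl⟩ := (coords n).surjective z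
      refine ⟨SSet.toTop.map (boundary.ι i) z, ?_⟩
      apply (coords (n + 1)).injective
      exact (toTopHomeo_incl i z).trans hz

/-- The collar of the boundary in the realisation of a standard simplex. -/
def collar (n : ℕ) : Collar (incl.{u} n) :=
  SimplexCollar.collar (isClosedEmbedding_incl n) (coords n) exists_incl_iff

end BoundaryRealization
end

noncomputable section

/-! ### Disjoint unions of copies of a simplicial set -/

namespace SSet

variable (S : Type u)

/-- The product with a fixed set, as a functor. -/
def copiesFunctor : Type u ⥤ Type u where
  obj T := S × T
  map f := ↾fun p => (p.1, f p.2)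

/-- The disjoint union of copies of `Z` indexed by `S`. -/
def copies : SSet.{u} ⥤ SSet.{u} := (SimplicialObject.whiskering _ _).obj (copiesFunctor S)

/-- The inclusion of a summand. -/
def copiesι (Z : SSet.{u}) (s : S) : Z ⟶ (copies S).obj Z where
  app n := ↾fun z => (s, z)

lemma copiesι_naturality {Z Z' : SSet.{u}} (f : Z ⟶ Z') (s : S) :
    copiesι S Z s ≫ (copies S).map f = f ≫ copiesι S Z' s := rfl

/-- The cofan of the summands. -/
def copiesCofan (Z : SSet.{u}) : Cofan (fun _ : S => Z) := Cofan.mk ((copies S).obj Z) (copiesι S Z)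

/-- The cofan of the summands is a colimit. -/
def copiesCofanIsColimit (Z : SSet.{u}) : IsColimit (copiesCofan S Z) :=
  Cofan.IsColimit.mk _
    (fun c =>
      { app := fun n => ↾fun p => (c.inj p.1).app n p.2
        naturality := fun m n f => by
          ext p
          exact ConcreteCategory.congr_hom ((c.inj p.1).naturality f) p.2 })
    (fun c s => rfl)
    (fun c m hm => by
      ext n p
      exact ConcreteCategory.congr_hom (congr_app (hm p.1) n) p.2)

/-- The coproduct of copies of `Z`. -/
def copiesIso (Z : SSet.{u}) : (∐ fun _ : S => Z) ≅ (copies S).obj Z :=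
  (coproductIsCoproduct _).coconePointUniqueUpToIso (copiesCofanIsColimit S Z)

lemma ι_copiesIso_hom (Z : SSet.{u}) (s : S) :
    Sigma.ι (fun _ : S => Z) s ≫ (copiesIso S Z).hom = copiesι S Z s :=
  (coproductIsCoproduct _).comp_coconePointUniqueUpToIso_hom (copiesCofanIsColimit S Z) ⟨s⟩

lemma copiesIso_hom_naturality {Z Z' : SSet.{u}} (f : Z ⟶ Z') :
    Limits.Sigma.map (fun _ : S => f) ≫ (copiesIso S Z').hom =
      (copiesIso S Z).hom ≫ (copies S).map f := by
  ext s : 1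
  rw [← Category.assoc, ← Category.assoc, ι_copiesIso_hom, copiesι_naturality, Sigma.ι_map,
    Category.assoc, ι_copiesIso_hom]

instance (Z : SSet.{u}) (d : ℕ) [Z.HasDimensionLT d] : ((copies S).obj Z).HasDimensionLT d where
  degenerate_eq_top n hn := by
    rw [Set.top_eq_univ, Set.eq_univ_iff_forall]
    rintro ⟨s, z⟩
    have hz : z ∈ Z.degenerate n := by
      rw [Z.degenerate_eq_univ_of_hasDimensionLT d n hn]
      exact Set.mem_univ _
    obtain ⟨m, hm, f, z', rfl⟩ := hz
    exact ⟨m, hm, f, (s, z'), rfl⟩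

/-- The realisation of a disjoint union. -/
def toTopCopiesIso (Z : SSet.{u}) :
    |(copies S).obj Z| ≅ TopCat.of (Σ _ : S, |Z|) :=
  (isColimitCofanMkObjOfIsColimit SSet.toTop _ _
    (copiesCofanIsColimit S Z)).coconePointUniqueUpToIso
      (TopCat.sigmaCofanIsColimit (fun _ : S => |Z|))

lemma toTopCopiesIso_hom_apply (Z : SSet.{u}) (s : S) (x : |Z|) :
    (toTopCopiesIso S Z).hom (SSet.toTop.map (copiesι S Z s) x) = ⟨s, x⟩ :=
  ConcreteCategory.congr_hom ((isColimitCofanMkObjOfIsColimit SSet.toTop _ _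
    (copiesCofanIsColimit S Z)).comp_coconePointUniqueUpToIso_hom
      (TopCat.sigmaCofanIsColimit (fun _ : S => |Z|)) ⟨s⟩) x

lemma toTopCopiesIso_inv_apply (Z : SSet.{u}) (s : S) (x : |Z|) :
    (toTopCopiesIso S Z).inv ⟨s, x⟩ = SSet.toTop.map (copiesι S Z s) x := by
  rw [← toTopCopiesIso_hom_apply]
  exact ConcreteCategory.congr_hom (toTopCopiesIso S Z).hom_inv_id _

lemma exists_toTop_copiesι (Z : SSet.{u}) (y : |(copies S).obj Z|) :
    ∃ s x, SSet.toTop.map (copiesι S Z s) x = y := by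
  refine ⟨((toTopCopiesIso S Z).hom y).1, ((toTopCopiesIso S Z).hom y).2, ?_⟩
  rw [← toTopCopiesIso_inv_apply]
  exact ConcreteCategory.congr_hom (toTopCopiesIso S Z).hom_inv_id y

/-- The disjoint union of collars of boundaries of simplices. -/
def copiesCollar (d : ℕ) : Collar (SSet.toTop.map ((copies S).map (∂Δ[d] : Subcomplex.{u} _).ι)) :=
  (BoundaryRealization.collar d).sigma (S := S) |>.ofIso (toTopCopiesIso S _)
    (toTopCopiesIso S _) (by
      apply ConcreteCategory.hom_ext
      intro y
      obtain ⟨s, x, rfl⟩ := exists_toTop_copiesι S _ y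
      have h : SSet.toTop.map (copiesι S ∂Δ[d] s) ≫
          SSet.toTop.map ((copies S).map (∂Δ[d] : Subcomplex.{u} _).ι) =
          SSet.toTop.map (∂Δ[d] : Subcomplex.{u} _).ι ≫ SSet.toTop.map (copiesι S Δ[d] s) := by
        rw [← Functor.map_comp, ← Functor.map_comp, copiesι_naturality]
      refine (congrArg (toTopCopiesIso S Δ[d]).hom (ConcreteCategory.congr_hom h x)).trans ?_
      refine (toTopCopiesIso_hom_apply S _ s _).trans ?_
      exact congrArg (TopCat.ofHom (X := Σ _ : S, |(∂Δ[d] : SSet.{u})|) (Y := Σ _ : S, |Δ[d]|)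
        ⟨Sigma.map id fun _ => BoundaryRealization.incl d,
          Continuous.sigma_map fun _ => (TopCat.Hom.hom _).continuous⟩)
        (toTopCopiesIso_hom_apply S _ s x).symm)

end SSet
end

noncomputable section

/-! ### Disjoint unions of standard simplices -/

namespace SSet

variable (S : Type u)

/-- A set as a discrete space. -/
def discrete : TopCat.{u} :=
  letI : TopologicalSpace S := ⊥
  TopCat.of S

instance : DiscreteTopology (discrete S) := ⟨rfl⟩

variable {k : Type u} [Ring k] (R : ModuleCat.{u} k)

lemma quasiIso_comp_of_isIso {X Y Z : SSet.{u}} (f : X ⟶ Y) (g : Y ⟶ Z) (h : X ⟶ Z)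
    (w : f ≫ g = h) [QuasiIso (SSet.chainComplexMap f R)] [IsIso g] :
    QuasiIso (SSet.chainComplexMap h R) := by
  rw [← w, chainComplexMap, Functor.map_comp]
  infer_instance

/-- An augmentation with an extra degeneracy is a quasi-isomorphism. -/
lemma quasiIso_augmentation (Z : SimplicialObject.Augmented (Type u))
    (ed : SimplicialObject.Augmented.ExtraDegeneracy Z) :
    QuasiIso (SSet.chainComplexMap (X := Z.left) Z.hom R) := by
  let e : HomotopyEquiv (SSet.chainComplex Z.left R)
      (SSet.chainComplex ((SimplicialObject.const _).obj Z.right) R) :=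
    { hom := SSet.chainComplexMap (X := Z.left) Z.hom R
      inv := SSet.chainComplexMap (Y := Z.left) ed.section_ R
      homotopyHomInvId := (Homotopy.ofEq (by
        rw [← Functor.map_comp])).trans
        ((ed.homotopy.sSetChainComplexMap R).trans (Homotopy.ofEq (by
          exact (CategoryTheory.Functor.map_id _ _))))
      homotopyInvHomId := (Homotopy.ofEq (by
        rw [← Functor.map_comp]
        exact (congrArg (fun f => SSet.chainComplexMap f R) ed.section_comp_hom).trans
          (CategoryTheory.Functor.map_id _ _))) }
  exact e.quasiIso_hom

variable (Z : SSet.{u})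

/-- The map to the singular simplicial set of a discrete space. -/
def copiesToDiscrete : (copies S).obj Z ⟶ TopCat.toSSet.obj (discrete S) where
  app n := ↾fun p => ((discrete S).toSSetObjEquiv n).symm (ContinuousMap.const _ p.1)

/-- The constant singular simplices of a discrete space. -/
def constToDiscrete (T : Type u) :
    (SimplicialObject.const (Type u)).obj (S × T) ⟶ TopCat.toSSet.obj (discrete S) :=
  NatTrans.mk (fun n => ↾fun p => ((discrete S).toSSetObjEquiv n).symm (ContinuousMap.const _ p.1))
    (fun _ _ _ => rfl)

/-- The topological simplices are connected, so singular simplices of a discrete space are constant.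
-/
lemma isIso_constToDiscrete (T : Type u) [Unique T] : IsIso (constToDiscrete S T) := by
  rw [NatTrans.isIso_iff_isIso_app]
  intro n
  rw [isIso_iff_bijective]
  constructor
  · rintro ⟨s, x⟩ ⟨s', x'⟩ h
    have h' := ((discrete S).toSSetObjEquiv n).symm.injective h
    exact Prod.ext (congrArg (fun φ => φ (stdSimplex.vertex 0)) h') (Subsingleton.elim _ _)
  · intro z
    obtain ⟨y, rfl⟩ := ((discrete S).toSSetObjEquiv n).symm.surjective z
    obtain ⟨s, hs⟩ : ∃ s, y = ContinuousMap.const _ s :=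
      ⟨y (stdSimplex.vertex 0), ContinuousMap.ext fun t =>
        PreconnectedSpace.constant inferInstance y.continuous⟩
    exact ⟨(s, default), by rw [hs]; rfl⟩

/-- The map factors through the augmentation of the copies of `Z`, which inherits the extra
degeneracy of `Z`. -/
lemma quasiIso_copiesToDiscrete (Z : SimplicialObject.Augmented (Type u)) [Unique Z.right]
    (ed : SimplicialObject.Augmented.ExtraDegeneracy Z) :
    QuasiIso (SSet.chainComplexMap (copiesToDiscrete S Z.left) R) := by
  have h₁ := quasiIso_augmentation R _ (ed.map (copiesFunctor S))
  have h₂ := isIso_constToDiscrete S Z.right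
  exact @quasiIso_comp_of_isIso _ _ R _ _ _ _ (constToDiscrete S Z.right) _ rfl h₁ h₂

lemma homEquiv_const (s : S) : copiesι S Z s ≫ copiesToDiscrete S Z =
    sSetTopAdj.homEquiv _ _ (TopCat.const (X := |Z|) (Y := discrete S) s) := by
  refine Eq.trans ?_ (sSetTopAdj.homEquiv_unit _ _ _).symm
  rfl

/-- The projection of a realised disjoint union to its index set. -/
def toDiscrete : |(copies S).obj Z| ⟶ discrete S :=
  (sSetTopAdj.homEquiv _ _).symm (copiesToDiscrete S Z)

lemma toDiscrete_apply (s : S) (x : |Z|) :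
    toDiscrete S Z (SSet.toTop.map (copiesι S Z s) x) = s := by
  have : SSet.toTop.map (copiesι S Z s) ≫ toDiscrete S Z =
      TopCat.const (X := |Z|) (Y := discrete S) s := by
    apply (sSetTopAdj.homEquiv _ _).injective
    rw [← homEquiv_const, Adjunction.homEquiv_naturality_left, toDiscrete,
      Equiv.apply_symm_apply]
  exact ConcreteCategory.congr_hom this x

lemma quasiIso_toDiscrete [ContractibleSpace |Z|] :
    QuasiIso (SSet.chainComplexMap (TopCat.toSSet.map (toDiscrete S Z)) R) := by
  obtain ⟨v, ⟨H⟩⟩ := id_nullhomotopic |Z|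
  let sec : discrete S ⟶ |(copies S).obj Z| :=
    TopCat.ofHom (X := discrete S)
      ⟨fun s => SSet.toTop.map (copiesι S Z s) v, continuous_of_discreteTopology⟩
  have hsec : sec ≫ toDiscrete S Z = 𝟙 _ := by
    apply ConcreteCategory.hom_ext
    intro s
    exact toDiscrete_apply S Z s v
  let ι : S → C(|Z|, |(copies S).obj Z|) := fun s => (SSet.toTop.map (copiesι S Z s)).hom
  have hH : Continuous fun x : |Z| × unitInterval => H (x.2, x.1) :=
    H.continuous.comp continuous_swap
  -- The homotopy is written as a map into a space of paths, so that its continuity can be checked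
  -- on each summand.
  let K : C(Σ _ : S, |Z|, C(unitInterval, |(copies S).obj Z|)) :=
    ⟨fun p => (ι p.1).comp (ContinuousMap.curry ⟨_, hH⟩ p.2),
      continuous_sigma fun s => (ContinuousMap.continuous_postcomp (ι s)).comp
        (ContinuousMap.continuous _)⟩
  have hK : ∀ s x t, K ((toTopCopiesIso S Z).hom (SSet.toTop.map (copiesι S Z s) x)) t =
      SSet.toTop.map (copiesι S Z s) (H (t, x)) := fun s x t => by
    rw [toTopCopiesIso_hom_apply]
    rfl
  let H' : TopCat.Homotopy (𝟙 _) (toDiscrete S Z ≫ sec) :=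
    { toFun := fun p => K ((toTopCopiesIso S Z).hom p.2) p.1
      continuous_toFun := by
        have : Continuous fun p : unitInterval × |(copies S).obj Z| =>
            (K ((toTopCopiesIso S Z).hom p.2), p.1) := by fun_prop
        exact continuous_eval.comp this
      map_zero_left := fun y => by
        obtain ⟨s, x, rfl⟩ := exists_toTop_copiesι S _ y
        rw [hK, H.apply_zero]
        rfl
      map_one_left := fun y => by
        obtain ⟨s, x, rfl⟩ := exists_toTop_copiesι S _ y
        rw [hK, H.apply_one]
        change _ = sec (toDiscrete S Z _)
        rw [toDiscrete_apply]
        rfl }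
  exact quasiIso_toSSet_map_of_homotopy R _ sec H'.symm
    ((ContinuousMap.Homotopy.refl _).cast rfl (congrArg TopCat.Hom.hom hsec.symm)).symm

lemma quasiIso_unit_of_contractible [ContractibleSpace |Z|]
    (h : QuasiIso (SSet.chainComplexMap (copiesToDiscrete S Z) R)) :
    QuasiIso (SSet.chainComplexMap (sSetTopAdj.unit.app ((copies S).obj Z)) R) := by
  have w : sSetTopAdj.unit.app _ ≫ TopCat.toSSet.map (toDiscrete S Z) = copiesToDiscrete S Z :=
    (sSetTopAdj.homEquiv_unit _ _ _).symm.trans (Equiv.apply_symm_apply _ _)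
  have := quasiIso_toDiscrete S R Z
  rw [← w, chainComplexMap, Functor.map_comp] at h
  exact quasiIso_of_comp_right _ (SSet.chainComplexMap (TopCat.toSSet.map (toDiscrete S Z)) R)

instance (d : ℕ) : ContractibleSpace |(Δ[d] : SSet.{u})| := by
  have : ContractibleSpace (AffineChain.Simplex d) :=
    (convex_stdSimplex ℝ (Fin (d + 1))).contractibleSpace
      ⟨_, (stdSimplex.vertex (S := ℝ) (0 : Fin (d + 1))).2⟩
  exact (BoundaryRealization.coords d).contractibleSpace

/-- The unit of the adjunction is a quasi-isomorphism for disjoint unions of simplices. -/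
lemma quasiIso_unit_copies (d : ℕ) :
    QuasiIso (SSet.chainComplexMap (sSetTopAdj.unit.app ((copies S).obj Δ[d])) R) :=
  have : Unique (SSet.Augmented.stdSimplex.{u}.obj ⦋d⦌).right :=
    Types.terminalIso.toEquiv.unique
  quasiIso_unit_of_contractible S R Δ[d] (quasiIso_copiesToDiscrete S R
    (SSet.Augmented.stdSimplex.obj ⦋d⦌) (SSet.Augmented.StandardSimplex.extraDegeneracy ⦋d⦌))

end SSet
end

noncomputable section

/-! ### Singular homology of realisations -/

namespace SSet

variable {k : Type u} [Ring k] (R : ModuleCat.{u} k)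

/-- The comparison map from simplicial chains to singular chains of the realisation. -/
abbrev comparison (X : SSet.{u}) :
    X.chainComplex R ⟶ (TopCat.toSSet.obj |X|).chainComplex R :=
  SSet.chainComplexMap (sSetTopAdj.unit.app X) R

lemma quasiIso_comparison_of_iso {X Y : SSet.{u}} (e : X ≅ Y) (h : QuasiIso (comparison R X)) :
    QuasiIso (comparison R Y) := by
  have w : sSetTopAdj.unit.app Y =
      e.inv ≫ sSetTopAdj.unit.app X ≫ TopCat.toSSet.map (SSet.toTop.map e.hom) := by
    rw [Iso.eq_inv_comp]
    exact sSetTopAdj.unit.naturality e.hom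
  rw [comparison, w, chainComplexMap, Functor.map_comp, Functor.map_comp]
  infer_instance

lemma isEmpty_realization (X : SSet.{u}) (h : ∀ n, IsEmpty (X.obj n)) : IsEmpty |X| := by
  let _ : TopologicalSpace (ULift.{u} Prop) := ⊤
  let f : Prop → (|X| ⟶ TopCat.of (ULift.{u} Prop)) := fun p =>
    TopCat.ofHom ⟨fun _ => ⟨p⟩, continuous_top⟩
  have h : f True = f False := (sSetTopAdj.homEquiv _ _).injective (by
    ext n x
    exact (h n).elim x)
  refine ⟨fun x => ?_⟩
  have := congrArg ULift.down (ConcreteCategory.congr_hom h x)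
  change True = False at this
  exact this ▸ trivial

lemma quasiIso_comparison_of_isEmpty (X : SSet.{u}) (h : ∀ n, IsEmpty (X.obj n)) :
    QuasiIso (comparison R X) := by
  have := isEmpty_realization X h
  have : IsIso (sSetTopAdj.unit.app X) := by
    rw [NatTrans.isIso_iff_isIso_app]
    intro n
    rw [isIso_iff_bijective]
    have : IsEmpty ((TopCat.toSSet.obj |X|).obj n) :=
      ⟨fun s => isEmptyElim ((|X|).toSSetObjEquiv n s (stdSimplex.vertex 0))⟩
    exact ⟨fun x => (h n).elim x, fun x => this.elim x⟩
  infer_instance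

lemma isEmpty_of_hasDimensionLT_zero (X : SSet.{u}) [X.HasDimensionLT 0] (n : SimplexCategoryᵒᵖ) :
    IsEmpty (X.obj n) := by
  refine ⟨fun x => ?_⟩
  let y : X _⦋0⦌ := X.map (SimplexCategory.const ⦋0⦌ n.unop 0).op x
  have hy : y ∈ X.degenerate 0 := by
    rw [X.degenerate_eq_univ_of_hasDimensionLT 0 0 le_rfl]
    exact Set.mem_univ _
  obtain ⟨m, hm, -⟩ := hy
  exact absurd hm (Nat.not_lt_zero m)

/-- The attaching step. -/
lemma quasiIso_comparison_of_isPushout {A B D Y : SSet.{u}} {a : A ⟶ B} {i : A ⟶ D} {j : B ⟶ Y}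
    {q : D ⟶ Y} [Mono i] [Mono j] (h : IsPushout a i j q) (c : Collar (SSet.toTop.map i))
    (hA : QuasiIso (comparison R A)) (hD : QuasiIso (comparison R D))
    (hB : QuasiIso (comparison R B)) : QuasiIso (comparison R Y) := by
  let S := SSet.toTop.{u} ⋙ TopCat.toSSet.{u}
  have hS := h.map SSet.toTop
  let η : ∀ {U V : SSet.{u}} (f : U ⟶ V), Arrow.mk f ⟶ Arrow.mk (S.map f) := fun {U V} f =>
    Arrow.homMk (sSetTopAdj.unit.app U) (sSetTopAdj.unit.app V) (sSetTopAdj.unit.naturality f).symm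
  let φ : Arrow.mk i ⟶ Arrow.mk j := Arrow.homMk a q h.w
  let ψ : Arrow.mk (S.map i) ⟶ Arrow.mk (S.map j) := Arrow.homMk (S.map a) (S.map q)
    (by dsimp only [Arrow.mk_hom]; rw [← Functor.map_comp, h.w, Functor.map_comp])
  have : Mono (Arrow.mk i).hom := ‹Mono i›
  have : Mono (Arrow.mk j).hom := ‹Mono j›
  have : Mono (Arrow.mk (S.map i)).hom := c.mono_map
  have : Mono (Arrow.mk (S.map j)).hom := c.mono_of_isPushout hS
  -- Both kinds of relative chains are unchanged by the attachment, simplicial ones by the pushout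
  -- and singular ones by excision. Hence the relative comparison for `j` follows from that for `i`,
  -- and the five lemma passes from `B` to `Y`.
  have hφ : IsIso ((RelativeChain.rel R).map φ) :=
    RelativeChain.isIso_rel_map_of_isPushout R φ h
  have hψ : QuasiIso ((RelativeChain.rel R).map ψ) := c.quasiIso_rel_map_of_isPushout R hS
  have hi : QuasiIso ((RelativeChain.rel R).map (η i)) :=
    RelativeChain.quasiIso_rel_map R (η i) hA hD
  have comm : η i ≫ ψ = φ ≫ η j := by
    ext : 1
    · exact (sSetTopAdj.unit.naturality a).symm
    · exact (sSetTopAdj.unit.naturality q).symm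
  have hj : QuasiIso ((RelativeChain.rel R).map (η j)) := by
    refine quasiIso_of_comp_left ((RelativeChain.rel R).map φ) _ (hφφ' := ?_)
    rw [← Functor.map_comp, ← comm, Functor.map_comp]
    infer_instance
  exact RelativeChain.quasiIso_right_of_rel R (η j) hB hj

lemma hasDimensionLT_skeletonOfBot (X : SSet.{u}) (d : ℕ) :
    HasDimensionLT (skeletonOfMono (⊥ : X.Subcomplex).ι d) d where
  degenerate_eq_top n hn := by
    rw [Set.top_eq_univ, Set.eq_univ_iff_forall]
    intro x
    by_contra hx
    rw [mem_degenerate_iff_notMem_nonDegenerate, not_not] at hx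
    replace hx := (Subcomplex.mem_nonDegenerate_iff _ _).1 hx
    have := (mem_skeletonOfMono_obj_iff_of_nonDegenerate (⊥ : X.Subcomplex).ι ⟨x.1, hx⟩ d).1 x.2
    rcases this with ⟨y, -⟩ | h
    · exact y.2
    · omega

lemma skeletonOfBot_eq_top (X : SSet.{u}) (d : ℕ) [X.HasDimensionLT d] :
    skeletonOfMono (⊥ : X.Subcomplex).ι d = ⊤ := by
  rw [Subcomplex.eq_top_iff_of_hasDimensionLT _ d]
  intro n hn x hx
  exact (mem_skeletonOfMono_obj_iff_of_nonDegenerate (⊥ : X.Subcomplex).ι ⟨x, hx⟩ d).2 (Or.inr hn)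

open relativeCellComplexOfMono in
/-- The simplicial chains of a finite-dimensional simplicial set compute the singular homology of
its realisation. -/
theorem quasiIso_comparison (d : ℕ) : ∀ (X : SSet.{u}) [X.HasDimensionLT d],
    QuasiIso (comparison R X) := by
  induction d with
  | zero => exact fun X _ => quasiIso_comparison_of_isEmpty R X (isEmpty_of_hasDimensionLT_zero X)
  | succ d ih =>
    intro X hX
    let i := (⊥ : X.Subcomplex).ι
    have hsk := hasDimensionLT_skeletonOfBot X d
    -- The skeleton of dimension `< d + 1` is obtained from that of dimension `< d` by attaching
    -- `d`-cells. The induction hypothesis covers the smaller skeleton and the boundaries, and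
    -- contractibility covers the simplices.
    have hpush : IsPushout ((copiesIso (Cell i d) ∂Δ[d]).inv ≫ t i d)
        ((copies (Cell i d)).map ∂Δ[d].ι) (r i d) ((copiesIso (Cell i d) Δ[d]).inv ≫ b i d) :=
      (isPushout i d).of_iso (copiesIso _ _) (Iso.refl _) (copiesIso _ _) (Iso.refl _)
        (by simp) (copiesIso_hom_naturality _ _) (by simp) (by simp)
    have : Mono ((copies (Cell i d)).map (∂Δ[d] : Subcomplex.{u} _).ι) := by
      rw [NatTrans.mono_iff_mono_app]
      intro n
      rw [mono_iff_injective]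
      rintro ⟨s, x⟩ ⟨s', x'⟩ h
      exact Prod.ext (congrArg (fun p => p.1) h) (Subtype.ext (congrArg (fun p => p.2) h))
    have h := quasiIso_comparison_of_isPushout R hpush (copiesCollar _ d)
      (ih _) (quasiIso_unit_copies _ R d) (ih _)
    refine quasiIso_comparison_of_iso R ?_ h
    exact Subcomplex.eqToIso (skeletonOfBot_eq_top X (d + 1)) ≪≫ Subcomplex.topIso X

end SSet
end

noncomputable section

/-! ### Simplicial chains of simplicial sets with contractible realisation -/

lemma ContractibleSpace.homotopic {X Y : Type*} [TopologicalSpace X] [TopologicalSpace Y]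
    [ContractibleSpace Y] (f g : C(X, Y)) : f.Homotopic g := by
  obtain ⟨y, hy⟩ := id_nullhomotopic Y
  exact (hy.comp (ContinuousMap.Homotopic.refl f)).trans
    (hy.comp (ContinuousMap.Homotopic.refl g)).symm

namespace SSet

variable {k : Type u} [Ring k] (R : ModuleCat.{u} k)

lemma quasiIso_toSSet_map_of_contractible {X Y : TopCat.{u}} [ContractibleSpace X]
    [ContractibleSpace Y] (f : X ⟶ Y) :
    QuasiIso (SSet.chainComplexMap (TopCat.toSSet.map f) R) := by
  let g : Y ⟶ X := TopCat.const (Classical.arbitrary X)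
  obtain ⟨h₁⟩ := ContractibleSpace.homotopic (f ≫ g).hom (𝟙 X : X ⟶ X).hom
  obtain ⟨h₂⟩ := ContractibleSpace.homotopic (g ≫ f).hom (𝟙 Y : Y ⟶ Y).hom
  exact quasiIso_toSSet_map_of_homotopy R f g h₁ h₂

lemma quasiIso_chainComplexMap_of_contractible {X Y : SSet.{u}} {d : ℕ} [X.HasDimensionLT d]
    [Y.HasDimensionLT d] [ContractibleSpace |X|] [ContractibleSpace |Y|] (f : X ⟶ Y) :
    QuasiIso (SSet.chainComplexMap f R) := by
  have h₁ := quasiIso_comparison R d X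
  have h₂ := quasiIso_comparison R d Y
  have h₃ := quasiIso_toSSet_map_of_contractible R (SSet.toTop.map f)
  have w : SSet.chainComplexMap f R ≫ comparison R Y = comparison R X ≫
      SSet.chainComplexMap (TopCat.toSSet.map (SSet.toTop.map f)) R := by
    rw [comparison, comparison, ← Functor.map_comp, ← Functor.map_comp]
    congr 1
    exact sSetTopAdj.unit.naturality f
  have : QuasiIso (SSet.chainComplexMap f R ≫ comparison R Y) := by
    rw [w]
    infer_instance
  exact quasiIso_of_comp_right _ (comparison R Y)

lemma quasiIso_normalizedChainComplexMap {X Y : SSet.{u}} (f : X ⟶ Y)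
    (h : QuasiIso (SSet.chainComplexMap f R)) : QuasiIso (SSet.normalizedChainComplexMap f R) := by
  have : QuasiIso (X.toNormalizedChainComplex R ≫ SSet.normalizedChainComplexMap f R) := by
    rw [toNormalizedChainComplex_normalizedChainComplexMap]
    infer_instance
  exact quasiIso_of_comp_left (X.toNormalizedChainComplex R) _

section

variable {X : SSet.{u}}

lemma quasiIso_normalized_toPoint [ContractibleSpace |X|] {d : ℕ} [X.HasDimensionLT d] (p : X ⟶ Δ[0]) :
    QuasiIso (SSet.normalizedChainComplexMap p R) := by
  have : X.HasDimensionLT (d + 1) := X.hasDimensionLT_of_le d (d + 1)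
  have : Δ[0].HasDimensionLT (d + 1) := SSet.hasDimensionLT_of_le _ 1 (d + 1)
  exact quasiIso_normalizedChainComplexMap R p
    (quasiIso_chainComplexMap_of_contractible (d := d + 1) R p)

/-- The comparison is with the point `Δ[0]`, whose normalised chains vanish in positive degrees; the
unnormalised ones do not. -/
lemma exactAt_normalizedChainComplex [ContractibleSpace |X|] (d : ℕ) [X.HasDimensionLT d] (m : ℕ) :
    (X.normalizedChainComplex R).ExactAt (m + 1) := by
  let p : X ⟶ Δ[0] := stdSimplex.isTerminalObj₀.from X
  have := quasiIso_normalized_toPoint (d := d) R p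
  rw [exactAt_iff_of_quasiIsoAt (SSet.normalizedChainComplexMap p R)]
  exact .of_isZero (isZero_normalizedChainComplex_X_of_hasDimensionLT Δ[0] R (m + 1) 1)

lemma normalizedChainComplexMap_f_zero {Y : SSet.{u}} (hY : Subsingleton (Y _⦋0⦌)) (p : X ⟶ Y)
    (ε : (X.normalizedChainComplex R).X 0 ⟶ R)
    (hε : ∀ x : X _⦋0⦌, X.ιNormalizedChainComplex x ≫ ε = 𝟙 R) (y₀ : Y _⦋0⦌) :
    (SSet.normalizedChainComplexMap p R).f 0 = ε ≫ Y.ιNormalizedChainComplex y₀ := by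
  apply normalizedChainComplex_hom_ext
  intro x hx
  rw [ι_normalizedChainComplexMap_f, reassoc_of% (hε x), Subsingleton.elim (p.app _ x) y₀]

/-- The map to the point factors through `ε` in degree `0`, so elements of the kernel of `ε` have
zero class in the homology of the point, hence in that of `X`, and are therefore boundaries. -/
lemma exact_normalized_zero [ContractibleSpace |X|] (d : ℕ) [X.HasDimensionLT d]
    (ε : (X.normalizedChainComplex R).X 0 ⟶ R)
    (hε : ∀ x : X _⦋0⦌, X.ιNormalizedChainComplex x ≫ ε = 𝟙 R)
    (y : (X.normalizedChainComplex R).X 0) (hy : ε y = 0) :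
    ∃ z, (X.normalizedChainComplex R).d 1 0 z = y := by
  let p : X ⟶ Δ[0] := stdSimplex.isTerminalObj₀.from X
  have := quasiIso_normalized_toPoint (d := d) R p
  let N := X.normalizedChainComplex R
  obtain ⟨y₀⟩ : Nonempty (Δ[0] _⦋0⦌) := ⟨stdSimplex.objEquiv.symm (𝟙 _)⟩
  have hΔ : Subsingleton (Δ[0] _⦋0⦌) := ⟨fun a b =>
    yonedaEquiv.symm.injective (stdSimplex.isTerminalObj₀.hom_ext _ _)⟩
  have hp := normalizedChainComplexMap_f_zero R hΔ p ε hε y₀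
  let ι := kernel.ι ε
  have hι : ι ≫ N.d 0 0 = 0 := by simp
  have h₀ : N.liftCycles ι 0 (by simp) hι ≫ N.homologyπ 0 = 0 := by
    rw [← cancel_mono (HomologicalComplex.homologyMap (SSet.normalizedChainComplexMap p R) 0),
      zero_comp, Category.assoc, HomologicalComplex.homologyπ_naturality,
      HomologicalComplex.liftCycles_comp_cyclesMap_assoc]
    have : ι ≫ (SSet.normalizedChainComplexMap p R).f 0 = 0 := by
      rw [hp, kernel.condition_assoc, zero_comp]
    have h : HomologicalComplex.liftCycles _ (ι ≫ (SSet.normalizedChainComplexMap p R).f 0) 0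
        (by simp) (by simp) = 0 := by
      rw [← cancel_mono (HomologicalComplex.iCycles _ _), HomologicalComplex.liftCycles_i, this,
        zero_comp]
    rw [h, zero_comp]
  rw [HomologicalComplex.liftCycles_comp_homologyπ_eq_zero_iff_up_to_refinements N 1 0 0
    (by simp) (by simp) ι hι] at h₀
  obtain ⟨A, π, hπ, z, hz⟩ := h₀
  obtain ⟨y', hy'⟩ : ∃ y' : (kernel ε : ModuleCat.{u} k), ι y' = y := by
    -- The categorical kernel is turned into elements; the cover `π` obtained above is epi, hence
    -- surjective on them.
    have := (ShortComplex.moduleCat_exact_iff _).1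
      (ShortComplex.exact_of_f_is_kernel (ShortComplex.mk ι ε (kernel.condition ε))
        (kernelIsKernel ε)) y hy
    exact this
  obtain ⟨a, rfl⟩ := (ModuleCat.epi_iff_surjective π).1 hπ y'
  exact ⟨z a, (ConcreteCategory.congr_hom hz a).symm.trans hy'⟩

end

/-! The normalised chains, written with finitely supported functions. -/

section

variable {F : Type u} [Field F] (V : Type u) [AddCommGroup V] [Module F V] (X : SSet.{u})

lemma sum_hom_apply {M N : ModuleCat.{u} F} {ι : Type*} (s : Finset ι) (f : ι → (M ⟶ N)) (v : M) :
    (∑ i ∈ s, f i : M ⟶ N) v = ∑ i ∈ s, f i v := by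
  change (∑ i ∈ s, f i : M ⟶ N).hom v = _
  rw [ModuleCat.hom_sum, LinearMap.sum_apply]

open Classical in
/-- The chain supported on a simplex, which is zero if the simplex is degenerate. -/
def simplexChain (F : Type u) [Field F] (V : Type u) [AddCommGroup V] [Module F V]
    {m : ℕ} (x : X _⦋m⦌) : V →ₗ[F] (X.nonDegenerate m →₀ V) :=
  if h : x ∈ X.nonDegenerate m then Finsupp.lsingle ⟨x, h⟩ else 0

lemma simplexChain_of_mem {m : ℕ} (x : X.nonDegenerate m) (v : V) :
    simplexChain X F V x.1 v = Finsupp.single x v := by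
  rw [simplexChain, dif_pos x.2]
  rfl

lemma simplexChain_of_notMem {m : ℕ} {x : X _⦋m⦌} (h : x ∉ X.nonDegenerate m) (v : V) :
    simplexChain X F V x v = 0 := by
  rw [simplexChain, dif_neg h]
  rfl

/-- The differential of the normalised chains. -/
def finsuppD (F : Type u) [Field F] (V : Type u) [AddCommGroup V] [Module F V] (m : ℕ) :
    (X.nonDegenerate (m + 1) →₀ V) →ₗ[F] (X.nonDegenerate m →₀ V) :=
  Finsupp.lsum F fun x => ∑ i : Fin (m + 2), (-1 : ℤ) ^ i.val • simplexChain X F V (X.δ i x.1)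

lemma finsuppD_single (m : ℕ) (x : X.nonDegenerate (m + 1)) (v : V) :
    finsuppD X F V m (Finsupp.single x v) =
      ∑ i : Fin (m + 2), (-1 : ℤ) ^ i.val • simplexChain X F V (X.δ i x.1) v := by
  rw [finsuppD, Finsupp.lsum_single, LinearMap.sum_apply]
  rfl

/-- The augmentation of the normalised chains. -/
def finsuppε (F : Type u) [Field F] (V : Type u) [AddCommGroup V] [Module F V] :
    (X.nonDegenerate 0 →₀ V) →ₗ[F] V := Finsupp.lsum F fun _ => LinearMap.id

/-- The comparison with the normalised chain complex. -/
def finsuppToNormalized (m : ℕ) :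
    ModuleCat.of F (X.nonDegenerate m →₀ V) ⟶
      (X.normalizedChainComplex (ModuleCat.of F V)).X m :=
  ModuleCat.ofHom (Finsupp.lsum F fun x =>
    (X.ιNormalizedChainComplex (R := ModuleCat.of F V) x.1).hom)

lemma finsuppToNormalized_single (m : ℕ) (x : X.nonDegenerate m) (v : V) :
    finsuppToNormalized (F := F) V X m (Finsupp.single x v) =
      X.ιNormalizedChainComplex (R := ModuleCat.of F V) x.1 v := by
  refine (Finsupp.sum_single_index ?_)
  exact map_zero (X.ιNormalizedChainComplex (R := ModuleCat.of F V) x.1).hom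

lemma simplexChain_finsuppToNormalized {m : ℕ} (x : X _⦋m⦌) :
    ModuleCat.ofHom (simplexChain X F V x) ≫ finsuppToNormalized V X m =
      X.ιNormalizedChainComplex (R := ModuleCat.of F V) x := by
  ext v
  by_cases hx : x ∈ X.nonDegenerate m
  · change finsuppToNormalized V X m (simplexChain X F V x v) = _
    rw [simplexChain_of_mem V X ⟨x, hx⟩, finsuppToNormalized_single]
  · change finsuppToNormalized V X m (simplexChain X F V x v) = _
    rw [simplexChain_of_notMem V X hx, map_zero,
      X.ιNormalizedChainComplex_eq_zero x (by
        rwa [mem_degenerate_iff_notMem_nonDegenerate])]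
    rfl

instance (m : ℕ) : IsIso (finsuppToNormalized (F := F) V X m) := by
  let g := (X.isColimitCofanNormalizedChainComplex (ModuleCat.of F V) m).desc
    (Cofan.mk (ModuleCat.of F (X.nonDegenerate m →₀ V))
      fun x => ModuleCat.ofHom (Finsupp.lsingle x))
  have hg : ∀ x : X.nonDegenerate m, X.ιNormalizedChainComplex (R := ModuleCat.of F V) x.1 ≫ g =
      ModuleCat.ofHom (Finsupp.lsingle x) := fun x =>
    (X.isColimitCofanNormalizedChainComplex (ModuleCat.of F V) m).fac _ ⟨x⟩
  refine ⟨g, ?_, ?_⟩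
  · apply ModuleCat.hom_ext
    refine Finsupp.lhom_ext fun x v => ?_
    change g (finsuppToNormalized V X m (Finsupp.single x v)) = Finsupp.single x v
    rw [finsuppToNormalized_single]
    exact ConcreteCategory.congr_hom (hg x) v
  · apply normalizedChainComplex_hom_ext
    intro x hx
    rw [reassoc_of% (hg ⟨x, hx⟩), Category.comp_id]
    ext v
    exact finsuppToNormalized_single V X m ⟨x, hx⟩ v

lemma finsuppToNormalized_d (m : ℕ) :
    finsuppToNormalized V X (m + 1) ≫
      (X.normalizedChainComplex (ModuleCat.of F V)).d (m + 1) m =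
      ModuleCat.ofHom (finsuppD X F V m) ≫ finsuppToNormalized V X m := by
  apply ModuleCat.hom_ext
  refine Finsupp.lhom_ext fun x v => ?_
  change (X.normalizedChainComplex (ModuleCat.of F V)).d (m + 1) m
    (finsuppToNormalized V X (m + 1) (Finsupp.single x v)) =
      finsuppToNormalized V X m (finsuppD X F V m (Finsupp.single x v))
  rw [finsuppToNormalized_single, finsuppD_single, map_sum]
  have h := ConcreteCategory.congr_hom
    (X.ιNormalizedChainComplex_d (R := ModuleCat.of F V) x.1) v
  refine h.trans ((sum_hom_apply _ _ _).trans ?_)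
  refine Finset.sum_congr rfl fun i _ => ?_
  rw [map_zsmul]
  have h' := ConcreteCategory.congr_hom (simplexChain_finsuppToNormalized V X (F := F)
    (X.δ i x.1)) v
  exact congrArg ((-1 : ℤ) ^ i.val • ·) h'.symm

lemma finsuppToNormalized_bijective (m : ℕ) :
    Function.Bijective (finsuppToNormalized (F := F) V X m) :=
  ConcreteCategory.bijective_of_isIso _

lemma finsuppToNormalized_d_apply (m : ℕ) (y : X.nonDegenerate (m + 1) →₀ V) :
    (X.normalizedChainComplex (ModuleCat.of F V)).d (m + 1) m
      (finsuppToNormalized V X (m + 1) y) = finsuppToNormalized V X m (finsuppD X F V m y) := by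
  have h := finsuppToNormalized_d V X (F := F) m
  generalize finsuppToNormalized (F := F) V X m = f at *
  generalize finsuppToNormalized (F := F) V X (m + 1) = g at *
  exact ConcreteCategory.congr_hom h y

lemma finsuppD_finsuppD (m : ℕ) (y : X.nonDegenerate (m + 2) →₀ V) :
    finsuppD X F V m (finsuppD X F V (m + 1) y) = 0 := by
  apply (finsuppToNormalized_bijective (F := F) V X m).1
  rw [← finsuppToNormalized_d_apply, ← finsuppToNormalized_d_apply, map_zero]
  exact ConcreteCategory.congr_hom
    ((X.normalizedChainComplex (ModuleCat.of F V)).d_comp_d (m + 2) (m + 1) m) _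

lemma finsuppε_single (x : X.nonDegenerate 0) (v : V) :
    finsuppε X F V (Finsupp.single x v) = v := Finsupp.lsum_single _ _ _ _

lemma finsuppε_finsuppD (y : X.nonDegenerate 1 →₀ V) : finsuppε X F V (finsuppD X F V 0 y) = 0 := by
  have : finsuppε X F V ∘ₗ finsuppD X F V 0 = 0 := by
    refine Finsupp.lhom_ext fun x v => ?_
    have h : ∀ z : X _⦋0⦌, finsuppε X F V (simplexChain X F V z v) = v := fun z => by
      rw [simplexChain_of_mem V X ⟨z, by simp⟩, finsuppε_single]
    rw [LinearMap.comp_apply, finsuppD_single, Fin.sum_univ_two, map_add, map_zsmul, map_zsmul,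
      h, h]
    simp
  exact LinearMap.congr_fun this y

variable [ContractibleSpace |X|]

/-- A contractible space is non-empty, so `X` has a simplex and therefore a vertex. -/
lemma finsuppε_surjective : Function.Surjective (finsuppε X F V) := by
  intro v
  obtain ⟨x⟩ : Nonempty (X _⦋0⦌) := by
    by_contra hX
    have h : ∀ n, IsEmpty (X.obj n) := fun n => ⟨fun x =>
      hX ⟨X.map (SimplexCategory.const ⦋0⦌ n.unop 0).op x⟩⟩
    have := isEmpty_realization X h
    exact isEmptyElim (Classical.arbitrary |X|)
  exact ⟨Finsupp.single ⟨x, by simp⟩ v, finsuppε_single V X _ v⟩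

lemma exists_finsuppD_eq (d : ℕ) [X.HasDimensionLT d] (m : ℕ) (y : X.nonDegenerate (m + 1) →₀ V)
    (hy : finsuppD X F V m y = 0) : ∃ z, finsuppD X F V (m + 1) z = y := by
  have h := exactAt_normalizedChainComplex (X := X) (ModuleCat.of F V) d m
  rw [HomologicalComplex.exactAt_iff' _ (m + 2) (m + 1) m (by simp) (by simp),
    ShortComplex.moduleCat_exact_iff] at h
  obtain ⟨z, hz⟩ := h (finsuppToNormalized V X (m + 1) y)
    ((finsuppToNormalized_d_apply V X m y).trans (congrArg (finsuppToNormalized V X m) hy |>.trans (map_zero _)))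
  obtain ⟨z, rfl⟩ := (finsuppToNormalized_bijective V X _).2 z
  exact ⟨z, (finsuppToNormalized_bijective V X _).1
    ((finsuppToNormalized_d_apply V X (m + 1) z).symm.trans hz)⟩

lemma exists_finsuppD_eq_zero (d : ℕ) [X.HasDimensionLT d] (y : X.nonDegenerate 0 →₀ V)
    (hy : finsuppε X F V y = 0) : ∃ z, finsuppD X F V 0 z = y := by
  have hι : ∀ x : X _⦋0⦌, X.ιNormalizedChainComplex (R := ModuleCat.of F V) x ≫
      inv (finsuppToNormalized V X 0) = ModuleCat.ofHom (simplexChain X F V x) := fun x => by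
    rw [IsIso.comp_inv_eq, simplexChain_finsuppToNormalized]
  obtain ⟨z, hz⟩ := exact_normalized_zero (X := X) (ModuleCat.of F V) d
    (inv (finsuppToNormalized V X 0) ≫ ModuleCat.ofHom (finsuppε X F V))
    (fun x => by
      rw [reassoc_of% (hι x)]
      ext v
      change finsuppε X F V (simplexChain X F V x v) = v
      rw [simplexChain_of_mem V X ⟨x, by simp⟩, finsuppε_single])
    (finsuppToNormalized V X 0 y) (by
      have : inv (finsuppToNormalized (F := F) V X 0) (finsuppToNormalized V X 0 y) = y :=
        ConcreteCategory.congr_hom (IsIso.hom_inv_id (finsuppToNormalized (F := F) V X 0)) y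
      exact (congrArg (finsuppε X F V) this).trans hy)
  obtain ⟨z, rfl⟩ := (finsuppToNormalized_bijective V X _).2 z
  exact ⟨z, (finsuppToNormalized_bijective V X _).1
    ((finsuppToNormalized_d_apply V X 0 z).symm.trans hz)⟩

end

end SSet
end

/-! ### Averages of locally constant functions on compact groups -/

noncomputable section

namespace LocallyConstant

section Average

variable {Q : Type u} [Group Q] [TopologicalSpace Q] [IsTopologicalGroup Q] [CompactSpace Q]

/-- The right translations that leave a locally constant function on a compact group unchanged. -/
def rightStabilizer {W : Type*} (f : LocallyConstant Q W) : OpenSubgroup Q where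
  carrier := {u | ∀ q, f (q * u) = f q}
  mul_mem' {a b} ha hb q := by rw [← mul_assoc, hb, ha]
  one_mem' q := by rw [mul_one]
  inv_mem' {a} ha q := by rw [← ha, inv_mul_cancel_right]
  isOpen' := by
    refine isOpen_iff_mem_nhds.2 fun u hu => ?_
    have hopen : IsOpen (Set.ofPred fun p : Q × Q => f (p.1 * p.2) = f p.1) := by
      let _ : TopologicalSpace W := ⊥
      have : DiscreteTopology W := ⟨rfl⟩
      have hc : Continuous fun p : Q × Q => (f (p.1 * p.2), f p.1) :=
        (f.continuous.comp continuous_mul).prodMk (f.continuous.comp continuous_fst)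
      exact (isOpen_discrete (Set.diagonal W)).preimage hc
    -- By compactness of `Q`, the tube lemma makes a single neighbourhood of `u` work for all `q` at
    -- once.
    obtain ⟨s, t, -, ht, hs, hut, hst⟩ := generalized_tube_lemma (isCompact_univ (X := Q))
      (isCompact_singleton (x := u)) hopen (by
        rintro ⟨a, b⟩ ⟨-, hb⟩
        cases Set.mem_singleton_iff.1 hb
        exact hu a)
    filter_upwards [ht.mem_nhds (hut rfl)] with b hb q
    exact hst (Set.mk_mem_prod (hs (Set.mem_univ q)) hb)

variable {F : Type u} [Field F] {W W' : Type*} [AddCommGroup W] [Module F W]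
  [AddCommGroup W'] [Module F W']

/-- The descent of a function to the left cosets of a group of right translations fixing it. -/
def descend (f : LocallyConstant Q W) {U : Subgroup Q} (hU : U ≤ f.rightStabilizer) : Q ⧸ U → W :=
  Quotient.lift f fun a b h => by
    have := hU (QuotientGroup.leftRel_apply.1 h) a
    rw [mul_inv_cancel_left] at this
    exact this.symm

variable (F) in
/-- The average of a locally constant function over the cosets of an open subgroup. -/
def averageOver (f : LocallyConstant Q W) (U : OpenSubgroup Q)
    (hU : (U : Subgroup Q) ≤ f.rightStabilizer) : W :=
  ((U : Subgroup Q).index : F)⁻¹ • ∑ᶠ q : Q ⧸ (U : Subgroup Q), f.descend hU q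

/-- Each coset of `U` splits into `[U : U']` cosets of `U'` on which `f` has the same value, and `[Q
: U'] = [U : U'] [Q : U]` is non-zero in `F` by ordinarity. -/
theorem averageOver_of_le (hF : SmoothRep.IsOrdinary F Q) (f : LocallyConstant Q W)
    {U U' : OpenSubgroup Q} (h : U' ≤ U) (hU : (U : Subgroup Q) ≤ f.rightStabilizer) :
    averageOver F f U' (le_trans h hU) = averageOver F f U hU := by
  have : Finite (Q ⧸ (U : Subgroup Q)) := Subgroup.quotient_finite_of_isOpen _ U.isOpen
  have : Finite (Q ⧸ (U' : Subgroup Q)) := Subgroup.quotient_finite_of_isOpen _ U'.isOpen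
  have hle : (U' : Subgroup Q) ≤ U := h
  let e := Subgroup.quotientEquivProdOfLE hle
  have : Finite ((Q ⧸ (U : Subgroup Q)) × (U : Subgroup Q) ⧸ (U' : Subgroup Q).subgroupOf U) :=
    Finite.of_equiv _ e
  have : Finite ((U : Subgroup Q) ⧸ (U' : Subgroup Q).subgroupOf U) :=
    Finite.of_injective (fun b => ((1 : Q) , b) : _ → (Q ⧸ (U : Subgroup Q)) × _)
      fun a b h => (Prod.mk.inj h).2
  cases nonempty_fintype (Q ⧸ (U : Subgroup Q))
  cases nonempty_fintype (Q ⧸ (U' : Subgroup Q))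
  cases nonempty_fintype ((U : Subgroup Q) ⧸ (U' : Subgroup Q).subgroupOf U)
  have hsum : ∑ q, f.descend (le_trans h hU) q =
      ((U' : Subgroup Q).relIndex U : F) • ∑ q, f.descend hU q := by
    have : ∀ q, f.descend (le_trans h hU) q = f.descend hU (e q).1 := by
      rintro ⟨q⟩
      rfl
    simp only [this]
    rw [e.sum_comp (fun p => f.descend hU p.1), Fintype.sum_prod_type]
    simp only [Finset.sum_const, Finset.card_univ]
    rw [← Finset.smul_sum, Nat.cast_smul_eq_nsmul, Subgroup.relIndex, Subgroup.index,
      Nat.card_eq_fintype_card]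
  have hi : ((U' : Subgroup Q).index : F) ≠ 0 := fun h0 => hF U' ((ringChar.spec F _).1 h0)
  have hmul : (((U' : Subgroup Q).relIndex U : F)) * ((U : Subgroup Q).index : F) =
      ((U' : Subgroup Q).index : F) := by
    rw [← Nat.cast_mul, Subgroup.relIndex_mul_index hle]
  rw [averageOver, averageOver, finsum_eq_sum_of_fintype, finsum_eq_sum_of_fintype, hsum,
    smul_smul, ← hmul, mul_inv_rev, mul_assoc, inv_mul_cancel₀, mul_one]
  intro h0
  rw [h0, zero_mul] at hmul
  exact hi hmul.symm

theorem averageOver_eq (hF : SmoothRep.IsOrdinary F Q) (f : LocallyConstant Q W)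
    {U U' : OpenSubgroup Q} (hU : (U : Subgroup Q) ≤ f.rightStabilizer)
    (hU' : (U' : Subgroup Q) ≤ f.rightStabilizer) :
    averageOver F f U hU = averageOver F f U' hU' :=
  (averageOver_of_le hF f (inf_le_left : U ⊓ U' ≤ U) hU).symm.trans
    (averageOver_of_le hF f (inf_le_right : U ⊓ U' ≤ U') hU')

variable (F) in
/-- The average of a locally constant function over a compact group. -/
def average (f : LocallyConstant Q W) : W := averageOver F f f.rightStabilizer le_rfl

theorem average_eq (hF : SmoothRep.IsOrdinary F Q) (f : LocallyConstant Q W) (U : OpenSubgroup Q)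
    (hU : (U : Subgroup Q) ≤ f.rightStabilizer) : average F f = averageOver F f U hU :=
  averageOver_eq hF f _ _

theorem average_add (hF : SmoothRep.IsOrdinary F Q) (f g : LocallyConstant Q W) :
    average F (f + g) = average F f + average F g := by
  have hfg : ((f.rightStabilizer ⊓ g.rightStabilizer : OpenSubgroup Q) : Subgroup Q) ≤
      (f + g).rightStabilizer := fun u hu q => congrArg₂ (· + ·) (hu.1 q) (hu.2 q)
  have : Finite (Q ⧸ ((f.rightStabilizer ⊓ g.rightStabilizer : OpenSubgroup Q) : Subgroup Q)) :=
    Subgroup.quotient_finite_of_isOpen _ (f.rightStabilizer ⊓ g.rightStabilizer).isOpen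
  rw [average_eq hF (f + g) _ hfg,
    average_eq hF f (f.rightStabilizer ⊓ g.rightStabilizer) (inf_le_left (α := OpenSubgroup Q)),
    average_eq hF g (f.rightStabilizer ⊓ g.rightStabilizer) (inf_le_right (α := OpenSubgroup Q)),
    averageOver, averageOver, averageOver, ← smul_add,
    ← finsum_add_distrib (Set.toFinite _) (Set.toFinite _)]
  congr 2
  ext ⟨q⟩
  rfl

theorem average_map (hF : SmoothRep.IsOrdinary F Q) (f : LocallyConstant Q W) (T : W →ₗ[F] W') :
    average F (f.map T) = T (average F f) := by
  have hfT : (f.rightStabilizer : Subgroup Q) ≤ (f.map T).rightStabilizer :=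
    fun u hu q => congrArg T (hu q)
  have : Finite (Q ⧸ (f.rightStabilizer : Subgroup Q)) :=
    Subgroup.quotient_finite_of_isOpen _ f.rightStabilizer.isOpen
  cases nonempty_fintype (Q ⧸ (f.rightStabilizer : Subgroup Q))
  rw [average_eq hF (f.map T) _ hfT, average, averageOver, averageOver, map_smul,
    finsum_eq_sum_of_fintype, finsum_eq_sum_of_fintype, map_sum]
  congr 2
  ext ⟨q⟩
  rfl

theorem average_const (hF : SmoothRep.IsOrdinary F Q) (w : W) :
    average F (const Q w) = w := by
  have hU : ((⊤ : OpenSubgroup Q) : Subgroup Q) ≤ (const Q w).rightStabilizer := fun _ _ _ => rfl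
  rw [average_eq hF _ ⊤ hU, averageOver]
  have : Finite (Q ⧸ ((⊤ : OpenSubgroup Q) : Subgroup Q)) :=
    Subgroup.quotient_finite_of_isOpen _ (⊤ : OpenSubgroup Q).isOpen
  cases nonempty_fintype (Q ⧸ ((⊤ : OpenSubgroup Q) : Subgroup Q))
  have h : ∀ q, (const Q w).descend hU q = w := by
    rintro ⟨q⟩
    rfl
  simp only [h, finsum_eq_sum_of_fintype, Finset.sum_const, Finset.card_univ]
  rw [Subgroup.index, Nat.card_eq_fintype_card, ← Nat.cast_smul_eq_nsmul F, smul_smul,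
    inv_mul_cancel₀, one_smul]
  intro h0
  refine hF ⊤ ((ringChar.spec F _).1 ?_)
  rw [Subgroup.index, Nat.card_eq_fintype_card]
  exact h0

/-- Left translation of locally constant functions. -/
def leftTranslate (q : Q) (f : LocallyConstant Q W) : LocallyConstant Q W :=
  f.comap ⟨fun a => q * a, continuous_const_mul q⟩

/-- Left translation permutes the left cosets over which the average is taken. -/
theorem average_leftTranslate (hF : SmoothRep.IsOrdinary F Q) (q : Q) (f : LocallyConstant Q W) :
    average F (f.leftTranslate q) = average F f := by
  have hU : (f.rightStabilizer : Subgroup Q) ≤ (f.leftTranslate q).rightStabilizer := by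
    intro u hu a
    change f (q * (a * u)) = f (q * a)
    rw [← mul_assoc]
    exact hu _
  have : Finite (Q ⧸ (f.rightStabilizer : Subgroup Q)) :=
    Subgroup.quotient_finite_of_isOpen _ f.rightStabilizer.isOpen
  cases nonempty_fintype (Q ⧸ (f.rightStabilizer : Subgroup Q))
  rw [average_eq hF _ _ hU, average, averageOver, averageOver, finsum_eq_sum_of_fintype,
    finsum_eq_sum_of_fintype]
  congr 1
  refine (Finset.sum_congr rfl ?_).trans
    (Equiv.sum_comp (MulAction.toPerm (α := Q) (β := Q ⧸ (f.rightStabilizer : Subgroup Q)) q) _)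
  rintro ⟨a⟩ -
  rfl

end Average

end LocallyConstant

end

/-! ### Semisimple representations -/

noncomputable section

namespace Representation

section

variable {F H : Type*} [Field F] [Group H] {V W : Type*} [AddCommGroup V] [Module F V]
  [AddCommGroup W] [Module F W] {ρ : Representation F H V} {σ : Representation F H W}

theorem map_asAlgebraHom (f : V →ₗ[F] W) (hf : ∀ h v, f (ρ h v) = σ h (f v))
    (z : MonoidAlgebra F H) (v : V) : f (ρ.asAlgebraHom z v) = σ.asAlgebraHom z (f v) := by
  induction z using MonoidAlgebra.induction_linear with
  | zero => simp
  | add x y hx hy => simp only [map_add, LinearMap.add_apply, hx, hy]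
  | single a r => simp [hf]

/-- An equivariant linear map as a linear map over the group algebra. -/
def asModuleHom (f : V →ₗ[F] W) (hf : ∀ h v, f (ρ h v) = σ h (f v)) :
    ρ.asModule →ₗ[MonoidAlgebra F H] σ.asModule where
  toFun := f
  map_add' := f.map_add
  map_smul' := map_asAlgebraHom f hf

theorem IsSemisimpleRepresentation.of_injective [h : IsSemisimpleRepresentation σ]
    (f : V →ₗ[F] W) (hf : ∀ h v, f (ρ h v) = σ h (f v)) (hinj : Function.Injective f) :
    IsSemisimpleRepresentation ρ := by
  rw [isSemisimpleRepresentation_iff_isSemisimpleModule_asModule] at h ⊢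
  exact IsSemisimpleModule.of_injective (M := σ.asModule) (N := ρ.asModule) (asModuleHom f hf) hinj

/-- A representation generated by the images of semisimple representations is semisimple. -/
theorem IsSemisimpleRepresentation.of_iSup_range {ι : Type*} [h : IsSemisimpleRepresentation ρ]
    (f : ι → V →ₗ[F] W) (hf : ∀ i h v, f i (ρ h v) = σ h (f i v))
    (htop : ∀ w, w ∈ ⨆ i, LinearMap.range (f i)) : IsSemisimpleRepresentation σ := by
  rw [isSemisimpleRepresentation_iff_isSemisimpleModule_asModule] at h ⊢
  refine isSemisimpleModule_of_isSemisimpleModule_submodule'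
    (p := fun i => LinearMap.range (asModuleHom (f i) (hf i)))
    (fun i => IsSemisimpleModule.range _) ?_
  rw [eq_top_iff]
  intro w _
  -- The first supremum is of `F`-subspaces, the second of submodules over the group algebra; only
  -- additive closure is needed to pass from one to the other.
  have key : ∀ w : W, w ∈ ⨆ i, LinearMap.range (f i) →
      w ∈ (⨆ i, LinearMap.range (asModuleHom (f i) (hf i))).toAddSubgroup := by
    intro w hw
    induction hw using Submodule.iSup_induction' with
    | mem i x hx =>
      obtain ⟨v, rfl⟩ := hx
      exact Submodule.mem_iSup_of_mem (p := fun i => LinearMap.range (asModuleHom (f i) (hf i))) i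
        ⟨v, rfl⟩
    | zero => exact zero_mem _
    | add x y _ _ hx hy => exact add_mem hx hy
  exact key w (htop w)

theorem IsSemisimpleRepresentation.of_surjective [IsSemisimpleRepresentation ρ]
    (f : V →ₗ[F] W) (hf : ∀ h v, f (ρ h v) = σ h (f v)) (hsurj : Function.Surjective f) :
    IsSemisimpleRepresentation σ :=
  of_iSup_range (ι := Unit) (fun _ => f) (fun _ => hf) fun w => by
    rw [iSup_unique]
    exact hsurj w

theorem IsSemisimpleRepresentation.prod (hρ : IsSemisimpleRepresentation ρ)
    (hσ : IsSemisimpleRepresentation σ) : IsSemisimpleRepresentation (ρ.prod σ) := by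
  rw [isSemisimpleRepresentation_iff_isSemisimpleModule_asModule] at hρ hσ ⊢
  let p := LinearMap.range (asModuleHom (ρ := ρ) (σ := ρ.prod σ) (LinearMap.inl F V W)
    fun h v => by simp)
  let q := LinearMap.range (asModuleHom (ρ := σ) (σ := ρ.prod σ) (LinearMap.inr F V W)
    fun h v => by simp)
  have hp : IsSemisimpleModule (MonoidAlgebra F H) p := .range _
  have hq : IsSemisimpleModule (MonoidAlgebra F H) q := .range _
  have htop : p ⊔ q = ⊤ := by
    rw [eq_top_iff]
    rintro w -
    refine Submodule.mem_sup.2 ⟨_, ⟨w.1, rfl⟩, _, ⟨w.2, rfl⟩, ?_⟩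
    exact Prod.ext (add_zero w.1) (zero_add w.2)
  refine isSemisimpleModule_of_isSemisimpleModule_submodule' (p := fun b => cond b p q) ?_ ?_
  · rintro (_ | _) <;> assumption
  · rw [iSup_bool_eq]
    exact htop

/-- A surjection from a semisimple representation has an equivariant section. -/
theorem IsSemisimpleRepresentation.exists_section [h : IsSemisimpleRepresentation ρ]
    (f : V →ₗ[F] W) (hf : ∀ h v, f (ρ h v) = σ h (f v)) (hsurj : Function.Surjective f) :
    ∃ s : W →ₗ[F] V, (∀ h w, s (σ h w) = ρ h (s w)) ∧ ∀ w, f (s w) = w := by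
  rw [isSemisimpleRepresentation_iff_isSemisimpleModule_asModule] at h
  obtain ⟨s, hs⟩ := IsSemisimpleModule.lifting_property (asModuleHom f hf) hsurj LinearMap.id
  have hsmul : ∀ (z : MonoidAlgebra F H) (w : W),
      (s (σ.asAlgebraHom z w) : V) = ρ.asAlgebraHom z (s w) := fun z w => s.map_smul z w
  refine ⟨⟨⟨s, s.map_add⟩, fun r w => ?_⟩, fun a w => ?_, fun w => LinearMap.congr_fun hs w⟩
  · have := hsmul (MonoidAlgebra.single 1 r) w
    rw [Representation.asAlgebraHom_single, Representation.asAlgebraHom_single, map_one,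
      map_one] at this
    exact this
  · have := hsmul (MonoidAlgebra.single a 1) w
    rw [Representation.asAlgebraHom_single_one, Representation.asAlgebraHom_single_one] at this
    exact this

end

end Representation

/-! ### The two categories as subcategories cut out by elements of `F[A]` -/

namespace SmoothRep

section Subcategory

variable {F : Type u} [Field F] {G : Type u} [Group G] [TopologicalSpace G]

/-- Smooth representations that are semisimple over `A` and killed by a set of elements of the
group algebra of `A`. -/
def isInMAKilledBy (A : Subgroup G) (I : Set (MonoidAlgebra F A)) :
    ObjectProperty (Rep.{u} F G) := fun V =>
  isInMA F A V ∧ ∀ z ∈ I, ∀ v : V,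
    Representation.asAlgebraHom (V.ρ.comp A.subtype : Representation F A V) z v = 0

theorem isInMAKilledBy_empty (A : Subgroup G) : isInMAKilledBy (F := F) A ∅ = isInMA F A := by
  ext V
  exact ⟨fun h => h.1, fun h => ⟨h, fun _ h => h.elim⟩⟩

section Character

variable {A : Subgroup G} {Ft : Type u} [Field Ft] [Algebra F Ft]

/-- The action of the group algebra on the one-dimensional representation given by `χ`. -/
def characterAlgHom (χ : A →* Ftˣ) : MonoidAlgebra F A →ₐ[F] Ft :=
  MonoidAlgebra.lift F Ft A ((Units.coeHom Ft).comp χ)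

theorem characterAlgHom_single (χ : A →* Ftˣ) (a : A) (r : F) :
    characterAlgHom (F := F) χ (MonoidAlgebra.single a r) = r • (χ a : Ft) := by
  simp [characterAlgHom]

theorem characterAlgHom_surjective {χ : A →* Ftˣ} (hχ : IsIrrCharacter (F := F) χ) :
    Function.Surjective (characterAlgHom (F := F) χ) := by
  rw [← AlgHom.range_eq_top, eq_top_iff, ← hχ]
  refine Algebra.adjoin_le ?_
  rintro _ ⟨a, rfl⟩
  exact ⟨MonoidAlgebra.single a 1, by
    simpa using characterAlgHom_single (F := F) χ a 1⟩

/-- `F[A] → Ft` is onto since `χ(A)` generates `Ft`. If its kernel kills `V`, the action of `F[A]`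
factors through the field `Ft`, and a basis of `V` over `Ft` is the required decomposition. -/
theorem isSumOfCharacter_iff {χ : A →* Ftˣ} (hχ : IsIrrCharacter (F := F) χ) (V : Rep.{u} F G) :
    IsSumOfCharacter χ V ↔ ∀ z, characterAlgHom (F := F) χ z = 0 → ∀ v : V,
      Representation.asAlgebraHom (V.ρ.comp A.subtype : Representation F A V) z v = 0 := by
  set ρ : Representation F A V := V.ρ.comp A.subtype with hρ
  constructor
  · rintro ⟨ι, e, he⟩ z hz v
    have key : ∀ z : MonoidAlgebra F A, ∀ i,
        e (ρ.asAlgebraHom z v) i = characterAlgHom (F := F) χ z * e v i := by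
      intro z i
      induction z using MonoidAlgebra.induction_linear with
      | zero => simp
      | add f g hf hg => simp only [map_add, LinearMap.add_apply, Finsupp.add_apply, hf, hg, add_mul]
      | single a r =>
        rw [Representation.asAlgebraHom_single, characterAlgHom_single, LinearMap.smul_apply,
          map_smul, Finsupp.smul_apply, smul_mul_assoc]
        exact congrArg (r • ·) (he a v i)
    apply e.injective
    ext i
    rw [key, hz, zero_mul, map_zero, Finsupp.zero_apply]
  · intro h
    have hs := characterAlgHom_surjective hχ
    let ψ : Ft →+* Module.End F V :=
      (characterAlgHom (F := F) χ).toRingHom.liftOfRightInverse _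
        (Function.rightInverse_surjInv hs) ⟨ρ.asAlgebraHom.toRingHom, fun z hz =>
          LinearMap.ext (h z hz)⟩
    have hψ : ∀ z, ψ (characterAlgHom (F := F) χ z) = ρ.asAlgebraHom z := fun z =>
      RingHom.liftOfRightInverse_comp_apply _ _ (Function.rightInverse_surjInv hs) _ z
    let _ : Module Ft V := Module.compHom V ψ
    have hsmul : ∀ (t : Ft) (v : V), t • v = ψ t v := fun _ _ => rfl
    have : IsScalarTower F Ft V := by
      refine ⟨fun r t v => ?_⟩
      obtain ⟨z, rfl⟩ := hs t
      rw [← map_smul, hsmul, hsmul, hψ, hψ, map_smul, LinearMap.smul_apply]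
    let b := Module.Basis.ofVectorSpace Ft V
    refine ⟨Module.Basis.ofVectorSpaceIndex Ft V, b.repr.restrictScalars F, fun a v i => ?_⟩
    have : V.ρ a v = (χ a : Ft) • v := by
      rw [hsmul]
      have h1 := characterAlgHom_single (F := F) χ a 1
      rw [one_smul] at h1
      rw [← h1, hψ, Representation.asAlgebraHom_single, one_smul]
      rfl
    rw [this]
    simp

theorem isInMAKilledBy_ker {χ : A →* Ftˣ} (hχ : IsIrrCharacter (F := F) χ) :
    isInMAKilledBy A (characterAlgHom (F := F) χ ⁻¹' {0}) = isInMAChar (F := F) χ := by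
  ext V
  exact and_congr_right fun _ => (isSumOfCharacter_iff hχ V).symm

end Character

variable (A : Subgroup G) (I : Set (MonoidAlgebra F A))

/-- With closure under quotients and finite products, this makes the full subcategory abelian with
exact inclusion, so that exactness and epimorphisms can be tested on vectors. -/
instance : (isInMAKilledBy A I).IsClosedUnderSubobjects where
  prop_of_mono {V W} f _ hW := by
    have hf : Function.Injective f.hom := (Rep.mono_iff_injective f).1 inferInstance
    have hcomm : ∀ (a : A) (v : V), f.hom.toLinearMap (V.ρ a v) = W.ρ a (f.hom.toLinearMap v) :=
      fun a v => Rep.hom_comm_apply f a v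
    refine ⟨⟨fun v => ?_, ?_⟩, fun z hz v => ?_⟩
    · obtain ⟨K, h1, h2, h3⟩ := hW.1.1 (f.hom v)
      exact ⟨K, h1, h2, fun k hk => hf ((Rep.hom_comm_apply f k v).trans (h3 k hk))⟩
    · have : Representation.IsSemisimpleRepresentation
        (W.ρ.comp A.subtype : Representation F A W) := hW.1.2
      exact Representation.IsSemisimpleRepresentation.of_injective
        (ρ := V.ρ.comp A.subtype) (σ := W.ρ.comp A.subtype) f.hom.toLinearMap hcomm hf
    · apply hf
      rw [map_zero]
      exact (Representation.map_asAlgebraHom (ρ := V.ρ.comp A.subtype) (σ := W.ρ.comp A.subtype)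
        f.hom.toLinearMap hcomm z v).trans (hW.2 z hz _)

instance : (isInMAKilledBy A I).IsClosedUnderQuotients where
  prop_of_epi {V W} f _ hV := by
    have hf : Function.Surjective f.hom := (Rep.epi_iff_surjective f).1 inferInstance
    have hcomm : ∀ (a : A) (v : V), f.hom.toLinearMap (V.ρ a v) = W.ρ a (f.hom.toLinearMap v) :=
      fun a v => Rep.hom_comm_apply f a v
    refine ⟨⟨fun w => ?_, ?_⟩, fun z hz w => ?_⟩
    · obtain ⟨v, rfl⟩ := hf w
      obtain ⟨K, h1, h2, h3⟩ := hV.1.1 v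
      exact ⟨K, h1, h2, fun k hk => by rw [← Rep.hom_comm_apply, h3 k hk]⟩
    · have : Representation.IsSemisimpleRepresentation
        (V.ρ.comp A.subtype : Representation F A V) := hV.1.2
      exact Representation.IsSemisimpleRepresentation.of_surjective
        (ρ := V.ρ.comp A.subtype) (σ := W.ρ.comp A.subtype) f.hom.toLinearMap hcomm hf
    · obtain ⟨v, rfl⟩ := hf w
      refine (Representation.map_asAlgebraHom (ρ := V.ρ.comp A.subtype) (σ := W.ρ.comp A.subtype)
        f.hom.toLinearMap hcomm z v).symm.trans ?_
      rw [hV.2 z hz, map_zero]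

theorem isInMAKilledBy_prod [IsTopologicalGroup G] {V W : Rep.{u} F G} (hV : isInMAKilledBy A I V)
    (hW : isInMAKilledBy A I W) : isInMAKilledBy A I (Rep.of (V.ρ.prod W.ρ)) := by
  refine ⟨⟨fun v => ?_, ?_⟩, fun z hz v => ?_⟩
  · obtain ⟨K, h1, h2, h3⟩ := hV.1.1 v.1
    obtain ⟨K', h1', h2', h3'⟩ := hW.1.1 v.2
    exact ⟨K ⊓ K', h1.inter_right (K'.isClosed_of_isOpen h2'), h2.inter h2',
      fun k hk => Prod.ext (h3 k hk.1) (h3' k hk.2)⟩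
  · exact Representation.IsSemisimpleRepresentation.prod (ρ := V.ρ.comp A.subtype)
      (σ := W.ρ.comp A.subtype) hV.1.2 hW.1.2
  · refine Prod.ext ?_ ?_
    · exact (Representation.map_asAlgebraHom (ρ := (V.ρ.prod W.ρ).comp A.subtype)
        (σ := V.ρ.comp A.subtype) (LinearMap.fst F V W) (fun _ _ => rfl) z v).trans
        (hV.2 z hz _)
    · exact (Representation.map_asAlgebraHom (ρ := (V.ρ.prod W.ρ).comp A.subtype)
        (σ := W.ρ.comp A.subtype) (LinearMap.snd F V W) (fun _ _ => rfl) z v).trans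
        (hW.2 z hz _)

instance [IsTopologicalGroup G] [LocallyCompactSpace G] [TotallyDisconnectedSpace G] :
    (isInMAKilledBy A I).ContainsZero where
  exists_zero := ⟨Rep.trivial F G PUnit, (Rep.isZero_iff _ _ _).2 inferInstance,
    isInMA_of_subsingleton F A _, fun _ _ _ => rfl⟩

instance [IsTopologicalGroup G] [LocallyCompactSpace G] [TotallyDisconnectedSpace G] :
    (isInMAKilledBy A I).IsClosedUnderFiniteProducts := by
  have : (isInMAKilledBy A I).IsClosedUnderBinaryProducts := by
    constructor
    rintro B ⟨h⟩
    let V := h.diag.obj ⟨.left⟩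
    let W := h.diag.obj ⟨.right⟩
    let f : B ⟶ V := h.π.app ⟨.left⟩
    let g : B ⟶ W := h.π.app ⟨.right⟩
    -- A categorical product embeds in the concrete product of the two factors, and closure under
    -- subobjects applies.
    let m : B ⟶ Rep.of (V.ρ.prod W.ρ) := Rep.ofHom (f.hom.prod g.hom)
    have : Mono m := by
      refine ⟨fun {Z} a b hab => h.isLimit.hom_ext ?_⟩
      have hab' : ∀ z, m.hom (a.hom z) = m.hom (b.hom z) := fun z =>
        congrArg (fun c : Z ⟶ _ => c.hom z) hab
      rintro ⟨_ | _⟩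
      · exact Rep.hom_ext (Representation.IntertwiningMap.ext (LinearMap.ext fun z =>
          congrArg Prod.fst (hab' z)))
      · exact Rep.hom_ext (Representation.IntertwiningMap.ext (LinearMap.ext fun z =>
          congrArg Prod.snd (hab' z)))
    exact (isInMAKilledBy A I).prop_of_mono m
      (isInMAKilledBy_prod A I (h.prop_diag_obj _) (h.prop_diag_obj _))
  exact .mk'

end Subcategory

end SmoothRep

end

/-! ### Signed permutation representations and their projectivity -/

noncomputable section

/-- A `G`-set fibred over `B`, with all fibres identified with `T`, has an equivariant section with
values in a given invariant subset if each fibre contains a point of that subset fixed by the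
stabilizer of the base point. -/
theorem MulAction.exists_equivariant_section {G B T : Type*} [Group G] [MulAction G B]
    (act : G → B → T → T) (hact : ∀ g h b t, act (g * h) b t = act g (h • b) (act h b t))
    (S : B → Set T) (hS : ∀ g b, ∀ t ∈ S b, act g b t ∈ S (g • b))
    (h : ∀ b, ∃ t ∈ S b, ∀ g : G, g • b = b → act g b t = t) :
    ∃ σ : B → T, (∀ b, σ b ∈ S b) ∧ ∀ g b, σ (g • b) = act g b (σ b) := by
  choose t htS hts using h
  let r : B → B := fun b => (Quotient.mk (MulAction.orbitRel G B) b).out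
  have hr : ∀ b, ∃ g : G, g • r b = b := fun b =>
    MulAction.mem_orbit_iff.1 (MulAction.orbitRel_apply.1
      ((MulAction.orbitRel G B).symm (Quotient.mk_out (s := MulAction.orbitRel G B) b)))
  choose γ hγ using hr
  have hrg : ∀ (g : G) b, r (g • b) = r b := fun g b =>
    congrArg Quotient.out (Quotient.sound (s := MulAction.orbitRel G B)
      (MulAction.orbitRel_apply.2 (MulAction.mem_orbit b g)))
  refine ⟨fun b => act (γ b) (r b) (t (r b)), fun b => ?_, fun g b => ?_⟩
  · have := hS (γ b) _ _ (htS (r b))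
    rwa [hγ] at this
  -- `γ b` carries the chosen point `r b` of the orbit to `b`. The elements `γ (g • b)` and `g * γ
  -- b` differ by an element of the stabilizer of `r b`, which fixes `t (r b)`, so the choice of `γ`
  -- does not matter.
  · have hfix : ((g * γ b)⁻¹ * γ (g • b)) • r b = r b := by
      rw [mul_smul, inv_smul_eq_iff, mul_smul, hγ b]
      have := hγ (g • b)
      rwa [hrg] at this
    have h1 := hact (g * γ b) ((g * γ b)⁻¹ * γ (g • b)) (r b) (t (r b))
    rw [mul_inv_cancel_left, hfix, hts _ _ hfix, hact, hγ b] at h1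
    simp only [hrg]
    exact h1

namespace SmoothRep

section SignedPermutation

variable {G : Type u} [Group G] {B : Type u} [MulAction G B]

/-- A continuous action on a set together with a continuous sign cocycle, both trivial on `A`. -/
structure IsSignCocycle [TopologicalSpace G] (A : Subgroup G) (s : G → B → ℤˣ) : Prop where
  map_mul : ∀ g h b, s (g * h) b = s g (h • b) * s h b
  smul_of_mem : ∀ a ∈ A, ∀ b : B, a • b = b
  map_of_mem : ∀ a ∈ A, ∀ b : B, s a b = 1
  eventually : ∀ b : B, ∀ᶠ g in 𝓝 (1 : G), g • b = b ∧ s g b = 1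

variable [TopologicalSpace G] {A : Subgroup G} {s : G → B → ℤˣ}

namespace IsSignCocycle

theorem map_one (hs : IsSignCocycle A s) (b : B) : s 1 b = 1 := hs.map_of_mem 1 A.one_mem b

variable {F : Type u} [Field F] {V : Type u} [AddCommGroup V] [Module F V]

/-- The sum of copies of a representation that are permuted up to sign. -/
def rep (hs : IsSignCocycle A s) (ρ : Representation F G V) : Representation F G (B →₀ V) where
  toFun g := Finsupp.lsum F fun b => Finsupp.lsingle (g • b) ∘ₗ ((s g b : ℤ) • ρ g)
  map_one' := by
    ext b v : 2
    simp [hs.map_one]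
  map_mul' g h := by
    ext b v : 2
    simp [hs.map_mul, SemigroupAction.mul_smul]

theorem rep_single (hs : IsSignCocycle A s) (ρ : Representation F G V) (g : G) (b : B) (v : V) :
    hs.rep ρ g (Finsupp.single b v) = Finsupp.single (g • b) ((s g b : ℤ) • ρ g v) := by
  simp [rep]

theorem rep_single_of_mem (hs : IsSignCocycle A s) (ρ : Representation F G V) {a : G} (ha : a ∈ A)
    (b : B) (v : V) : hs.rep ρ a (Finsupp.single b v) = Finsupp.single b (ρ a v) := by
  rw [rep_single, hs.smul_of_mem a ha, hs.map_of_mem a ha, Units.val_one, one_smul]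

variable [IsTopologicalGroup G]

theorem isSmooth_rep (hs : IsSignCocycle A s) [LocallyCompactSpace G] [TotallyDisconnectedSpace G]
    {V : Rep.{u} F G} (hV : IsSmooth F G V) : IsSmooth F G (Rep.of (hs.rep V.ρ)) := by
  intro y
  change ∃ K : Subgroup G, _ ∧ _ ∧ ∀ k ∈ K, hs.rep V.ρ k y = y
  induction y using Finsupp.induction_linear with
  | zero =>
    obtain ⟨K, h1, h2⟩ := exists_compact_open_subgroup G
    exact ⟨K, h1, h2, fun k _ => _root_.map_zero _⟩
  | add x y hx hy =>
    obtain ⟨K, h1, h2, h3⟩ := hx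
    obtain ⟨K', h1', h2', h3'⟩ := hy
    exact ⟨K ⊓ K', h1.inter_right (K'.isClosed_of_isOpen h2'), h2.inter h2', fun k hk => by
      rw [_root_.map_add, h3 k hk.1, h3' k hk.2]⟩
  | single b v =>
    obtain ⟨K, h1, h2, h3⟩ := hV v
    -- The cocycle identity makes the elements fixing `b` with sign `1` a subgroup, which is open by
    -- `eventually`.
    let N : Subgroup G :=
      { carrier := {g | g • b = b ∧ s g b = 1}
        mul_mem' := by
          rintro g h ⟨hg, hg'⟩ ⟨hh, hh'⟩
          exact ⟨by rw [mul_smul, hh, hg], by rw [hs.map_mul, hh, hg', hh', one_mul]⟩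
        one_mem' := ⟨one_smul _ _, hs.map_one b⟩
        inv_mem' := by
          rintro g ⟨hg, hg'⟩
          have hg1 : g⁻¹ • b = b := by rw [inv_smul_eq_iff, hg]
          refine ⟨hg1, ?_⟩
          have := hs.map_mul g g⁻¹ b
          rwa [hg1, hg', one_mul, mul_inv_cancel, hs.map_one, eq_comm] at this }
    have hN : IsOpen (N : Set G) := N.isOpen_of_mem_nhds (g := 1) (hs.eventually b)
    refine ⟨K ⊓ N, h1.inter_right (N.isClosed_of_isOpen hN), h2.inter hN, fun k hk => ?_⟩
    obtain ⟨hk1, hk2⟩ : k • b = b ∧ s k b = 1 := hk.2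
    rw [rep_single, hk1, hk2, h3 k hk.1, Units.val_one, one_smul]

/-- `A` fixes every index with sign `1`, so over `A` this is a direct sum of copies of `V`. -/
theorem isInMAKilledBy_rep (hs : IsSignCocycle A s) [LocallyCompactSpace G]
    [TotallyDisconnectedSpace G] {I : Set (MonoidAlgebra F A)}
    {V : Rep.{u} F G} (hV : isInMAKilledBy A I V) :
    isInMAKilledBy A I (Rep.of (hs.rep V.ρ)) := by
  have hcomm : ∀ (b : B) (a : A) (v : V), Finsupp.lsingle (R := F) b (V.ρ a v) =
      hs.rep V.ρ a (Finsupp.lsingle (R := F) b v) := fun b a v =>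
    (hs.rep_single_of_mem V.ρ a.2 b v).symm
  refine ⟨⟨hs.isSmooth_rep hV.1.1, ?_⟩, fun z hz y => ?_⟩
  · have : Representation.IsSemisimpleRepresentation
      (V.ρ.comp A.subtype : Representation F A V) := hV.1.2
    refine Representation.IsSemisimpleRepresentation.of_iSup_range (ι := B)
      (ρ := V.ρ.comp A.subtype) (σ := (hs.rep V.ρ).comp A.subtype)
      (fun b => Finsupp.lsingle b) hcomm fun w => ?_
    rw [Finsupp.iSup_lsingle_range]
    exact Submodule.mem_top
  · change B →₀ V at y
    induction y using Finsupp.induction_linear with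
    | zero => exact _root_.map_zero _
    | add x y hx hy => exact (_root_.map_add _ x y).trans (by rw [hx, hy, add_zero])
    | single b v =>
      refine (Representation.map_asAlgebraHom (ρ := V.ρ.comp A.subtype)
        (σ := (hs.rep V.ρ).comp A.subtype) (Finsupp.lsingle b) (hcomm b) z v).symm.trans ?_
      rw [hV.2 z hz, _root_.map_zero]

section Lift

variable {V W W' : Rep.{u} F G}

/-- The twisted conjugation action on linear maps. -/
def conj (V W : Rep.{u} F G) (s : G → B → ℤˣ) (g : G) (b : B) (φ : V →ₗ[F] W) : V →ₗ[F] W :=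
  (s g b : ℤ) • W.ρ g ∘ₗ φ ∘ₗ V.ρ g⁻¹

theorem conj_apply (g : G) (b : B) (φ : V →ₗ[F] W) (v : V) :
    conj V W s g b φ v = (s g b : ℤ) • W.ρ g (φ (V.ρ g⁻¹ v)) :=
  rfl

theorem conj_mul (hs : IsSignCocycle A s) (g h : G) (b : B) (φ : V →ₗ[F] W) :
    conj V W s (g * h) b φ = conj V W s g (h • b) (conj V W s h b φ) := by
  ext v
  simp only [conj_apply, hs.map_mul, Units.val_mul, mul_inv_rev, _root_.map_mul,
    Module.End.mul_apply, map_zsmul, smul_smul]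

theorem eventually_rho_eq (hV : IsSmooth F G V) (v : V) : ∀ᶠ g in 𝓝 (1 : G), V.ρ g v = v := by
  obtain ⟨K, -, h2, h3⟩ := hV v
  filter_upwards [h2.mem_nhds K.one_mem] with g hg using h3 g hg

/-- Write `g' = g * u` with `u` near `1`: then `u` fixes `b` with sign `1` and fixes both `g⁻¹ v`
and `φ (g⁻¹ v)`. The neighbourhood depends on `v`, so the conjugates are locally constant only
pointwise. -/
theorem eventually_conj_eq (hs : IsSignCocycle A s) (hV : IsSmooth F G V) (hW : IsSmooth F G W)
    (b : B) (φ : V →ₗ[F] W) (v : V) (g : G) :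
    ∀ᶠ g' in 𝓝 g, conj V W s g' b φ v = conj V W s g b φ v := by
  have ht : Filter.Tendsto (fun g' => g⁻¹ * g') (𝓝 g) (𝓝 1) := by
    have : Continuous fun g' => g⁻¹ * g' := by fun_prop
    simpa using this.tendsto g
  filter_upwards [ht.eventually (hs.eventually b),
    ht.eventually (eventually_rho_eq hV (V.ρ g⁻¹ v)),
    ht.eventually (eventually_rho_eq hW (φ (V.ρ g⁻¹ v)))] with g' h1 h2 h3
  obtain ⟨u, rfl⟩ : ∃ u, g' = g * u := ⟨g⁻¹ * g', by simp⟩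
  simp only [inv_mul_cancel_left] at h1 h2 h3
  have h2' : V.ρ (u⁻¹ * g⁻¹) v = V.ρ g⁻¹ v := by
    rw [_root_.map_mul, Module.End.mul_apply]
    nth_rewrite 1 [← h2]
    rw [← Module.End.mul_apply, ← _root_.map_mul, inv_mul_cancel, _root_.map_one]
    rfl
  rw [conj_apply, conj_apply, mul_inv_rev, h2', _root_.map_mul, Module.End.mul_apply, h3,
    hs.map_mul, h1.1, h1.2, mul_one]

/-- The conjugates of an `A`-equivariant map by the elements of a stabilizer, as a function on the
stabilizer modulo `A`. -/
def orbitFunction (hs : IsSignCocycle A s) (hV : IsSmooth F G V) (hW : IsSmooth F G W)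
    (b : B) (φ : V →ₗ[F] W) (hφ : ∀ a ∈ A, ∀ v, φ (V.ρ a v) = W.ρ a (φ v)) (v : V) :
    LocallyConstant (MulAction.stabilizer G b ⧸ A.subgroupOf (MulAction.stabilizer G b)) W where
  toFun := Quotient.lift (fun h : MulAction.stabilizer G b => conj V W s h b φ v) (by
    intro g h hgh
    obtain ⟨a, ha, rfl⟩ : ∃ a : MulAction.stabilizer G b, (a : G) ∈ A ∧ h = g * a :=
      ⟨g⁻¹ * h, Subgroup.mem_subgroupOf.1 (QuotientGroup.leftRel_apply.1 hgh), by simp⟩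
    change conj V W s g b φ v = conj V W s (g * a) b φ v
    rw [hs.conj_mul, hs.smul_of_mem _ ha]
    refine congrArg (fun φ => conj V W s g b φ v) (LinearMap.ext fun w => ?_)
    rw [conj_apply, hs.map_of_mem _ ha, ← hφ _ ha, Units.val_one, one_smul,
      ← Module.End.mul_apply, ← _root_.map_mul, mul_inv_cancel, _root_.map_one]
    rfl)
  isLocallyConstant := by
    have h0 : IsLocallyConstant fun h : MulAction.stabilizer G b => conj V W s h b φ v :=
      (IsLocallyConstant.iff_eventually_eq _).2 fun h =>
        continuous_subtype_val.continuousAt.eventually (hs.eventually_conj_eq hV hW b φ v h)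
    intro T
    exact (QuotientGroup.isQuotientMap_mk
      (N := A.subgroupOf (MulAction.stabilizer G b))).isOpen_preimage.1 (h0 T)

/-- `ψ` is the average of the conjugates of `φ` over `G_b / A`, taken vector by vector. Averaging is
linear; it does not change `e ∘ φ`, which is already invariant; and invariance under left
translations makes `ψ` fixed. -/
theorem exists_fixed_lift (hs : IsSignCocycle A s) (hA : A ≤ Subgroup.center G) (b : B)
    (hc : IsCompactModulo A (MulAction.stabilizer G b))
    (ho : IsOrdinaryModulo F hA (MulAction.stabilizer G b))
    (hV : IsSmooth F G V) (hW : IsSmooth F G W)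
    (φ : V →ₗ[F] W) (hφ : ∀ a ∈ A, ∀ v, φ (V.ρ a v) = W.ρ a (φ v))
    (e : W →ₗ[F] W') (he : ∀ g w, e (W.ρ g w) = W'.ρ g (e w))
    (heφ : ∀ g : G, g • b = b → conj V W' s g b (e ∘ₗ φ) = e ∘ₗ φ) :
    ∃ ψ : V →ₗ[F] W, e ∘ₗ ψ = e ∘ₗ φ ∧ ∀ g : G, g • b = b → conj V W s g b ψ = ψ := by
  have hn := normal_subgroupOf_of_le_center hA (MulAction.stabilizer G b)
  have hc' : CompactSpace
    (MulAction.stabilizer G b ⧸ A.subgroupOf (MulAction.stabilizer G b)) := hc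
  have ho' : IsOrdinary F
    (MulAction.stabilizer G b ⧸ A.subgroupOf (MulAction.stabilizer G b)) := ho
  let c := hs.orbitFunction hV hW b φ hφ
  have hsmul : ∀ (r : F) v, c (r • v) = (c v).map (r • LinearMap.id : W →ₗ[F] W) := by
    intro r v
    ext ⟨h⟩
    exact _root_.map_smul (conj V W s h b φ) r v
  refine ⟨⟨⟨fun v => (c v).average F, fun v w => ?_⟩, fun r v => ?_⟩, ?_, fun g hg => ?_⟩
  · rw [← LocallyConstant.average_add ho']
    congr 1
    ext ⟨h⟩
    exact _root_.map_add (conj V W s h b φ) v w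
  · change (c (r • v)).average F = _
    rw [hsmul, LocallyConstant.average_map ho']
    rfl
  · ext v
    change e ((c v).average F) = e (φ v)
    rw [← LocallyConstant.average_map ho']
    refine Eq.trans (congrArg (LocallyConstant.average F) ?_)
      (LocallyConstant.average_const ho' (e (φ v)))
    ext ⟨h⟩
    change e (conj V W s h b φ v) = e (φ v)
    refine Eq.trans ?_ (LinearMap.congr_fun (heφ h h.2) v)
    rw [conj_apply, conj_apply, map_zsmul, he]
    rfl
  · ext v
    rw [conj_apply]
    change ((s g b : ℤ) • W.ρ g) ((c (V.ρ g⁻¹ v)).average F) = (c v).average F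
    rw [← LocallyConstant.average_map ho',
      ← LocallyConstant.average_leftTranslate ho'
        (QuotientGroup.mk (⟨g, hg⟩ : MulAction.stabilizer G b)) (c v)]
    congr 1
    ext ⟨h⟩
    change conj V W s g b (conj V W s h b φ) v = conj V W s (g * h) b φ v
    rw [hs.conj_mul, MulAction.mem_stabilizer_iff.1 h.2]

/-- A sum of copies of `V` permuted up to sign, with ordinary stabilizers, is projective among the
smooth representations that are semisimple over `A`. -/
theorem exists_lift (hs : IsSignCocycle A s) (hA : A ≤ Subgroup.center G)
    (hc : ∀ b : B, IsCompactModulo A (MulAction.stabilizer G b))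
    (ho : ∀ b : B, IsOrdinaryModulo F hA (MulAction.stabilizer G b))
    (hV : IsSmooth F G V) (hW : isInMA F A W) (e : W ⟶ W') (he : Function.Surjective e.hom)
    (f : Rep.of (hs.rep V.ρ) ⟶ W') : ∃ f' : Rep.of (hs.rep V.ρ) ⟶ W, f' ≫ e = f := by
  have : Representation.IsSemisimpleRepresentation
    (W.ρ.comp A.subtype : Representation F A W) := hW.2
  -- The section `t` is equivariant only for `A`; averaging and transport along orbits will supply
  -- equivariance for `G`.
  obtain ⟨t, ht, hte⟩ := Representation.IsSemisimpleRepresentation.exists_section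
    (ρ := W.ρ.comp A.subtype) (σ := W'.ρ.comp A.subtype) e.hom.toLinearMap
    (fun a w => Rep.hom_comm_apply e a w) he
  let fb : B → V →ₗ[F] W' := fun b => f.hom.toLinearMap ∘ₗ Finsupp.lsingle b
  have hfb : ∀ g b v, fb (g • b) ((s g b : ℤ) • V.ρ g v) = W'.ρ g (fb b v) := by
    intro g b v
    refine Eq.trans ?_ (Rep.hom_comm_apply f g (Finsupp.single b v))
    exact congrArg f.hom (hs.rep_single V.ρ g b v).symm
  have hfconj : ∀ g b, conj V W' s g b (fb b) = fb (g • b) := by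
    intro g b
    ext v
    rw [conj_apply, ← hfb, map_zsmul, smul_smul, ← Units.val_mul, Int.units_mul_self,
      Units.val_one, one_smul, ← Module.End.mul_apply, ← _root_.map_mul, mul_inv_cancel,
      _root_.map_one]
    rfl
  have heconj : ∀ g b (φ : V →ₗ[F] W),
      e.hom.toLinearMap ∘ₗ conj V W s g b φ = conj V W' s g b (e.hom.toLinearMap ∘ₗ φ) := by
    intro g b φ
    ext v
    simp only [LinearMap.comp_apply, conj_apply, map_zsmul]
    exact congrArg _ (Rep.hom_comm_apply e g _)
  -- An equivariant choice of lifts of the components `fb b` is the same as an equivariant lift of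
  -- `f`; the twist in `conj` matches the sign in `rep`, since signs square to `1`.
  obtain ⟨σ, hσ, hσg⟩ := MulAction.exists_equivariant_section (G := G) (B := B)
    (conj V W s) hs.conj_mul (fun b => {φ | e.hom.toLinearMap ∘ₗ φ = fb b})
    (fun g b φ hφ => by
      change e.hom.toLinearMap ∘ₗ conj V W s g b φ = fb (g • b)
      rw [heconj, ← hfconj]
      exact congrArg _ hφ)
    (fun b => by
      have h0 : e.hom.toLinearMap ∘ₗ t ∘ₗ fb b = fb b := LinearMap.ext fun v => hte _
      obtain ⟨ψ, h1, h2⟩ := hs.exists_fixed_lift hA b (hc b) (ho b) hV hW.1 (t ∘ₗ fb b)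
        (fun a ha v => by
          have h3 := hfb a b v
          rw [hs.smul_of_mem a ha, hs.map_of_mem a ha, Units.val_one, one_smul] at h3
          refine Eq.trans ?_ (ht ⟨a, ha⟩ _)
          exact congrArg t h3)
        e.hom.toLinearMap (fun g w => Rep.hom_comm_apply e g w)
        (fun g hg => by rw [h0, hfconj, hg])
      exact ⟨ψ, h1.trans h0, h2⟩)
  refine ⟨Rep.ofHom ⟨Finsupp.lsum F σ, fun g => ?_⟩, ?_⟩
  · ext b v : 2
    simp only [LinearMap.comp_apply, Finsupp.lsingle_apply, hs.rep_single, Finsupp.lsum_single,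
      hσg, conj_apply, map_zsmul, smul_smul, ← Units.val_mul, Int.units_mul_self, Units.val_one,
      one_smul]
    rw [← Module.End.mul_apply, ← _root_.map_mul, inv_mul_cancel, _root_.map_one]
    rfl
  · refine Rep.hom_ext (Representation.IntertwiningMap.ext ?_)
    ext b v : 2
    refine Eq.trans (congrArg e.hom ?_) (LinearMap.congr_fun (hσ b) v)
    exact Finsupp.lsum_single F σ b v

end Lift

end IsSignCocycle

end SignedPermutation

end SmoothRep

end

/-! ### Projective resolutions from exact sequences of representations -/

noncomputable section

namespace SmoothRep

theorem hasProjectiveResolutionLE_of_exact {C : Type*} [Category C] [Abelian C] {Z : C}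
    (X : ℕ → C) [∀ k, Projective (X k)] (d : ∀ k, X (k + 1) ⟶ X k) (ε : X 0 ⟶ Z)
    (hd : ∀ k, d (k + 1) ≫ d k = 0) (hε : d 0 ≫ ε = 0) [Epi ε]
    (hexact : ∀ k, (ShortComplex.mk _ _ (hd k)).Exact) (hexact₀ : (ShortComplex.mk _ _ hε).Exact)
    (n : ℕ) (hX : ∀ i, n < i → IsZero (X i)) : HasProjectiveResolutionLE Z n := by
  let K : ChainComplex C ℕ := ChainComplex.of X d hd
  have hKd : ∀ k, K.d (k + 1) k = d k := fun k => ChainComplex.of_d X d k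
  have hw : K.d 1 0 ≫ (ε : K.X 0 ⟶ Z) = 0 := by
    rw [hKd 0]
    exact hε
  refine ⟨{ complex := K
            projective := fun k => inferInstanceAs (Projective (X k))
            π := (ChainComplex.toSingle₀Equiv _ _).symm ⟨ε, hw⟩
            quasiIso := ⟨fun k => ?_⟩ }, hX⟩
  cases k with
  | zero =>
    rw [ChainComplex.quasiIsoAt₀_iff, ShortComplex.quasiIso_iff_of_zeros']
    · refine (ShortComplex.exact_and_epi_g_iff_of_iso ?_).2 ⟨hexact₀, inferInstanceAs (Epi ε)⟩
      exact ShortComplex.isoMk (Iso.refl _) (Iso.refl _) (Iso.refl _)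
        (by
          refine (Category.id_comp _).trans ((hKd 0).symm.trans (Category.comp_id _).symm))
        (by
          refine (Category.id_comp _).trans (Eq.trans ?_ (Category.comp_id _).symm)
          exact (ChainComplex.toSingle₀Equiv_symm_apply_f_zero (C := K) (X := Z) ε hw).symm)
    all_goals rfl
  | succ k =>
    rw [quasiIsoAt_iff_exactAt' _ _ (ChainComplex.exactAt_succ_single_obj _ _),
      HomologicalComplex.exactAt_iff' _ (k + 1 + 1) (k + 1) k (by simp) (by simp)]
    refine ShortComplex.exact_of_iso ?_ (hexact k)
    exact ShortComplex.isoMk (Iso.refl _) (Iso.refl _) (Iso.refl _)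
      ((Category.id_comp _).trans ((hKd (k + 1)).trans (Category.comp_id _).symm))
      ((Category.id_comp _).trans ((hKd k).trans (Category.comp_id _).symm))

section

variable {F : Type u} [Field F] {G : Type u} [Group G]

theorem rep_exact_of_forall (S : ShortComplex (Rep.{u} F G))
    (h : ∀ y : S.X₂, S.g.hom y = 0 → ∃ x : S.X₁, S.f.hom x = y) : S.Exact := by
  rw [← ShortComplex.exact_map_iff_of_faithful S (forget₂ (Rep.{u} F G) (ModuleCat.{u} F)),
    ShortComplex.moduleCat_exact_iff]
  exact h

theorem fullSubcategory_exact_of_forall {P : ObjectProperty (Rep.{u} F G)} [P.ContainsZero]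
    [P.IsClosedUnderKernels] [P.IsClosedUnderCokernels] [P.IsClosedUnderFiniteProducts]
    (S : ShortComplex P.FullSubcategory)
    (h : ∀ y : S.X₂.obj, S.g.hom.hom y = 0 → ∃ x : S.X₁.obj, S.f.hom.hom x = y) : S.Exact := by
  have : P.ι.PreservesHomology := 
    { preservesKernels := fun {X Y} f => P.preservesKernels_ι f
      preservesCokernels := fun {X Y} f => P.preservesCokernels_ι f }
  rw [← ShortComplex.exact_map_iff_of_faithful S P.ι]
  exact rep_exact_of_forall _ h

theorem hasProjectiveResolutionLE_of_forall {P : ObjectProperty (Rep.{u} F G)} [P.ContainsZero]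
    [P.IsClosedUnderKernels] [P.IsClosedUnderCokernels] [P.IsClosedUnderFiniteProducts]
    {V : P.FullSubcategory} (X : ℕ → Rep.{u} F G) (hX : ∀ k, P (X k))
    (hlift : ∀ k (W W' : Rep.{u} F G) (e : W ⟶ W'), P W → Function.Surjective e.hom →
      ∀ f : X k ⟶ W', ∃ f', f' ≫ e = f)
    (d : ∀ k, X (k + 1) ⟶ X k) (ε : X 0 ⟶ V.obj)
    (hd : ∀ k x, (d k).hom ((d (k + 1)).hom x) = 0) (hε : ∀ x, ε.hom ((d 0).hom x) = 0)
    (hsurj : Function.Surjective ε.hom)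
    (hexact : ∀ k x, (d k).hom x = 0 → ∃ y, (d (k + 1)).hom y = x)
    (hexact₀ : ∀ x, ε.hom x = 0 → ∃ y, (d 0).hom y = x)
    (n : ℕ) (hz : ∀ i, n < i → Subsingleton (X i)) : HasProjectiveResolutionLE V n := by
  let Y : ℕ → P.FullSubcategory := fun k => ⟨X k, hX k⟩
  -- Epimorphisms of the subcategory are thus surjective maps, and `hlift` yields projectivity.
  have := P.preservesEpimorphisms_ι_of_isNormalMonoCategory
  have : ∀ k, Projective (Y k) := fun k => ⟨fun {W W'} f e _ => by
    obtain ⟨f', hf'⟩ := hlift k W.obj W'.obj e.hom W.property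
      ((Rep.epi_iff_surjective _).1 (inferInstanceAs (Epi (P.ι.map e)))) f.hom
    exact ⟨P.homMk f', P.ι.map_injective hf'⟩⟩
  have : Epi (P.homMk ε : Y 0 ⟶ V) :=
    P.ι.epi_of_epi_map ((Rep.epi_iff_surjective ε).2 hsurj)
  refine hasProjectiveResolutionLE_of_exact Y (fun k => P.homMk (d k)) (P.homMk ε)
    (fun k => P.ι.map_injective ?_) (P.ι.map_injective ?_)
    (fun k => fullSubcategory_exact_of_forall _ (hexact k))
    (fullSubcategory_exact_of_forall _ hexact₀) n fun i hi => ?_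
  · exact Rep.hom_ext (Representation.IntertwiningMap.ext (LinearMap.ext (hd k)))
  · exact Rep.hom_ext (Representation.IntertwiningMap.ext (LinearMap.ext hε))
  · exact IsZero.of_full_of_faithful_of_isZero P.ι _ ((Rep.isZero_iff _ _ _).2 (hz i hi))

end

end SmoothRep

end

/-! ### Signs of crossed actions and the action on chains -/

noncomputable section

/-- The sign of the permutation induced on complements of a point and of its image. -/
theorem Equiv.Perm.sign_of_succAbove {n : ℕ} (φ : Equiv.Perm (Fin (n + 2)))
    (ψ : Equiv.Perm (Fin (n + 1))) (i : Fin (n + 2))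
    (h : ∀ j, (φ i).succAbove (ψ j) = φ (i.succAbove j)) :
    (-1) ^ (i : ℕ) * ψ.sign = (-1) ^ (φ i : ℕ) * φ.sign := by
  -- The cycles `i.cycleRange` and `(φ i).cycleRange`, of signs `(-1) ^ i` and `(-1) ^ φ i`, move
  -- `i` and `φ i` to the front; what remains of `φ` is `ψ` extended by a fixed point.
  have key : (φ i).cycleRange * φ = Equiv.Perm.decomposeFin.symm (0, ψ) * i.cycleRange := by
    ext1 x
    refine Fin.succAboveCases i ?_ (fun j => ?_) x
    · simp [Fin.cycleRange_self]
    · simp [← h, Fin.cycleRange_succAbove]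
  have := congrArg Equiv.Perm.sign key
  simp only [Equiv.Perm.sign_mul, Fin.sign_cycleRange, Equiv.Perm.decomposeFin.symm_sign,
    if_true, one_mul] at this
  rw [this, mul_comm]

namespace SSet

/-- If `σ_i x = σ_j x` with `i < j`, applying `d_i` gives `x = σ_{j-1} d_i x`, which is degenerate.
-/
theorem σ_injective_of_mem_nonDegenerate (X : SSet.{u}) {k : ℕ} {x : X _⦋k⦌}
    (hx : x ∈ X.nonDegenerate k) : Function.Injective fun i : Fin (k + 1) => X.σ i x := by
  have key : ∀ i j : Fin (k + 1), i < j → X.σ i x ≠ X.σ j x := by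
    intro i j hij h
    cases k with
    | zero => omega
    | succ k =>
      obtain ⟨j, rfl⟩ := Fin.exists_succ_eq.2 (Fin.ne_zero_of_lt hij)
      have h1 : X.δ i.castSucc (X.σ i x) = x :=
        ConcreteCategory.congr_hom (SimplicialObject.δ_comp_σ_self X (i := i)) x
      have h2 : X.δ i.castSucc (X.σ j.succ x) = X.σ j (X.δ i x) :=
        ConcreteCategory.congr_hom (SimplicialObject.δ_comp_σ_of_le X (i := i) (j := j)
          (Fin.le_castSucc_iff.2 hij)) x
      rw [h, h2] at h1
      rw [← h1] at hx
      exact (mem_degenerate_iff_notMem_nonDegenerate _ _).1 (σ_mem_degenerate _ _ _) hx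
  intro i j h
  by_contra hne
  rcases lt_or_gt_of_ne hne with hlt | hlt
  · exact key i j hlt h
  · exact key j i hlt h.symm

end SSet

namespace SmoothRep

section

variable {G : Type u} [Group G] {X : SSet.{u}} [∀ k, MulAction G (X _⦋k⦌)]
  {R : ∀ {k : ℕ}, G → X _⦋k⦌ → Equiv.Perm (Fin (k + 1))}

namespace IsCrossedAction

theorem smul_mem_degenerate (hR : IsCrossedAction R) {k : ℕ} (g : G) {x : X _⦋k⦌}
    (hx : x ∈ X.degenerate k) : g • x ∈ X.degenerate k := by
  cases k with
  | zero => simp at hx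
  | succ k =>
    rw [SSet.degenerate_eq_iUnion_range_σ, Set.mem_iUnion] at hx
    obtain ⟨i, y, rfl⟩ := hx
    rw [hR.smul_σ]
    exact X.σ_mem_degenerate _ _

theorem smul_mem_nonDegenerate_iff (hR : IsCrossedAction R) {k : ℕ} (g : G) {x : X _⦋k⦌} :
    g • x ∈ X.nonDegenerate k ↔ x ∈ X.nonDegenerate k := by
  rw [← not_iff_not, ← SSet.mem_degenerate_iff_notMem_nonDegenerate,
    ← SSet.mem_degenerate_iff_notMem_nonDegenerate]
  refine ⟨fun h => ?_, hR.smul_mem_degenerate g⟩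
  have := hR.smul_mem_degenerate g⁻¹ h
  rwa [inv_smul_smul] at this

/-- The action on non-degenerate simplices. -/
abbrev nonDegenerateAction (hR : IsCrossedAction R) (k : ℕ) :
    MulAction G (X.nonDegenerate k) where
  smul g x := ⟨g • x.1, (hR.smul_mem_nonDegenerate_iff g).2 x.2⟩
  one_smul x := Subtype.ext (one_smul G x.1)
  mul_smul g h x := Subtype.ext (mul_smul g h x.1)

/-- From `g • σ_i x = σ_{R g x i} x`, the permutation can be read off the action on degenerate
simplices. Hence continuity of `R`, and its triviality on `A`, need not be assumed. -/
theorem eq_one_of_smul_σ (hR : IsCrossedAction R) {k : ℕ} {x : X _⦋k⦌}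
    (hx : x ∈ X.nonDegenerate k) {g : G} (hg : g • x = x) (h : ∀ i, g • X.σ i x = X.σ i x) :
    R g x = 1 := by
  ext1 i
  have := hR.smul_σ g x i
  rw [h, hg] at this
  exact X.σ_injective_of_mem_nonDegenerate hx this.symm

theorem isSignCocycle [TopologicalSpace G] [IsTopologicalGroup G] (hR : IsCrossedAction R)
    (hcont : IsContinuousAction G X) {A : Subgroup G}
    (hA : ∀ a ∈ A, ∀ (k : ℕ) (x : X _⦋k⦌), a • x = x) (k : ℕ) :
    letI := hR.nonDegenerateAction k
    IsSignCocycle A fun g (x : X.nonDegenerate k) => (R g x.1).sign := by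
  letI := hR.nonDegenerateAction k
  have hopen : ∀ (m : ℕ) (y : X _⦋m⦌), ∀ᶠ g in 𝓝 (1 : G), g • y = y := by
    intro m y
    letI : TopologicalSpace (X _⦋m⦌) := ⊥
    haveI : DiscreteTopology (X _⦋m⦌) := ⟨rfl⟩
    haveI : ContinuousSMul G (X _⦋m⦌) := hcont m
    have hc : Continuous fun g : G => g • y := by fun_prop
    refine ((isOpen_discrete {y}).preimage hc).mem_nhds ?_
    simp
  refine ⟨fun g h x => ?_, fun a ha x => Subtype.ext (hA a ha k x.1), fun a ha x => ?_, fun x => ?_⟩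
  · rw [hR.map_mul, Equiv.Perm.sign_mul]
    rfl
  · rw [hR.eq_one_of_smul_σ x.2 (hA a ha k x.1) fun i => hA a ha _ _, Equiv.Perm.sign_one]
  -- `x` has finitely many degeneracies, so one neighbourhood of `1` fixes all of them.
  · filter_upwards [hopen k x.1, Filter.eventually_all.2 fun i => hopen _ (X.σ i x.1)] with g h1 h2
    exact ⟨Subtype.ext h1, by rw [hR.eq_one_of_smul_σ x.2 h1 h2, Equiv.Perm.sign_one]⟩

variable [TopologicalSpace G] [IsTopologicalGroup G] {A : Subgroup G}
  {F : Type u} [Field F]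

/-- The representation on the chains of the simplicial set with coefficients in `V`. -/
def chainRep (hR : IsCrossedAction R) (hcont : IsContinuousAction G X)
    (hA : ∀ a ∈ A, ∀ (k : ℕ) (x : X _⦋k⦌), a • x = x) {V : Type u} [AddCommGroup V] [Module F V]
    (ρ : Representation F G V) (k : ℕ) : Representation F G (X.nonDegenerate k →₀ V) :=
  letI := hR.nonDegenerateAction k
  (hR.isSignCocycle hcont hA k).rep ρ

variable {V : Type u} [AddCommGroup V] [Module F V] (ρ : Representation F G V)

theorem chainRep_single (hR : IsCrossedAction R) (hcont : IsContinuousAction G X)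
    (hA : ∀ a ∈ A, ∀ (k : ℕ) (x : X _⦋k⦌), a • x = x) {k : ℕ} (g : G) (x : X.nonDegenerate k)
    (v : V) : hR.chainRep hcont hA ρ k g (Finsupp.single x v) =
      Finsupp.single ⟨g • x.1, (hR.smul_mem_nonDegenerate_iff g).2 x.2⟩
        (((R g x.1).sign : ℤ) • ρ g v) :=
  letI := hR.nonDegenerateAction k
  (hR.isSignCocycle hcont hA k).rep_single ρ g x v

theorem chainRep_simplexChain (hR : IsCrossedAction R) (hcont : IsContinuousAction G X)
    (hA : ∀ a ∈ A, ∀ (k : ℕ) (x : X _⦋k⦌), a • x = x) {k : ℕ} (g : G) (x : X _⦋k⦌)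
    (v : V) : hR.chainRep hcont hA ρ k g (SSet.simplexChain X F V x v) =
      SSet.simplexChain X F V (g • x) (((R g x).sign : ℤ) • ρ g v) := by
  by_cases hx : x ∈ X.nonDegenerate k
  · rw [SSet.simplexChain_of_mem V X ⟨x, hx⟩, chainRep_single]
    exact (SSet.simplexChain_of_mem V X ⟨g • x, (hR.smul_mem_nonDegenerate_iff g).2 hx⟩ _).symm
  · rw [SSet.simplexChain_of_notMem V X hx, SSet.simplexChain_of_notMem V X
      (fun h => hx ((hR.smul_mem_nonDegenerate_iff g).1 h)), map_zero]

/-- Passing from `x` to its `i`-th face changes the sign of `R g x` by `(-1) ^ (i + R g x i)`,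
exactly the change of sign in the alternating sum when faces are reindexed by `R g x`. -/
theorem finsuppD_chainRep (hR : IsCrossedAction R) (hcont : IsContinuousAction G X)
    (hA : ∀ a ∈ A, ∀ (k : ℕ) (x : X _⦋k⦌), a • x = x) (k : ℕ) (g : G) :
    SSet.finsuppD X F V k ∘ₗ hR.chainRep hcont hA ρ (k + 1) g =
      hR.chainRep hcont hA ρ k g ∘ₗ SSet.finsuppD X F V k := by
  ext x v : 2
  simp only [LinearMap.comp_apply, Finsupp.lsingle_apply, chainRep_single, SSet.finsuppD_single,
    map_sum, map_zsmul, chainRep_simplexChain]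
  rw [← Equiv.sum_comp (R g x.1)]
  refine Finset.sum_congr rfl fun i _ => ?_
  rw [← hR.smul_δ, smul_smul, smul_smul]
  congr 1
  have := congrArg (fun u : ℤˣ => (u : ℤ)) (Equiv.Perm.sign_of_succAbove (R g x.1)
    (R g (X.δ i x.1)) i (hR.R_δ g x.1 i))
  simpa using this.symm

theorem finsuppε_chainRep (hR : IsCrossedAction R) (hcont : IsContinuousAction G X)
    (hA : ∀ a ∈ A, ∀ (k : ℕ) (x : X _⦋k⦌), a • x = x) (g : G) :
    SSet.finsuppε X F V ∘ₗ hR.chainRep hcont hA ρ 0 g = ρ g ∘ₗ SSet.finsuppε X F V := by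
  ext x v : 2
  have h : R g x.1 = 1 := Equiv.ext fun i => Fin.ext (by omega)
  simp only [LinearMap.comp_apply, Finsupp.lsingle_apply, chainRep_single, SSet.finsuppε_single,
    h, Equiv.Perm.sign_one, Units.val_one, one_smul]

end IsCrossedAction

end

end SmoothRep

end

/-! ### The chain resolution and the bound on projective dimension -/

noncomputable section

namespace SmoothRep

theorem categoryProjDim_le {C : Type*} [Category C] [HasZeroObject C] [HasZeroMorphisms C] {n : ℕ}
    (h : ∀ V : C, HasProjectiveResolutionLE V n) : categoryProjDim C ≤ n :=
  iSup_le fun V => iInf₂_le n (h V)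

/-- The augmented chains with coefficients in `V` are the resolution. The category enters as a
variable `P` with an equation, so that it can be either of the two in the theorem. -/
theorem categoryProjDim_isInMAKilledBy_le
    {G : Type u} [Group G] [TopologicalSpace G] [IsTopologicalGroup G]
    [LocallyCompactSpace G] [TotallyDisconnectedSpace G] {F : Type u} [Field F]
    {A : Subgroup G} (hA : A ≤ Subgroup.center G) (X : SSet.{u}) (n : ℕ) (hdim : X.HasDimensionLE n)
    (hX : ContractibleSpace (SSet.toTop.obj X)) [∀ k, MulAction G (X _⦋k⦌)]
    (hcont : IsContinuousAction G X)
    (R : ∀ {k : ℕ}, G → X _⦋k⦌ → Equiv.Perm (Fin (k + 1))) (hR : IsCrossedAction R)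
    (hAtriv : ∀ a ∈ A, ∀ (k : ℕ) (x : X _⦋k⦌), a • x = x)
    (hcompact : ∀ (k : ℕ), ∀ x ∈ X.nonDegenerate k, IsCompactModulo A (MulAction.stabilizer G x))
    (hord : ∀ (k : ℕ), ∀ x ∈ X.nonDegenerate k,
      IsOrdinaryModulo F hA (MulAction.stabilizer G x))
    (P : ObjectProperty (Rep.{u} F G)) [P.ContainsZero] (I : Set (MonoidAlgebra F A))
    (hP : isInMAKilledBy A I = P) : categoryProjDim P.FullSubcategory ≤ n := by
  subst hP
  refine categoryProjDim_le fun V => ?_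
  have hstab : ∀ (k : ℕ) (x : X.nonDegenerate k),
      letI := hR.nonDegenerateAction k
      MulAction.stabilizer G x = MulAction.stabilizer G x.1 := by
    intro k x
    ext g
    exact Subtype.ext_iff
  have : X.HasDimensionLT (n + 1) := hdim
  refine hasProjectiveResolutionLE_of_forall
    (fun k => Rep.of (hR.chainRep hcont hAtriv V.obj.ρ k)) (fun k => ?_) ?_
    (fun k => Rep.ofHom ⟨SSet.finsuppD X F V.obj k, hR.finsuppD_chainRep _ hcont hAtriv k⟩)
    (Rep.ofHom ⟨SSet.finsuppε X F V.obj, hR.finsuppε_chainRep _ hcont hAtriv⟩)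
    (fun k => SSet.finsuppD_finsuppD V.obj X k) (SSet.finsuppε_finsuppD V.obj X)
    (SSet.finsuppε_surjective V.obj X) (fun k => SSet.exists_finsuppD_eq V.obj X (n + 1) k)
    (SSet.exists_finsuppD_eq_zero V.obj X (n + 1)) n fun i hi => ?_
  · let _ := hR.nonDegenerateAction k
    exact (hR.isSignCocycle hcont hAtriv k).isInMAKilledBy_rep V.property
  · intro k W W' e hW he f
    let _ := hR.nonDegenerateAction k
    refine (hR.isSignCocycle hcont hAtriv k).exists_lift hA (fun x => ?_) (fun x => ?_)
      V.property.1.1 hW.1 e he f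
    · rw [hstab]
      exact hcompact k x.1 x.2
    · rw [hstab]
      exact hord k x.1 x.2
  -- Normalisation gives the length: there are no non-degenerate simplices above dimension `n`.
  · have : IsEmpty (X.nonDegenerate i) := by
      rw [SSet.nonDegenerate_eq_empty_of_hasDimensionLT X (n + 1) i hi]
      infer_instance
    exact inferInstanceAs (Subsingleton (X.nonDegenerate i →₀ V.obj))

end SmoothRep

end

theorem theorem3
    {G : Type u} [Group G] [TopologicalSpace G] [IsTopologicalGroup G]
    [LocallyCompactSpace G] [TotallyDisconnectedSpace G]
    {F : Type u} [Field F]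
    (A : Subgroup G) (hAclosed : IsClosed (A : Set G)) (hA : A ≤ Subgroup.center G)
    (X : SSet.{u}) (n : ℕ) (hdim : X.HasDimensionLE n)
    (hX : ContractibleSpace (SSet.toTop.obj X))
    [∀ k, MulAction G (X _⦋k⦌)]
    (hcont : SmoothRep.IsContinuousAction G X)
    (R : ∀ {k : ℕ}, G → X _⦋k⦌ → Equiv.Perm (Fin (k + 1)))
    (hR : SmoothRep.IsCrossedAction R)
    (hAtriv : ∀ a ∈ A, ∀ (k : ℕ) (x : X _⦋k⦌), a • x = x)
    (hcompact : ∀ (k : ℕ), ∀ x ∈ X.nonDegenerate k,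
      SmoothRep.IsCompactModulo A (MulAction.stabilizer G x))
    (hord : ∀ (k : ℕ), ∀ x ∈ X.nonDegenerate k,
      SmoothRep.IsOrdinaryModulo F hA (MulAction.stabilizer G x)) :
    (∀ {Ft : Type u} [Field Ft] [Algebra F Ft] (χ : A →* Ftˣ),
      SmoothRep.IsIrrCharacter (F := F) χ →
        SmoothRep.categoryProjDim (SmoothRep.MAChar F χ) ≤ n) ∧
    SmoothRep.categoryProjDim (SmoothRep.MA F A) ≤ n :=
  ⟨fun _ hχ => SmoothRep.categoryProjDim_isInMAKilledBy_le hA X n hdim hX hcont R hR hAtriv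
      hcompact hord _ _ (SmoothRep.isInMAKilledBy_ker hχ),
    SmoothRep.categoryProjDim_isInMAKilledBy_le hA X n hdim hX hcont R hR hAtriv hcompact hord _ _
      (SmoothRep.isInMAKilledBy_empty A)⟩
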